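/- **Non-chiral VOAs.** A non-chiral vertex operator algebra of central charge $(c,\bar c)$ is an $\mathbb R\times\mathbb R$-graded complex vector space $V=\coprod V_{(h,\bar h)}$ with vectors $\mathbf 1\in V_{(0,0)}$, $\omega\in V_{(2,0)}$, $\bar\omega\in V_{(0,2)}$ and a linear map $u\mapsto Y_V(u,x,\bar x)=\sum_{m,n\in\mathbb R}u_{m,n}x^{-m-1}\bar x^{-n-1}$, $u_{m,n}\in\mathrm{End}(V)$, such that: $Y_V(\mathbf 1,x,\bar x)=1$; all $V_{(h,\bar h)}$ are finite-dimensional, and vanish if $h<M$ or $\bar h<M$ for some fixed $M\in\mathbb R$; $h-\bar h\in\mathbb Z$ whenever $V_{(h,\bar h)}\neq0$; $Y_V(v,x,\bar x)\mathbf 1$ has only non-negative powers of $x,\bar x$ and constant term $v$; $Y_V(\omega,x,\bar x)=\sum_{n\in\mathbb Z}L(n)x^{-n-2}$ and $Y_V(\bar\omega,x,\bar x)=\sum_{n\in\mathbb Z}\bar L(n)\bar x^{-n-2}$, where $L$, $\bar L$ satisfy commuting Virasoro algebras of central charges $c,\bar c$; $L(0)=h$ and $\bar L(0)=\bar h$ on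 $V_{(h,\bar h)}$; $[L(0),Y_V(u)]=x\partial_xY_V(u)+Y_V(L(0)u)$, $[L(-1),Y_V(u)]=Y_V(L(-1)u)=\partial_xY_V(u)$ and the same with bars; and *locality*: for $u_1,\dots,u_n\in V$ there is an operator-valued function $m_n$ of $(z_i,\bar z_i)$ on $\{z_i,\bar z_i\ne0,\ z_i\neq z_j,\ \bar z_i\ne\bar z_j\}\subset\mathbb C^{2n}$, multi-valued analytic in independent $z_i,\bar z_i$ and single-valued where the $\bar z_i$ are the complex conjugates of the $z_i$, to which (for conjugate $\bar z_i$) each product $Y_V(u_{\sigma(1)},z_{\sigma(1)},\bar z_{\sigma(1)})\cdots Y_V(u_{\sigma(n)},z_{\sigma(n)},\bar z_{\sigma(n)})$, $\sigma\in S_n$, converges absolutely (in matrix elements) for $|z_{\sigma(1)}|>\dots>|z_{\sigma(n)}|>0$. **Modules.** A module is a $\mathbb C\times\mathbb C$-graded space $W$ with a linear map $u\mapsto Y_W(u,x,\bar x)=\sum_{m,n\in\mathbb C}u^W_{m,n}x^{-m-1}\bar x^{-n-1}$ ($u\in V$) with the same properties except creation (with $L^W,\bar L^W$ the modes of $\omega,\bar\omega$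 on $W$, each satisfying the Virasoro algebra of central charge $c$, resp. $\bar c$, and the bounds imposed on $\mathrm{Re}\,h$, $\mathrm{Re}\,\bar h$), and with *duality*: $Y_W(u_1,z_1,\bar z_1)Y_W(u_2,z_2,\bar z_2)$, $Y_W(u_2,z_2,\bar z_2)Y_W(u_1,z_1,\bar z_1)$ and $Y_W(Y_V(u_1,z_1-z_2,\bar z_1-\bar z_2)u_2,z_2,\bar z_2)$ are the expansions, for $|z_1|>|z_2|>0$, $|z_2|>|z_1|>0$ and $|z_2|>|z_1-z_2|>0$, of one function of this kind, linear in $u_1,u_2$. **Chiral vectors.** A vector $u\in V$ is chiral (anti-chiral) if $Y_V(u,x,\bar x)$ depends only on $x$ (only on $\bar x$). For homogeneous chiral $u\in V_{(h,\bar h)}$ let $x_n(u)$ be the coefficient of $x^{-n-(h-\bar h)}$ in $Y_V(u,x)$; for homogeneous anti-chiral $v\in V_{(h',\bar h')}$ let $\bar x_n(v)$ be the coefficient of $\bar x^{-n-(\bar h'-h')}$ in $Y_V(v,\bar x)$. On a module, $x^W_n(u)$ and $\bar x^W_n(v)$ are the same coefficients of $Y_W$. Binomial coefficients are $\binom sr=s(s-1)\cdots(s-r+1)/r!$.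 **Theorem.** Let $V$ be a non-chiral VOA, let $u_i\in V_{(h_i,\bar h_i)}$, $u_j\in V_{(h_j,\bar h_j)}$ be chiral and $v_i\in V_{(h'_i,\bar h'_i)}$, $v_j\in V_{(h'_j,\bar h'_j)}$ anti-chiral, and put $\Delta_i=h_i-\bar h_i$, $\Delta'_i=\bar h'_i-h'_i$. Then for all $n,k,m,p\in\mathbb Z$ and $m_+\in\mathbb Z_{\ge0}$: 1. $Y_V(u_i,x)=\sum_{n\in\mathbb Z}x_n(u_i)x^{-n-\Delta_i}$ and $Y_V(v_i,\bar x)=\sum_{n\in\mathbb Z}\bar x_n(v_i)\bar x^{-n-\Delta'_i}$. 2. $x_p(u_i)u_j$ is chiral, in $V_{(h_j-p+\bar h_i,\ \bar h_i+\bar h_j)}$, and $\bar x_p(v_i)v_j$ is anti-chiral, in $V_{(h'_i+h'_j,\ \bar h'_j-p+h'_i)}$. 3. The following hold, where each sum over $p$ has only finitely many non-zero terms: $$[x_n(u_i),x_k(u_j)]=\sum_{p\ge1-\Delta_i}\binom{n+\Delta_i-1}{p+\Delta_i-1}x_{k+n}(x_p(u_i)u_j),$$ $$[\bar x_n(v_i),\bar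 x_k(v_j)]=\sum_{p\ge1-\Delta'_i}\binom{n+\Delta'_i-1}{p+\Delta'_i-1}\bar x_{k+n}(\bar x_p(v_i)v_j),\qquad [x_n(u_i),\bar x_k(v_j)]=0.$$ 4. In particular $[L(n),x_k(u_i)]=\sum_{p\ge-1}\binom{n+1}{p+1}x_{k+n}(L(p)u_i)$, $[\bar L(n),x_k(u_i)]=0$, $[\bar L(n),\bar x_k(v_i)]=\sum_{p\ge-1}\binom{n+1}{p+1}\bar x_{k+n}(\bar L(p)v_i)$ and $[L(n),\bar x_k(v_i)]=0$. 5. (Borcherds identities; each sum over $r$ has finitely many non-zero terms on every vector.) $$\sum_{r\ge0}\binom mr\Big((-1)^rx_{n+m-r}(u_i)x_{k+r}(u_j)-(-1)^{m+r}x_{k+m-r}(u_j)x_{n+r}(u_i)\Big)=\sum_{p\ge1-\Delta_i}\binom{n+\Delta_i-1}{p+\Delta_i-1}x_{k+n+m+\bar h_i-\bar h_j}(x_{p+m}(u_i)u_j),$$ $$\sum_{r\ge0}\binom mr\Big((-1)^r\bar x_{n+m-r}(v_i)\bar x_{k+r}(v_j)-(-1)^{m+r}\bar x_{k+m-r}(v_j)\bar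 x_{n+r}(v_i)\Big)=\sum_{p\ge1-\Delta'_i}\binom{n+\Delta'_i-1}{p+\Delta'_i-1}\bar x_{k+n+m+h'_i-h'_j}(\bar x_{p+m}(v_i)v_j),$$ $$\sum_{r\ge0}\binom{m_+}r\Big((-1)^rx_{n+m_+-r}(u_i)\bar x_{k+r}(v_j)-(-1)^{m_++r}\bar x_{k+m_+-r}(v_j)x_{n+r}(u_i)\Big)=0.$$ 6. The span of the modes $x_n(u)$, $n\in\mathbb Z$, of homogeneous chiral vectors $u$ and the span of the modes $\bar x_n(v)$, $n\in\mathbb Z$, of homogeneous anti-chiral vectors $v$ are closed under the commutator, and they commute with each other. For every $V$-module $W$, statements 1 and 3–6 also hold with $Y_W$, $x^W$, $\bar x^W$, $L^W(n)$, $\bar L^W(n)$ in place of $Y_V$, $x$, $\bar x$, $L(n)$, $\bar L(n)$ for the operators on $W$; the vectors $x_p(u_i)u_j$, $x_{p+m}(u_i)u_j$, $L(p)u_i$ of $V$, and their anti-chiral analogues, are formed in $V$ as before. -/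

import Mathlib

open Filter Topology

noncomputable section

namespace NCVOA

/-! ### Formal sums with finitely many non-zero terms -/

/-- The series `∑ i, f i` has only finitely many non-zero terms and its value is `s`. -/
def HasFiniteSum {M : Type*} [AddCommMonoid M] (f : ℕ → M) (s : M) : Prop :=
  (Function.support f).Finite ∧ ∑ᶠ i, f i = s

/-! ### Graded spaces -/

/-- The contragredient `V' = ∐ V'_a` of a graded space `V = ∐ V_a`: the linear functionals on `V`
which vanish on all but finitely many of the homogeneous subspaces. -/
def contragredient {ι V : Type*} [AddCommGroup V] [Module ℂ V] (gr : ι → Submodule ℂ V) :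
    Submodule ℂ (Module.Dual ℂ V) where
  carrier := {f | {a | ∃ v ∈ gr a, f v ≠ 0}.Finite}
  zero_mem' := by simp
  add_mem' := by
    intro f g hf hg
    refine (Set.Finite.union hf hg).subset ?_
    rintro a ⟨v, hv, hne⟩
    by_cases h : f v = 0
    · right
      refine ⟨v, hv, fun hg0 => hne ?_⟩
      simp [h, hg0]
    · exact Or.inl ⟨v, hv, h⟩
  smul_mem' := by
    intro c f hf
    refine Set.Finite.subset hf ?_
    rintro a ⟨v, hv, hne⟩
    refine ⟨v, hv, fun h => hne ?_⟩
    simp [h]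

/-! ### Correlation functions -/

/-- `z ^ a * z̄ ^ b`, where `z̄` is the complex conjugate of `z ≠ 0` and `log z̄` is the conjugate
of `log z`. It does not depend on the branch of `log z` if `a - b ∈ ℤ`. -/
def conjPow (a b z : ℂ) : ℂ :=
  Complex.exp (a * Complex.log z + b * (starRingEnd ℂ) (Complex.log z))

/-- Configurations of `n` distinct non-zero complex numbers. -/
def Conf (n : ℕ) : Set (Fin n → ℂ) :=
  {z | (∀ i, z i ≠ 0) ∧ Function.Injective z}

/-- The point `(z, z̄)` of `ℂⁿ × ℂⁿ`, with `z̄` the complex conjugate of `z`. -/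
def conjPt {n : ℕ} (z : Fin n → ℂ) : (Fin n → ℂ) × (Fin n → ℂ) :=
  (z, fun i => (starRingEnd ℂ) (z i))

/-- The germ of `G` at `γ 0` has an analytic continuation along the path `γ`. -/
def ContinuesAlong {E : Type*} [NormedAddCommGroup E] [NormedSpace ℂ E]
    (γ : C(unitInterval, E)) (G : E → ℂ) : Prop :=
  ∃ F : unitInterval → E → ℂ,
    F 0 =ᶠ[𝓝 (γ 0)] G ∧
    ∀ t, AnalyticAt ℂ (F t) (γ t) ∧ ∀ᶠ s in 𝓝 t, F s =ᶠ[𝓝 (γ s)] F t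

/-- `g` is the (single-valued) restriction to the points `(z, z̄)` with `z̄` conjugate to `z` of a
multi-valued analytic function of independent variables `z₁, …, zₙ, z̄₁, …, z̄ₙ`, which are
subject to `zᵢ, z̄ᵢ ≠ 0`, `zᵢ ≠ zⱼ`, `z̄ᵢ ≠ z̄ⱼ`: near every such point, `g` is the restriction of
an analytic germ in `2n` variables, which continues along every path in that domain. -/
def IsCorrelationFunction {n : ℕ} (g : (Fin n → ℂ) → ℂ) : Prop :=
  ∀ z ∈ Conf n, ∃ G : (Fin n → ℂ) × (Fin n → ℂ) → ℂ,
    AnalyticAt ℂ G (conjPt z) ∧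
    (∀ᶠ y in 𝓝 z, G (conjPt y) = g y) ∧
    ∀ γ : C(unitInterval, (Fin n → ℂ) × (Fin n → ℂ)),
      γ 0 = conjPt z → (∀ t, (γ t).1 ∈ Conf n ∧ (γ t).2 ∈ Conf n) → ContinuesAlong γ G

section Products

variable {K V W : Type*} [Field K] [Algebra K ℂ] [AddCommGroup V] [Module ℂ V]
  [AddCommGroup W] [Module ℂ W]

/-- A vertex operator map is given by its modes: `Y u m n = u_{m,n}` is the coefficient of
`x ^ (-m-1) * x̄ ^ (-n-1)` in `Y(u, x, x̄)`. This is the factor `z ^ (-m-1) * z̄ ^ (-n-1)` with `z̄`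
the conjugate of `z`. -/
def modePow (k : K × K) (z : ℂ) : ℂ :=
  conjPow (-(algebraMap K ℂ k.1) - 1) (-(algebraMap K ℂ k.2) - 1) z

/-- The terms of the matrix element `⟨f, Y(u₁, z₁, z̄₁) ⋯ Y(uₙ, zₙ, z̄ₙ) w⟩`, one for every choice
`k` of a mode of each of the `n` vertex operators. -/
def productTerm (Y : V →ₗ[ℂ] (K → K → Module.End ℂ W)) {n : ℕ} (u : Fin n → V) (z : Fin n → ℂ)
    (w : W) (f : Module.Dual ℂ W) (k : Fin n → K × K) : ℂ :=
  f ((List.ofFn fun i => Y (u i) (k i).1 (k i).2).prod w) * ∏ i, modePow (k i) (z i)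

/-- Locality of vertex operators. The operator-valued function `m` has values in
`Hom(W, W̄) = Hom(W, (W')*)`, where `W̄ = ∏ W_a` is the algebraic completion (the homogeneous
subspaces are finite-dimensional), so that `m z w f` is its matrix element. In the domain
`|z_{σ(1)}| > ⋯ > |z_{σ(n)}| > 0`, the product `Y(u_{σ(1)}, z_{σ(1)}, z̄_{σ(1)}) ⋯` converges
absolutely to it. -/
def IsLocal (gr : K × K → Submodule ℂ W) (Y : V →ₗ[ℂ] (K → K → Module.End ℂ W)) : Prop :=
  ∀ (n : ℕ) (u : Fin n → V),
    ∃ m : (Fin n → ℂ) → W →ₗ[ℂ] (contragredient gr →ₗ[ℂ] ℂ),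
      (∀ w f, IsCorrelationFunction fun z => m z w f) ∧
      ∀ (σ : Equiv.Perm (Fin n)) (z : Fin n → ℂ),
        (∀ i, z i ≠ 0) → StrictAnti (fun i => ‖z (σ i)‖) →
        ∀ (w : W) (f : contragredient gr),
          HasSum (productTerm Y (u ∘ σ) (z ∘ σ) w (f : Module.Dual ℂ W)) (m z w f)

end Products

/-! ### Non-chiral vertex operator algebras -/

/-- The central term `c/12 · m (m² - 1) δ_{m+n,0}` of the Virasoro algebra. -/
def virasoroCocycle (c : ℂ) (m n : ℤ) : ℂ :=
  if m + n = 0 then c / 12 * m * ((m : ℂ) ^ 2 - 1) else 0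

/-- A non-chiral vertex operator algebra `(V, Y, ω, ω̄, 𝟏)` of central charge `(c, c̄)`.
`Y u m n = u_{m,n}` is the coefficient of `x ^ (-m-1) * x̄ ^ (-n-1)` in `Y(u, x, x̄)`, and the
identities between formal series are written coefficient by coefficient. -/
structure NonChiralVOA (V : Type*) [AddCommGroup V] [Module ℂ V] where
  c : ℂ
  cbar : ℂ
  /-- the homogeneous subspace `V_{(h, h̄)}` -/
  gr : ℝ × ℝ → Submodule ℂ V
  gr_isInternal : DirectSum.IsInternal gr
  Y : V →ₗ[ℂ] (ℝ → ℝ → Module.End ℂ V)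
  vac : V
  omega : V
  omegabar : V
  vac_mem : vac ∈ gr (0, 0)
  omega_mem : omega ∈ gr (2, 0)
  omegabar_mem : omegabar ∈ gr (0, 2)
  /-- identity property: `Y(𝟏, x, x̄) = 1` -/
  identity : ∀ m n, Y vac m n = if m = -1 ∧ n = -1 then 1 else 0
  finite_dim : ∀ a, FiniteDimensional ℂ (gr a)
  bounded_below : ∃ M : ℝ, ∀ h hb : ℝ, h < M ∨ hb < M → gr (h, hb) = ⊥
  single_valued : ∀ h hb : ℝ, gr (h, hb) ≠ ⊥ → ∃ k : ℤ, h - hb = k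
  /-- creation property: `Y(v, x, x̄) 𝟏` has only non-negative powers of `x`, `x̄` … -/
  creation_nonneg : ∀ v m n, ¬(m ≤ -1 ∧ n ≤ -1) → Y v m n vac = 0
  /-- … and its constant term is `v` -/
  creation_const : ∀ v, Y v (-1) (-1) vac = v
  /-- `L(n)` -/
  L : ℤ → Module.End ℂ V
  /-- `L̄(n)` -/
  Lbar : ℤ → Module.End ℂ V
  /-- `Y(ω, x, x̄) = ∑ L(n) x ^ (-n-2)` -/
  omega_mode : ∀ n : ℤ, Y omega (n + 1) (-1) = L n
  omega_mode_zero : ∀ r s : ℝ, (s ≠ -1 ∨ ∀ n : ℤ, r ≠ n + 1) → Y omega r s = 0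
  /-- `Y(ω̄, x, x̄) = ∑ L̄(n) x̄ ^ (-n-2)` -/
  omegabar_mode : ∀ n : ℤ, Y omegabar (-1) (n + 1) = Lbar n
  omegabar_mode_zero : ∀ r s : ℝ, (r ≠ -1 ∨ ∀ n : ℤ, s ≠ n + 1) → Y omegabar r s = 0
  virasoro : ∀ m n, ⁅L m, L n⁆ = ((m : ℂ) - n) • L (m + n) + virasoroCocycle c m n • 1
  virasoro_bar : ∀ m n,
    ⁅Lbar m, Lbar n⁆ = ((m : ℂ) - n) • Lbar (m + n) + virasoroCocycle cbar m n • 1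
  virasoro_comm : ∀ m n, ⁅L m, Lbar n⁆ = 0
  grading : ∀ h hb, ∀ v ∈ gr (h, hb), L 0 v = (h : ℂ) • v ∧ Lbar 0 v = (hb : ℂ) • v
  L_zero : ∀ u (m n : ℝ), ⁅L 0, Y u m n⁆ = (-(m : ℂ) - 1) • Y u m n + Y (L 0 u) m n
  Lbar_zero : ∀ u (m n : ℝ), ⁅Lbar 0, Y u m n⁆ = (-(n : ℂ) - 1) • Y u m n + Y (Lbar 0 u) m n
  translation : ∀ u (m n : ℝ), ⁅L (-1), Y u m n⁆ = Y (L (-1) u) m n ∧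
    Y (L (-1) u) m n = (-(m : ℂ)) • Y u (m - 1) n
  translation_bar : ∀ u (m n : ℝ), ⁅Lbar (-1), Y u m n⁆ = Y (Lbar (-1) u) m n ∧
    Y (Lbar (-1) u) m n = (-(n : ℂ)) • Y u m (n - 1)
  locality : IsLocal gr Y

namespace NonChiralVOA

variable {V : Type*} [AddCommGroup V] [Module ℂ V] (A : NonChiralVOA V)

/-- `u` is chiral: only the power `x̄ ^ 0` of `x̄` occurs in `Y(u, x, x̄)`. -/
def IsChiral (u : V) : Prop := ∀ m n : ℝ, n ≠ -1 → A.Y u m n = 0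

/-- `u` is anti-chiral: only the power `x ^ 0` of `x` occurs in `Y(u, x, x̄)`. -/
def IsAntiChiral (u : V) : Prop := ∀ m n : ℝ, m ≠ -1 → A.Y u m n = 0

/-- The mode `x_n(u)` of a chiral vector `u` of conformal weight `(h, h̄)`, that is the coefficient
of `x ^ (-n-(h-h̄))` in `Y(u, x)`. -/
def x (h hb : ℝ) (u : V) (n : ℝ) : Module.End ℂ V := A.Y u (n + (h - hb) - 1) (-1)

/-- The mode `x̄_n(v)` of an anti-chiral vector `v` of conformal weight `(h, h̄)`, that is the
coefficient of `x̄ ^ (-n-(h̄-h))` in `Y(v, x̄)`. -/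
def xbar (h hb : ℝ) (v : V) (n : ℝ) : Module.End ℂ V := A.Y v (-1) (n + (hb - h) - 1)

/-- The span of all modes of homogeneous chiral vectors. -/
def chiralAlgebra : Submodule ℂ (Module.End ℂ V) :=
  Submodule.span ℂ {T | ∃ (h hb : ℝ) (u : V) (n : ℤ),
    u ∈ A.gr (h, hb) ∧ A.IsChiral u ∧ T = A.x h hb u n}

/-- The span of all modes of homogeneous anti-chiral vectors. -/
def antiChiralAlgebra : Submodule ℂ (Module.End ℂ V) :=
  Submodule.span ℂ {T | ∃ (h hb : ℝ) (v : V) (n : ℤ),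
    v ∈ A.gr (h, hb) ∧ A.IsAntiChiral v ∧ T = A.xbar h hb v n}

/-- A module `(W, Y_W)` of a non-chiral vertex operator algebra. `Y u m n = u^W_{m,n}` is the
coefficient of `x ^ (-m-1) * x̄ ^ (-n-1)` in `Y_W(u, x, x̄)`. -/
structure VModule (W : Type*) [AddCommGroup W] [Module ℂ W] where
  /-- the homogeneous subspace `W_{(h, h̄)}` -/
  gr : ℂ × ℂ → Submodule ℂ W
  gr_isInternal : DirectSum.IsInternal gr
  Y : V →ₗ[ℂ] (ℂ → ℂ → Module.End ℂ W)
  identity : ∀ m n, Y A.vac m n = if m = -1 ∧ n = -1 then 1 else 0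
  finite_dim : ∀ a, FiniteDimensional ℂ (gr a)
  bounded_below : ∃ M : ℝ, ∀ h hb : ℂ, h.re < M ∨ hb.re < M → gr (h, hb) = ⊥
  single_valued : ∀ h hb : ℂ, gr (h, hb) ≠ ⊥ → ∃ k : ℤ, h - hb = k
  /-- `L^W(n)` -/
  L : ℤ → Module.End ℂ W
  /-- `L̄^W(n)` -/
  Lbar : ℤ → Module.End ℂ W
  omega_mode : ∀ n : ℤ, Y A.omega (n + 1) (-1) = L n
  omega_mode_zero : ∀ r s : ℂ, (s ≠ -1 ∨ ∀ n : ℤ, r ≠ n + 1) → Y A.omega r s = 0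
  omegabar_mode : ∀ n : ℤ, Y A.omegabar (-1) (n + 1) = Lbar n
  omegabar_mode_zero : ∀ r s : ℂ, (r ≠ -1 ∨ ∀ n : ℤ, s ≠ n + 1) → Y A.omegabar r s = 0
  virasoro : ∀ m n, ⁅L m, L n⁆ = ((m : ℂ) - n) • L (m + n) + virasoroCocycle A.c m n • 1
  virasoro_bar : ∀ m n,
    ⁅Lbar m, Lbar n⁆ = ((m : ℂ) - n) • Lbar (m + n) + virasoroCocycle A.cbar m n • 1
  grading : ∀ h hb, ∀ w ∈ gr (h, hb), L 0 w = h • w ∧ Lbar 0 w = hb • w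
  L_zero : ∀ u m n, ⁅L 0, Y u m n⁆ = (-m - 1) • Y u m n + Y (A.L 0 u) m n
  Lbar_zero : ∀ u m n, ⁅Lbar 0, Y u m n⁆ = (-n - 1) • Y u m n + Y (A.Lbar 0 u) m n
  translation : ∀ u m n, ⁅L (-1), Y u m n⁆ = Y (A.L (-1) u) m n ∧
    Y (A.L (-1) u) m n = (-m) • Y u (m - 1) n
  translation_bar : ∀ u m n, ⁅Lbar (-1), Y u m n⁆ = Y (A.Lbar (-1) u) m n ∧
    Y (A.Lbar (-1) u) m n = (-n) • Y u m (n - 1)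
  locality : IsLocal gr Y
  /-- locality and duality: `Y_W(u₁, z₁) Y_W(u₂, z₂)`, `Y_W(u₂, z₂) Y_W(u₁, z₁)` and
  `Y_W(Y_V(u₁, z₁ - z₂) u₂, z₂)` are the expansions of one function, linear in `u₁` and `u₂`, for
  `|z₁| > |z₂| > 0`, `|z₂| > |z₁| > 0` and `|z₂| > |z₁ - z₂| > 0` respectively -/
  duality : ∃ m : V →ₗ[ℂ] V →ₗ[ℂ] ((Fin 2 → ℂ) → W →ₗ[ℂ] (contragredient gr →ₗ[ℂ] ℂ)),
    ∀ (u₁ u₂ : V) (w : W) (f : contragredient gr),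
      IsCorrelationFunction (fun z => m u₁ u₂ z w f) ∧
      (∀ z₁ z₂ : ℂ, ‖z₂‖ < ‖z₁‖ → 0 < ‖z₂‖ →
        HasSum (productTerm Y ![u₁, u₂] ![z₁, z₂] w (f : Module.Dual ℂ W))
          (m u₁ u₂ ![z₁, z₂] w f)) ∧
      (∀ z₁ z₂ : ℂ, ‖z₁‖ < ‖z₂‖ → 0 < ‖z₁‖ →
        HasSum (productTerm Y ![u₂, u₁] ![z₂, z₁] w (f : Module.Dual ℂ W))
          (m u₁ u₂ ![z₁, z₂] w f)) ∧
      (∀ z₁ z₂ : ℂ, ‖z₁ - z₂‖ < ‖z₂‖ → 0 < ‖z₁ - z₂‖ →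
        HasSum (fun k : (ℝ × ℝ) × (ℂ × ℂ) =>
            (f : Module.Dual ℂ W) (Y (A.Y u₁ k.1.1 k.1.2 u₂) k.2.1 k.2.2 w) *
              (modePow k.1 (z₁ - z₂) * modePow k.2 z₂))
          (m u₁ u₂ ![z₁, z₂] w f))

namespace VModule

variable {A} {W : Type*} [AddCommGroup W] [Module ℂ W] (B : A.VModule W)

/-- The mode `x^W_n(u)` of a chiral vector `u` of conformal weight `(h, h̄)`, that is the
coefficient of `x ^ (-n-(h-h̄))` in `Y_W(u, x)`. -/
def x (h hb : ℝ) (u : V) (n : ℝ) : Module.End ℂ W := B.Y u ((n + (h - hb) - 1 : ℝ) : ℂ) (-1)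

/-- The mode `x̄^W_n(v)` of an anti-chiral vector `v` of conformal weight `(h, h̄)`, that is the
coefficient of `x̄ ^ (-n-(h̄-h))` in `Y_W(v, x̄)`. -/
def xbar (h hb : ℝ) (v : V) (n : ℝ) : Module.End ℂ W := B.Y v (-1) ((n + (hb - h) - 1 : ℝ) : ℂ)

/-- The span of all modes on `W` of homogeneous chiral vectors. -/
def chiralAlgebra : Submodule ℂ (Module.End ℂ W) :=
  Submodule.span ℂ {T | ∃ (h hb : ℝ) (u : V) (n : ℤ),
    u ∈ A.gr (h, hb) ∧ A.IsChiral u ∧ T = B.x h hb u n}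

/-- The span of all modes on `W` of homogeneous anti-chiral vectors. -/
def antiChiralAlgebra : Submodule ℂ (Module.End ℂ W) :=
  Submodule.span ℂ {T | ∃ (h hb : ℝ) (v : V) (n : ℤ),
    v ∈ A.gr (h, hb) ∧ A.IsAntiChiral v ∧ T = B.xbar h hb v n}

end VModule

end NonChiralVOA

/-- The generalized binomial coefficient `s (s-1) ⋯ (s-j+1) / j!` for a real number `s`, as a
complex number. -/
def binom (s : ℝ) (j : ℕ) : ℂ := ((Ring.choose s j : ℝ) : ℂ)

end NCVOA

end

/-! Let `u` be chiral, and let `f` be a functional in the contragredient. By locality the two-point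
function `φ(z) = ⟨f, Y(u,z) Y(v,1) y⟩` extends to a single-valued real analytic function on `ℂ ∖ {0,
1}`. For `|z| > 1` it is a convergent Laurent series in `z` alone, so it is holomorphic there. The
Cauchy–Riemann equation then spreads over the connected set `ℂ ∖ {0, 1}` by the identity theorem
(`ChiralModes.differentiableOn`).

The Laurent coefficients of `φ` at `∞`, `0` and `1` are matrix elements of `Y(u)Y(v)`, `Y(v)Y(u)`
and `Y(Y(u)v)`. The pole at `1` has finite order because `u_a v = 0` for large `a`. The residue
theorem for `z^n (z-1)^m φ(z)`, with this factor expanded binomially on three circles, is the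
Borcherds identity (`jacobi_of_expansions`, `IsModeSystem.borcherds`). Placing `v` at `1` loses
nothing: for homogeneous `f` and `y`, a matrix element of `Y(v,1)` collapses to a single mode
(`IsModeSystem.pairing_one`). The commutator formula is the case `m = 0`, and the Virasoro formula
is the commutator with `ω`.

On a module the expansion at `1` is part of the duality axiom. On `V` it has to be derived from
locality (`NonChiralVOA.hasDuality`). With `D = L(-1) + L̄(-1)`, skew-symmetry reads `Y(v,1)y =
exp(D) Y(y,-1)v`. Moving `exp(D)` to the left past `Y(u,z)` shifts `z` to `z - 1`. Locality for `u`
and `y` then exchanges `Y(u,z-1)` with `Y(y,-1)`, and skew-symmetry for `u_a v` gives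
`Y(Y(u,z-1)v,1)y`. Functionals in the contragredient kill high powers of `D`, so all exponentials
are finite sums.

If `v` is anti-chiral, degree counting leaves one monomial in `φ` both for `|z| > 1` and for `|z| <
1`. By holomorphy the two monomials agree, so the modes commute. Applied to `ω̄`, this shows that a
non-zero homogeneous chiral vector has `h̄ = 0`, which reconciles the weights in the stated
formulas. The anti-chiral statements follow by exchanging `x` and `x̄` (`mirror`). -/

namespace NCVOA

/-! ### Laurent coefficients, circle integrals and residues -/

open Complex in
theorem hasSum_choose_mul_pow (m : ℤ) {x : ℂ} (hx : ‖x‖ < 1) :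
    HasSum (fun r : ℕ => Ring.choose (m : ℂ) r * x ^ r) ((1 + x) ^ m) := by
  have h := (Complex.one_add_cpow_hasFPowerSeriesOnBall_zero (a := (m : ℂ))).hasSum
    (y := x) (by simpa [enorm_eq_nnnorm, ← NNReal.coe_lt_one] using hx)
  have e : ∀ y : ℂ, y ^ (m : ℂ) = y ^ m := fun y => Complex.cpow_intCast y m
  simp only [zero_add, e] at h
  refine h.congr_fun ?_
  intro r
  simp [binomialSeries, FormalMultilinearSeries.ofScalars]

theorem circleIntegral_zpow (z₀ : ℂ) {R : ℝ} (hR : 0 < R) (k : ℤ) :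
    (∮ z in C(z₀, R), (z - z₀) ^ k) = if k = -1 then 2 * Real.pi * Complex.I else 0 := by
  split_ifs with h
  · subst h
    simpa using circleIntegral.integral_sub_center_inv z₀ hR.ne'
  · exact circleIntegral.integral_sub_zpow_of_ne h _ _ _

theorem hasSum_circleIntegral {ι : Type*} [Countable ι] {F : ι → ℂ → ℂ} {f : ℂ → ℂ} {z₀ : ℂ}
    {R : ℝ} (hR : 0 < R) (bound : ι → ℝ) (hF : ∀ i, ContinuousOn (F i) (Metric.sphere z₀ R))
    (hb : ∀ i, ∀ z ∈ Metric.sphere z₀ R, ‖F i z‖ ≤ bound i) (hs : Summable bound)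
    (hf : ∀ z ∈ Metric.sphere z₀ R, HasSum (fun i => F i z) (f z)) :
    HasSum (fun i => ∮ z in C(z₀, R), F i z) (∮ z in C(z₀, R), f z) := by
  have hm : ∀ θ, circleMap z₀ R θ ∈ Metric.sphere z₀ R := circleMap_mem_sphere z₀ hR.le
  simp only [circleIntegral]
  refine intervalIntegral.hasSum_integral_of_dominated_convergence (fun i _ => R * bound i)
    ?_ ?_ ?_ ?_ ?_
  · intro i
    have h1 : Continuous fun θ => F i (circleMap z₀ R θ) :=
      (hF i).comp_continuous (continuous_circleMap z₀ R) hm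
    have h2 : Continuous fun θ => deriv (circleMap z₀ R) θ := by
      simp only [deriv_circleMap]
      exact (continuous_circleMap 0 R).mul continuous_const
    exact (h2.smul h1).aestronglyMeasurable
  · intro i
    refine Filter.Eventually.of_forall fun θ _ => ?_
    simp only [deriv_circleMap, smul_eq_mul, norm_mul, norm_circleMap_zero, Complex.norm_I, mul_one,
      abs_of_pos hR]
    exact mul_le_mul_of_nonneg_left (hb i _ (hm θ)) hR.le
  · exact Filter.Eventually.of_forall fun θ _ => hs.mul_left R
  · exact intervalIntegrable_const
  · exact Filter.Eventually.of_forall fun θ _ => (hf _ (hm θ)).const_smul _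

/-- A convergent Laurent expansion on a circle determines the moments of the function. -/
theorem circleIntegral_zpow_mul_of_hasSum {φ : ℂ → ℂ} {c : ℤ → ℂ} {z₀ : ℂ} {R : ℝ} (hR : 0 < R)
    (h : ∀ z ∈ Metric.sphere z₀ R, HasSum (fun a => c a * (z - z₀) ^ (-a - 1)) (φ z)) (s : ℤ) :
    (∮ z in C(z₀, R), (z - z₀) ^ s * φ z) = 2 * Real.pi * Complex.I * c s := by
  have hne : ∀ z ∈ Metric.sphere z₀ R, z - z₀ ≠ 0 := by
    intro z hz h0
    rw [mem_sphere_iff_norm, h0, norm_zero] at hz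
    exact hR.ne hz
  have hz1 : z₀ + R ∈ Metric.sphere z₀ R := by
    simp [abs_of_pos hR]
  -- Convergence at the single point `z₀ + R` is absolute, and the norms of the terms are constant
  -- on the circle. This gives the dominating series.
  have hs : Summable fun a => ‖c a‖ * R ^ (s + (-a - 1)) := by
    have := ((h _ hz1).summable.norm).mul_left (R ^ s)
    refine this.congr fun a => ?_
    simp only [add_sub_cancel_left, norm_mul, norm_zpow, Complex.norm_real, Real.norm_eq_abs,
      abs_of_pos hR]
    rw [zpow_add₀ hR.ne']
    ring
  have key := hasSum_circleIntegral (z₀ := z₀) (F := fun a z => c a * (z - z₀) ^ (s + (-a - 1)))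
    (f := fun z => (z - z₀) ^ s * φ z) hR (fun a => ‖c a‖ * R ^ (s + (-a - 1))) ?_ ?_ hs ?_
  · refine key.unique ?_
    have h2 : (fun a : ℤ => ∮ z in C(z₀, R), c a * (z - z₀) ^ (s + (-a - 1))) =
        fun a => if a = s then 2 * Real.pi * Complex.I * c s else 0 := by
      funext a
      rw [circleIntegral.integral_const_mul, circleIntegral_zpow _ hR]
      by_cases h : a = s
      · subst h
        rw [if_pos (by omega), if_pos rfl, mul_comm]
      · rw [if_neg (by omega), if_neg h, mul_zero]
    rw [h2]
    exact hasSum_ite_eq s _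
  · intro a
    exact continuousOn_const.mul ((continuousOn_id.sub continuousOn_const).zpow₀ _
      fun z hz => Or.inl (hne z hz))
  · intro a z hz
    rw [norm_mul, norm_zpow, mem_sphere_iff_norm.1 hz]
  · intro z hz
    refine ((h z hz).mul_left ((z - z₀) ^ s)).congr_fun ?_
    intro a
    rw [zpow_add₀ (hne z hz)]
    ring

/-- Only `g` is expanded under the integral, with `φ` bounded on the circle. Each term is then a
moment of `φ`, that is, one Laurent coefficient. -/
theorem hasSum_moments {φ g : ℂ → ℂ} {c : ℤ → ℂ} {d : ℕ → ℂ} {e : ℕ → ℤ} {z₀ : ℂ} {R : ℝ}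
    (hR : 0 < R) (hφ : ContinuousOn φ (Metric.sphere z₀ R))
    (h : ∀ z ∈ Metric.sphere z₀ R, HasSum (fun a => c a * (z - z₀) ^ (-a - 1)) (φ z))
    (hg : ∀ z ∈ Metric.sphere z₀ R, HasSum (fun r => d r * (z - z₀) ^ (e r)) (g z)) :
    HasSum (fun r => d r * c (e r))
      ((2 * Real.pi * Complex.I)⁻¹ * ∮ z in C(z₀, R), g z * φ z) := by
  have hne : ∀ z ∈ Metric.sphere z₀ R, z - z₀ ≠ 0 := by
    intro z hz h0
    rw [mem_sphere_iff_norm, h0, norm_zero] at hz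
    exact hR.ne hz
  have hz1 : z₀ + R ∈ Metric.sphere z₀ R := by
    simp [abs_of_pos hR]
  obtain ⟨M, hM⟩ := (isCompact_sphere z₀ R).exists_bound_of_continuousOn hφ
  have hs : Summable fun r => ‖d r‖ * R ^ (e r) * M := by
    refine (((hg _ hz1).summable.norm).mul_right M).congr fun a => ?_
    simp [abs_of_pos hR]
  have key := hasSum_circleIntegral (z₀ := z₀) (F := fun r z => d r * ((z - z₀) ^ (e r) * φ z))
    (f := fun z => g z * φ z) hR _ ?_ ?_ hs ?_
  · have := key.mul_left (2 * Real.pi * Complex.I)⁻¹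
    refine this.congr_fun ?_
    intro r
    rw [circleIntegral.integral_const_mul, circleIntegral_zpow_mul_of_hasSum hR h]
    have := Complex.two_pi_I_ne_zero
    field_simp
  · intro a
    exact continuousOn_const.mul (((continuousOn_id.sub continuousOn_const).zpow₀ _
      fun z hz => Or.inl (hne z hz)).mul hφ)
  · intro a z hz
    rw [norm_mul, norm_mul, norm_zpow, mem_sphere_iff_norm.1 hz, mul_assoc]
    gcongr
    exact hM z hz
  · intro z hz
    refine ((hg z hz).mul_right (φ z)).congr_fun ?_
    intro a
    ring

/-- The circle of radius `2` encloses `0` and `1`, and the two small circles enclose one of them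
each. Induction on the pole order: `η = η(1) + (z - 1) · dslope η 1` lowers the order by one, up to
a pure power of `z - 1`. For order zero this is Cauchy's theorem on an annulus and on a disc. -/
theorem circleIntegral_residue (J : ℕ) : ∀ η : ℂ → ℂ, DifferentiableOn ℂ η {0}ᶜ →
    (∮ z in C(0, 2), (z - 1) ^ (-(J : ℤ)) * η z) - (∮ z in C(0, 1 / 2), (z - 1) ^ (-(J : ℤ)) * η z)
      = ∮ z in C(1, 1 / 2), (z - 1) ^ (-(J : ℤ)) * η z := by
  have open0 : IsOpen ({0}ᶜ : Set ℂ) := isOpen_compl_singleton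
  induction J with
  | zero =>
    intro η hη
    simp only [Nat.cast_zero, neg_zero, zpow_zero, one_mul]
    have h1 : (∮ z in C(0, 2), η z) = ∮ z in C(0, 1 / 2), η z := by
      refine Complex.circleIntegral_eq_of_differentiable_on_annulus_off_countable (by norm_num)
        (by norm_num) Set.countable_empty (hη.continuousOn.mono ?_) ?_
      · rintro z hz rfl
        exact hz.2 (by simp)
      · intro z hz
        refine (hη z ?_).differentiableAt (open0.mem_nhds ?_) <;>
        · rintro rfl
          exact hz.1.2 (by simp)
    have h2 : (∮ z in C(1, 1 / 2), η z) = 0 := by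
      have h0 : ∀ z ∈ Metric.closedBall (1 : ℂ) (1 / 2), z ∈ ({0}ᶜ : Set ℂ) := by
        rintro z hz rfl
        norm_num at hz
      refine Complex.circleIntegral_eq_zero_of_differentiable_on_off_countable (by norm_num)
        Set.countable_empty (hη.continuousOn.mono h0) fun z hz => ?_
      have := h0 z (Metric.ball_subset_closedBall hz.1)
      exact (hη z this).differentiableAt (open0.mem_nhds this)
    rw [h1, h2, sub_self]
  | succ J ih =>
    intro η hη
    have hd : DifferentiableOn ℂ (dslope η 1) {0}ᶜ :=
      (Complex.differentiableOn_dslope (open0.mem_nhds (by simp))).2 hη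
    have key : ∀ (z₀ : ℂ) (R : ℝ), 0 < R → (∀ z ∈ Metric.sphere z₀ R, z ≠ 0 ∧ z ≠ 1) →
        (∮ z in C(z₀, R), (z - 1) ^ (-((J + 1 : ℕ) : ℤ)) * η z) =
        η 1 * (∮ z in C(z₀, R), (z - 1) ^ (-((J + 1 : ℕ) : ℤ))) +
          ∮ z in C(z₀, R), (z - 1) ^ (-(J : ℤ)) * dslope η 1 z := by
      intro z₀ R hR hs
      have c1 : ∀ k : ℤ, ContinuousOn (fun z : ℂ => (z - 1) ^ k) (Metric.sphere z₀ R) := fun k =>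
        (continuousOn_id.sub continuousOn_const).zpow₀ _
          fun z hz => Or.inl (sub_ne_zero.2 (hs z hz).2)
      have c2 : ContinuousOn (dslope η 1) (Metric.sphere z₀ R) :=
        hd.continuousOn.mono fun z hz => (hs z hz).1
      rw [← circleIntegral.integral_const_mul, ← circleIntegral.integral_add]
      · refine circleIntegral.integral_congr hR.le fun z hz => ?_
        have h1 : z - 1 ≠ 0 := sub_ne_zero.2 (hs z hz).2
        have h2 : η z = η 1 + (z - 1) * dslope η 1 z := by
          rw [dslope_of_ne _ (hs z hz).2, slope_def_field]
          field_simp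
          ring
        have h3 : (z - 1) ^ (-(J : ℤ)) = (z - 1) ^ (-((J + 1 : ℕ) : ℤ)) * (z - 1) := by
          rw [← zpow_add_one₀ h1]
          congr 1
          push_cast
          ring
        simp only [h3]
        rw [h2]
        ring
      · exact (continuousOn_const.mul (c1 _)).circleIntegrable hR.le
      · exact ((c1 _).mul c2).circleIntegrable hR.le
    rw [key 0 2 (by norm_num), key 0 (1 / 2) (by norm_num), key 1 (1 / 2) (by norm_num)]
    · have ih := ih _ hd
      -- A pure power of `z - 1` integrates to zero on all three circles unless the exponent is
      -- `-1`. In that case only the circles enclosing `1` contribute, with equal values.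
      have e : (∮ z in C(0, 2), (z - 1) ^ (-((J + 1 : ℕ) : ℤ))) -
          (∮ z in C(0, 1 / 2), (z - 1) ^ (-((J + 1 : ℕ) : ℤ))) =
          ∮ z in C(1, 1 / 2), (z - 1) ^ (-((J + 1 : ℕ) : ℤ)) := by
        by_cases hJ : (-((J + 1 : ℕ) : ℤ)) = -1
        · rw [hJ]
          simp only [zpow_neg_one]
          rw [circleIntegral.integral_sub_inv_of_mem_ball (R := 2) (by simp),
            circleIntegral.integral_sub_inv_of_mem_ball (c := 1) (by simp)]
          rw [sub_eq_self]
          have h0 : ∀ z ∈ Metric.closedBall (0 : ℂ) (1 / 2), z - 1 ≠ 0 := by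
            intro z hz h
            rw [sub_eq_zero.1 h] at hz
            norm_num at hz
          refine Complex.circleIntegral_eq_zero_of_differentiable_on_off_countable (by norm_num)
            Set.countable_empty ?_ fun z hz => ?_
          · exact (continuousOn_id.sub continuousOn_const).inv₀ h0
          · exact (differentiableAt_id.sub_const _).inv
              (h0 z (Metric.ball_subset_closedBall hz.1))
        · simp only [circleIntegral.integral_sub_zpow_of_ne hJ, sub_zero]
      linear_combination ih + η 1 * e
    · intro z hz
      constructor
      · rintro rfl
        norm_num at hz
      · rintro rfl
        norm_num at hz
    · intro z hz
      constructor
      · rintro rfl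
        norm_num at hz
      · rintro rfl
        norm_num at hz
    · intro z hz
      constructor
      · rintro rfl
        norm_num at hz
      · rintro rfl
        norm_num at hz

/-- A function which is real analytic on a connected open set, and holomorphic near one point, is
holomorphic. -/
theorem differentiableOn_of_analyticOnNhd_real {φ : ℂ → ℂ} {U : Set ℂ} (hU : IsPreconnected U)
    (hφ : AnalyticOnNhd ℝ φ U) {z₀ : ℂ} (hz₀ : z₀ ∈ U)
    (hd : ∀ᶠ z in 𝓝 z₀, DifferentiableAt ℂ φ z) : DifferentiableOn ℂ φ U := by
  have h1 : AnalyticOnNhd ℝ (fderiv ℝ φ) U := hφ.fderiv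
  have h2 : ∀ v : ℂ, AnalyticOnNhd ℝ (fun z => fderiv ℝ φ z v) U := fun v z hz =>
    ((ContinuousLinearMap.apply ℝ ℂ v).analyticAt _).comp (h1 z hz)
  have h3 : AnalyticOnNhd ℝ (fun z => Complex.I • fderiv ℝ φ z 1) U := fun z hz =>
    analyticAt_const.fun_smul (h2 1 z hz)
  -- The Cauchy–Riemann equation equates two real analytic functions, so it propagates from a
  -- neighbourhood of `z₀` to all of `U`.
  have key := (h2 Complex.I).eqOn_of_preconnected_of_eventuallyEq h3 hU hz₀ ?_
  · intro z hz
    refine DifferentiableAt.differentiableWithinAt ?_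
    exact differentiableAt_complex_iff_differentiableAt_real.2
      ⟨(hφ z hz).differentiableAt, key hz⟩
  · filter_upwards [hd] with z hz
    exact (differentiableAt_complex_iff_differentiableAt_real.1 hz).2

/-- On an annulus `r1 < |z| < r2` each term is bounded by its size at `r1` or at `r2`, according to
the sign of the exponent. The sum of both bounds is summable, so the Weierstrass theorem applies. -/
theorem differentiableAt_of_hasSum_zpow {φ : ℂ → ℂ} {c : ℤ → ℂ} {r : ℝ} (hr : 0 ≤ r)
    (h : ∀ z : ℂ, r < ‖z‖ → HasSum (fun a => c a * z ^ (-a - 1)) (φ z)) {z₀ : ℂ}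
    (hz₀ : r < ‖z₀‖) : DifferentiableAt ℂ φ z₀ := by
  obtain ⟨r1, hr1, hr1'⟩ := exists_between hz₀
  have hp : 0 < r1 := hr.trans_lt hr1
  obtain ⟨r2, hr2⟩ := exists_gt ‖z₀‖
  have hp2 : 0 < r2 := (hp.trans hr1').trans hr2
  set U : Set ℂ := {z | r1 < ‖z‖ ∧ ‖z‖ < r2}
  have hU : IsOpen U := (isOpen_lt continuous_const continuous_norm).inter
    (isOpen_lt continuous_norm continuous_const)
  have hs : ∀ R : ℝ, r < R → Summable fun a => ‖c a‖ * R ^ (-a - 1) := by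
    intro R hR
    have hR0 : 0 < R := hr.trans_lt hR
    refine (h (R : ℂ) (by simpa [abs_of_pos hR0] using hR)).summable.norm.congr fun a => ?_
    simp [abs_of_pos hR0]
  have hz : ∀ z ∈ U, z ≠ 0 := by
    rintro z hz rfl
    exact absurd hz.1 (by simpa using hp.le)
  have key : DifferentiableOn ℂ (fun z => ∑' a, c a * z ^ (-a - 1)) U := by
    refine Complex.differentiableOn_tsum_of_summable_norm
      ((hs r1 hr1).add (hs r2 (hr1.trans (hr1'.trans hr2)))) ?_ hU ?_
    · intro a z hzU
      exact ((differentiableAt_id.zpow (Or.inl (hz z hzU))).const_mul _).differentiableWithinAt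
    · intro a z hzU
      have hz0 : 0 < ‖z‖ := hp.trans hzU.1
      rw [norm_mul, norm_zpow, ← mul_add]
      refine mul_le_mul_of_nonneg_left ?_ (norm_nonneg _)
      rcases le_total 0 (-a - 1) with h0 | h0
      · have h1 := zpow_le_zpow_left₀ h0 hz0.le hzU.2.le
        have h2 : 0 < r1 ^ (-a - 1) := zpow_pos hp _
        linarith
      · have h1 : ‖z‖ ^ (-a - 1) ≤ r1 ^ (-a - 1) := by
          have := zpow_le_zpow_left₀ (neg_nonneg.2 h0) hp.le hzU.1.le
          rw [zpow_neg, zpow_neg] at this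
          exact (inv_le_inv₀ (zpow_pos hp _) (zpow_pos hz0 _)).1 this
        have h2 : 0 < r2 ^ (-a - 1) := zpow_pos hp2 _
        linarith
  have hmem : z₀ ∈ U := ⟨hr1', hr2⟩
  refine ((key z₀ hmem).differentiableAt (hU.mem_nhds hmem)).congr_of_eventuallyEq ?_
  filter_upwards [hU.mem_nhds hmem] with z hzU
  exact (h z (hr1.trans hzU.1)).tsum_eq.symm

theorem isPreconnected_compl_pair (a b : ℂ) : IsPreconnected ({a, b}ᶜ : Set ℂ) :=
  ((((Set.finite_singleton b).insert a).countable).isPathConnected_compl_of_one_lt_rank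
    (by rw [Complex.rank_real_complex]; exact Cardinal.one_lt_two)).isConnected.isPreconnected

theorem isOpen_compl_pair (a b : ℂ) : IsOpen ({a, b}ᶜ : Set ℂ) :=
  ((Set.finite_singleton b).insert a).isClosed.isOpen_compl

theorem eqOn_compl_pair {φ ψ : ℂ → ℂ} {a b : ℂ} (hφ : DifferentiableOn ℂ φ {a, b}ᶜ)
    (hψ : DifferentiableOn ℂ ψ {a, b}ᶜ) {z₀ : ℂ} (hz₀ : z₀ ∈ ({a, b}ᶜ : Set ℂ))
    (h : ∀ᶠ z in 𝓝 z₀, φ z = ψ z) : Set.EqOn φ ψ {a, b}ᶜ :=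
  (hφ.analyticOnNhd (isOpen_compl_pair a b)).eqOn_of_preconnected_of_eventuallyEq
    (hψ.analyticOnNhd (isOpen_compl_pair a b)) (isPreconnected_compl_pair a b) hz₀ h

/-- Multiplication by a power of `z - 1` removes a pole at `1`. -/
theorem exists_removable {φ : ℂ → ℂ} (hφ : DifferentiableOn ℂ φ {0, 1}ᶜ) {C : ℤ → ℂ}
    (hC : ∀ z : ℂ, 0 < ‖z - 1‖ → ‖z - 1‖ < 1 →
      HasSum (fun a => C a * (z - 1) ^ (-a - 1)) (φ z))
    {k : ℤ} (hk : ∀ a, k ≤ a → C a = 0) (n : ℤ) :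
    ∃ η : ℂ → ℂ, DifferentiableOn ℂ η {0}ᶜ ∧ ∀ z ≠ 1, η z = z ^ n * (z - 1) ^ k * φ z := by
  set ψ : ℂ → ℂ := fun z => z ^ n * ((z - 1) ^ k * φ z) with hψ
  have hd : DifferentiableOn ℂ ψ ({0}ᶜ \ {1}) := by
    intro z hz
    have h0 : z ≠ 0 := hz.1
    have h1 : z - 1 ≠ 0 := sub_ne_zero.2 hz.2
    have h2 : z ∈ ({0, 1}ᶜ : Set ℂ) := by simpa using ⟨h0, hz.2⟩
    have d1 : DifferentiableAt ℂ (fun z : ℂ => z ^ n) z := differentiableAt_id.zpow (Or.inl h0)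
    have d2 : DifferentiableAt ℂ (fun z : ℂ => (z - 1) ^ k) z :=
      (differentiableAt_id.sub_const 1).zpow (Or.inl h1)
    have d3 := (hφ z h2).differentiableAt ((isOpen_compl_pair 0 1).mem_nhds h2)
    exact (d1.mul (d2.mul d3)).differentiableWithinAt
  have hb : IsBoundedUnder (· ≤ ·) (𝓝[≠] (1 : ℂ)) (norm ∘ fun z => ψ z - ψ 1) := by
    have hs : Summable fun a => ‖C a‖ * (1 / 2 : ℝ) ^ (k + (-a - 1)) := by
      have h := (hC (3 / 2) (by norm_num) (by norm_num)).summable.norm.mul_left ((1 / 2 : ℝ) ^ k)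
      refine h.congr fun a => ?_
      rw [norm_mul, norm_zpow, zpow_add₀ (by norm_num)]
      norm_num
      ring
    -- Only indices `a < k` survive, so `(z - 1) ^ k * φ z` has exponents `k - a - 1 ≥ 0` and is
    -- dominated by its terms at radius `1 / 2`.
    have hb1 : ∀ z : ℂ, z ≠ 1 → ‖z - 1‖ ≤ 1 / 2 →
        ‖(z - 1) ^ k * φ z‖ ≤ ∑' a, ‖C a‖ * (1 / 2 : ℝ) ^ (k + (-a - 1)) := by
      intro z hz1 hz
      have hz0 : z - 1 ≠ 0 := sub_ne_zero.2 hz1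
      have h := (hC z (norm_pos_iff.2 hz0) (by linarith)).mul_left ((z - 1) ^ k)
      rw [← h.tsum_eq]
      refine tsum_of_norm_bounded hs.hasSum fun a => ?_
      rw [mul_left_comm, ← zpow_add₀ hz0, norm_mul, norm_zpow]
      by_cases ha : k ≤ a
      · simp [hk a ha]
      · exact mul_le_mul_of_nonneg_left
          (zpow_le_zpow_left₀ (by omega) (norm_nonneg _) hz) (norm_nonneg _)
    have hc : ContinuousAt (fun z : ℂ => ‖z ^ n‖) 1 :=
      (continuousAt_id.zpow₀ n (Or.inl one_ne_zero)).norm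
    have hlt : ∀ᶠ z in 𝓝 (1 : ℂ), ‖z ^ n‖ < 2 :=
      hc.eventually (gt_mem_nhds (by simp))
    refine isBoundedUnder_of_eventually_le
      (a := 2 * (∑' a, ‖C a‖ * (1 / 2 : ℝ) ^ (k + (-a - 1))) + ‖ψ 1‖) ?_
    have hball : ∀ᶠ z in 𝓝 (1 : ℂ), ‖z - 1‖ ≤ 1 / 2 := by
      filter_upwards [Metric.closedBall_mem_nhds (1 : ℂ) (by norm_num : (0 : ℝ) < 1 / 2)] with z hz
      exact mem_closedBall_iff_norm.1 hz
    filter_upwards [self_mem_nhdsWithin, nhdsWithin_le_nhds hlt, nhdsWithin_le_nhds hball]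
      with z hz1 hz2 hz3
    refine (norm_sub_le _ _).trans (add_le_add_left ?_ _)
    rw [hψ]
    simp only [norm_mul (z ^ n)]
    exact mul_le_mul hz2.le (hb1 z hz1 hz3) (norm_nonneg _) (by norm_num)
  refine ⟨_, Complex.differentiableOn_update_limUnder_of_isLittleO
    (isOpen_compl_singleton.mem_nhds (by simp)) hd hb.isLittleO_sub_self_inv, fun z hz => ?_⟩
  rw [Function.update_of_ne hz, hψ, mul_assoc]

/-- The residue theorem for `z ^ n * (z - 1) ^ m * φ z`, in terms of the Laurent coefficients of
`φ` at `∞`, `0` and `1`. -/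
theorem jacobi_of_expansions {φ : ℂ → ℂ} (hφ : DifferentiableOn ℂ φ {0, 1}ᶜ) {A B C : ℤ → ℂ}
    (hA : ∀ z : ℂ, 1 < ‖z‖ → HasSum (fun a => A a * z ^ (-a - 1)) (φ z))
    (hB : ∀ z : ℂ, 0 < ‖z‖ → ‖z‖ < 1 → HasSum (fun a => B a * z ^ (-a - 1)) (φ z))
    (hC : ∀ z : ℂ, 0 < ‖z - 1‖ → ‖z - 1‖ < 1 →
      HasSum (fun a => C a * (z - 1) ^ (-a - 1)) (φ z))
    {k : ℤ} (hk : ∀ a, k ≤ a → C a = 0) (n m : ℤ) :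
    ∃ I₁ I₂ I₃ : ℂ,
      HasSum (fun r : ℕ => Ring.choose (m : ℂ) r * (-1) ^ r * A (n + m - r)) I₁ ∧
      HasSum (fun r : ℕ => Ring.choose (m : ℂ) r * (-1) ^ (m + r) * B (n + r)) I₂ ∧
      HasSum (fun j : ℕ => Ring.choose (n : ℂ) j * C (m + j)) I₃ ∧ I₁ - I₂ = I₃ := by
  have hc : ∀ (z₀ : ℂ) (R : ℝ), (∀ z ∈ Metric.sphere z₀ R, z ≠ 0 ∧ z ≠ 1) →
      ContinuousOn φ (Metric.sphere z₀ R) := fun z₀ R h =>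
    hφ.continuousOn.mono fun z hz => by simpa using h z hz
  have s1 : ∀ z ∈ Metric.sphere (0 : ℂ) 2, z ≠ 0 ∧ z ≠ 1 := by
    intro z hz
    constructor <;> rintro rfl <;> norm_num at hz
  have s2 : ∀ z ∈ Metric.sphere (0 : ℂ) (1 / 2), z ≠ 0 ∧ z ≠ 1 := by
    intro z hz
    constructor <;> rintro rfl <;> norm_num at hz
  have s3 : ∀ z ∈ Metric.sphere (1 : ℂ) (1 / 2), z ≠ 0 ∧ z ≠ 1 := by
    intro z hz
    constructor <;> rintro rfl <;> norm_num at hz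
  -- On `|z| = 2`: `(z - 1)^m = z^m (1 - z⁻¹)^m`.
  have h1 := hasSum_moments (φ := φ) (g := fun z => z ^ n * (z - 1) ^ m) (c := A)
    (d := fun r => Ring.choose (m : ℂ) r * (-1) ^ r) (e := fun r => n + m - r) (z₀ := 0) (R := 2)
    (by norm_num) (hc _ _ s1) (fun z hz => by
      rw [mem_sphere_iff_norm, sub_zero] at hz
      simpa using hA z (by rw [hz]; norm_num)) (fun z hz => by
      have hz0 := (s1 z hz).1
      rw [mem_sphere_iff_norm, sub_zero] at hz
      have h := (hasSum_choose_mul_pow m (x := -z⁻¹) (by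
        rw [norm_neg, norm_inv, hz]; norm_num)).mul_left (z ^ (n + m))
      have e : z ^ n * (z - 1) ^ m = z ^ (n + m) * (1 + -z⁻¹) ^ m := by
        rw [zpow_add₀ hz0, mul_assoc, ← mul_zpow]
        congr 2
        field_simp
        ring
      rw [e]
      refine h.congr_fun fun r => ?_
      rw [sub_zero, zpow_sub₀ hz0, zpow_natCast, neg_pow z⁻¹, inv_pow]
      ring)
  -- On `|z| = 1/2`: `(z - 1)^m = (-1)^m (1 - z)^m`.
  have h2 := hasSum_moments (φ := φ) (g := fun z => z ^ n * (z - 1) ^ m) (c := B)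
    (d := fun r => Ring.choose (m : ℂ) r * (-1) ^ (m + r)) (e := fun r => n + r) (z₀ := 0)
    (R := 1 / 2)
    (by norm_num) (hc _ _ s2) (fun z hz => by
      rw [mem_sphere_iff_norm, sub_zero] at hz
      simpa using hB z (by rw [hz]; norm_num) (by rw [hz]; norm_num)) (fun z hz => by
      have hz0 := (s2 z hz).1
      rw [mem_sphere_iff_norm, sub_zero] at hz
      have h := (hasSum_choose_mul_pow m (x := -z) (by
        rw [norm_neg, hz]; norm_num)).mul_left (z ^ n * (-1) ^ m)
      have e : z ^ n * (z - 1) ^ m = z ^ n * (-1) ^ m * (1 + -z) ^ m := by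
        rw [mul_assoc, ← mul_zpow]
        congr 2
        ring
      rw [e]
      refine h.congr_fun fun r => ?_
      rw [sub_zero, zpow_add₀ hz0, zpow_add₀ (by norm_num), zpow_natCast, zpow_natCast, neg_pow z]
      ring)
  -- On `|z - 1| = 1/2`: `z^n = (1 + (z - 1))^n`.
  have h3 := hasSum_moments (φ := φ) (g := fun z => z ^ n * (z - 1) ^ m) (c := C)
    (d := fun r => Ring.choose (n : ℂ) r) (e := fun r => m + r) (z₀ := 1)
    (R := 1 / 2)
    (by norm_num) (hc _ _ s3) (fun z hz => by
      rw [mem_sphere_iff_norm] at hz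
      exact hC z (by rw [hz]; norm_num) (by rw [hz]; norm_num)) (fun z hz => by
      have hz1 : z - 1 ≠ 0 := sub_ne_zero.2 (s3 z hz).2
      rw [mem_sphere_iff_norm] at hz
      have h := (hasSum_choose_mul_pow n (x := z - 1) (by
        rw [hz]; norm_num)).mul_right ((z - 1) ^ m)
      rw [add_sub_cancel] at h
      refine h.congr_fun fun r => ?_
      rw [zpow_add₀ hz1, zpow_natCast]
      ring)
  refine ⟨_, _, _, h1, h2, h3, ?_⟩
  rw [← mul_sub]
  congr 1
  -- Since `m + J ≥ k`, multiplication by `(z - 1)^(m + J)` removes the pole of `φ` at `1`. The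
  -- integrand is therefore `(z - 1)^(-J)` times a function holomorphic off `0`.
  set J : ℕ := (k - m).toNat
  obtain ⟨η, hη, hηe⟩ := exists_removable hφ hC (k := m + J)
    (fun a ha => hk a (by have := Int.self_le_toNat (k - m); omega)) n
  have e : ∀ z : ℂ, z ≠ 0 ∧ z ≠ 1 →
      z ^ n * (z - 1) ^ m * φ z = (z - 1) ^ (-(J : ℤ)) * η z := by
    intro z hz
    have hz1 : z - 1 ≠ 0 := sub_ne_zero.2 hz.2
    rw [hηe z hz.2, zpow_add₀ hz1, zpow_neg]
    have := zpow_ne_zero (J : ℤ) hz1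
    field_simp
  have := circleIntegral_residue J η hη
  rw [circleIntegral.integral_congr (by norm_num) fun z hz => e z (s1 z hz),
    circleIntegral.integral_congr (by norm_num) fun z hz => e z (s2 z hz),
    circleIntegral.integral_congr (by norm_num) fun z hz => e z (s3 z hz)]
  exact this

/-! ### Re-expansion of Laurent series about a shifted centre -/

/-- Negation of the upper index. It turns the binomial coefficients in the expansion of `(z -
c)^(-a-1)`, regrouped by `b = a + i`, into those produced by moving `exp D` past a mode. -/
theorem choose_neg_sub_one_mul (b : ℤ) (i : ℕ) :
    Ring.choose (((-(b - i) - 1 : ℤ)) : ℂ) i * (-1) ^ i = Ring.choose (b : ℂ) i := by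
  have h : ((-(b - i) - 1 : ℤ) : ℂ) = -((b : ℂ) - i + 1) := by push_cast; ring
  rw [h, Ring.choose_neg, show (b : ℂ) - i + 1 + i - 1 = b by ring, Int.negOnePow_def]
  rcases Nat.even_or_odd i with hi | hi
  · have h1 : ((-1 : ℤˣ) ^ (i : ℤ)) = 1 := by rw [zpow_natCast, hi.neg_one_pow]
    rw [h1, hi.neg_one_pow]
    simp
  · have h1 : ((-1 : ℤˣ) ^ (i : ℤ)) = -1 := by rw [zpow_natCast, hi.neg_one_pow]
    rw [h1, hi.neg_one_pow]
    simp

/-- The norms are again binomial coefficients, with generating series `(1 - q)^(-a-1)`. Hence the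
absolute values in the re-expansion can be summed in closed form. -/
theorem norm_choose_neg_sub_one (a i : ℕ) :
    ‖Ring.choose (((-(a : ℤ) - 1 : ℤ)) : ℂ) i‖ = ((a + i).choose a : ℕ) := by
  have h := choose_neg_sub_one_mul ((a + i : ℕ) : ℤ) i
  have h2 : (((a + i : ℕ) : ℤ) : ℂ) = ((a + i : ℕ) : ℂ) := by push_cast; rfl
  rw [h2, Ring.choose_natCast, show (-(((a + i : ℕ) : ℤ) - i) - 1 : ℤ) = -(a : ℤ) - 1 by
    push_cast; ring] at h
  have h3 := congrArg norm h
  rw [norm_mul, norm_pow, norm_neg, norm_one, one_pow, mul_one, Complex.norm_natCast,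
    ← Nat.choose_symm_add] at h3
  exact h3

/-- Re-expansion at infinity of a Laurent series around `c`. -/
theorem hasSum_shift {A' A : ℤ → ℂ} {c : ℂ} (hc : ‖c‖ = 1) {a₀ : ℤ} (h0 : ∀ a < a₀, A' a = 0)
    {ψ : ℂ → ℂ}
    (hψ : ∀ z : ℂ, 1 < ‖z - c‖ → HasSum (fun a => A' a * (z - c) ^ (-a - 1)) (ψ z))
    (hA : ∀ b : ℤ, HasSum (fun i : ℕ => Ring.choose (b : ℂ) i * c ^ i * A' (b - i)) (A b))
    {z : ℂ} (hz : 2 < ‖z‖) : HasSum (fun b => A b * z ^ (-b - 1)) (ψ z) := by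
  have hz0 : z ≠ 0 := by
    rintro rfl
    norm_num at hz
  have hzp : 0 < ‖z‖ := norm_pos_iff.2 hz0
  have hx : ‖-(c / z)‖ < 1 := by
    rw [norm_neg, norm_div, hc, div_lt_one hzp]
    linarith
  have hzc : 1 < ‖z - c‖ := by
    have := norm_sub_norm_le z c
    linarith
  set F : ℤ × ℕ → ℂ := fun p =>
    A' p.1 * (Ring.choose ((-p.1 - 1 : ℤ) : ℂ) p.2 * (-(c / z)) ^ p.2 * z ^ (-p.1 - 1)) with hF
  have hinner : ∀ a : ℤ, HasSum (fun i => F (a, i)) (A' a * (z - c) ^ (-a - 1)) := by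
    intro a
    have h := ((hasSum_choose_mul_pow (-a - 1) hx).mul_right (z ^ (-a - 1))).mul_left (A' a)
    rwa [← mul_zpow, show (1 + -(c / z)) * z = z - c by field_simp; ring] at h
  -- The row of norms sums to the norm of the term of `ψ` at distance `‖z‖ - 1` from `c`. The bound
  -- `2 < ‖z‖` keeps this distance inside the domain of convergence.
  have hnorm : ∀ a : ℤ, 0 ≤ a →
      HasSum (fun i => ‖F (a, i)‖) (‖A' a‖ * (‖z‖ - 1) ^ (-a - 1)) := by
    intro a ha
    lift a to ℕ using ha
    have hq : ‖‖z‖⁻¹‖ < 1 := by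
      rw [norm_inv, norm_norm]
      exact inv_lt_one_of_one_lt₀ (by linarith)
    have h := ((hasSum_choose_mul_geometric_of_norm_lt_one a hq).mul_right
      (‖z‖ ^ (-(a : ℤ) - 1))).mul_left ‖A' a‖
    have e : 1 / (1 - ‖z‖⁻¹) ^ (a + 1) * ‖z‖ ^ (-(a : ℤ) - 1) = (‖z‖ - 1) ^ (-(a : ℤ) - 1) := by
      rw [show (-(a : ℤ) - 1) = -((a + 1 : ℕ) : ℤ) by push_cast; ring, zpow_neg, zpow_neg,
        zpow_natCast, zpow_natCast, one_div, ← mul_inv, ← mul_pow]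
      congr 2
      field_simp
    rw [e] at h
    refine h.congr_fun fun i => ?_
    simp only [hF, norm_mul, norm_pow, norm_neg, norm_div, hc, norm_zpow,
      norm_choose_neg_sub_one, one_div]
    rw [add_comm a i]
  have hsum : Summable F := by
    refine Summable.of_norm ((summable_prod_of_nonneg fun p => norm_nonneg _).2 ⟨fun a =>
      (hinner a).summable.norm, ?_⟩)
    have hs : Summable fun a : ℤ => ‖A' a‖ * (‖z‖ - 1) ^ (-a - 1) := by
      have h1 : ‖((‖z‖ - 1 : ℝ) : ℂ)‖ = ‖z‖ - 1 := by
        rw [Complex.norm_real, Real.norm_eq_abs, abs_of_pos (by linarith)]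
      refine (hψ (c + ((‖z‖ - 1 : ℝ) : ℂ)) ?_).summable.norm.congr fun a => ?_
      · rw [add_sub_cancel_left, h1]
        linarith
      · rw [add_sub_cancel_left, norm_mul, norm_zpow, h1]
    -- Rows with `a < a₀` vanish, so the closed form can fail only for the finitely many `a` with
    -- `a₀ ≤ a < 0`.
    refine (summable_congr_cofinite ?_).1 hs
    rw [Filter.eventuallyEq_iff_exists_mem]
    refine ⟨(Set.Ico a₀ 0)ᶜ, (Set.finite_Ico a₀ 0).compl_mem_cofinite, fun a ha => ?_⟩
    rcases lt_or_ge a a₀ with h | h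
    · simp [hF, h0 a h]
    · have : 0 ≤ a := by
        by_contra h'
        exact ha ⟨h, not_le.1 h'⟩
      exact (hnorm a this).tsum_eq.symm
  have htot : HasSum F (ψ z) := by
    have h := hsum.hasSum.prod_fiberwise hinner
    rw [← h.unique (hψ z hzc)]
    exact hsum.hasSum
  -- Regrouping by the total exponent `b = a + i`.
  let e : ℤ × ℕ ≃ ℤ × ℕ :=
    { toFun := fun p => (p.1 - p.2, p.2)
      invFun := fun p => (p.1 + p.2, p.2)
      left_inv := fun p => by simp
      right_inv := fun p => by simp }
  refine ((e.hasSum_iff).2 htot).prod_fiberwise fun b => ?_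
  refine ((hA b).mul_right (z ^ (-b - 1))).congr_fun fun i => ?_
  simp only [hF, Function.comp_apply, e, Equiv.coe_fn_mk]
  rw [← choose_neg_sub_one_mul b i, neg_pow (c / z), div_pow,
    show -(b - (i : ℤ)) - 1 = (-b - 1) + i by ring, zpow_add₀ hz0 _ (i : ℤ), zpow_natCast]
  field_simp

theorem sum_range_antidiagonal {M : Type*} [AddCommMonoid M] (g : ℕ → ℕ → M) {I L : ℕ}
    (hI : ∀ i l, I ≤ i → g i l = 0) (hL : ∀ i l, L ≤ l → g i l = 0) {N : ℕ} (hN : I + L ≤ N) :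
    ∑ k ∈ Finset.range N, ∑ p ∈ Finset.HasAntidiagonal.antidiagonal k, g p.1 p.2 =
      ∑ i ∈ Finset.range I, ∑ l ∈ Finset.range L, g i l := by
  rw [← Finset.sum_product', Finset.sum_sigma']
  symm
  refine Finset.sum_bij_ne_zero (fun p _ _ => ⟨p.1 + p.2, p⟩) ?_ ?_ ?_ ?_
  · intro p hp _
    simp only [Finset.mem_product, Finset.mem_range] at hp
    simp only [Finset.mem_sigma, Finset.mem_range, Finset.HasAntidiagonal.mem_antidiagonal, and_true]
    omega
  · intro p _ _ q _ _ h
    exact eq_of_heq (Sigma.mk.inj h).2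
  · rintro ⟨k, p⟩ hk hne
    simp only [Finset.mem_sigma, Finset.mem_range, Finset.HasAntidiagonal.mem_antidiagonal] at hk
    obtain ⟨hk, rfl⟩ := hk
    refine ⟨p, ?_, hne, rfl⟩
    simp only [Finset.mem_product, Finset.mem_range]
    constructor
    · by_contra h
      exact hne (hI _ _ (not_lt.1 h))
    · by_contra h
      exact hne (hL _ _ (not_lt.1 h))
  · intro p _ _
    rfl

/-! ### Two-point functions with a chiral insertion -/

section TwoPoint

set_option linter.unusedSectionVars false

variable {K V W : Type*} [Field K] [Algebra K ℂ] [AddCommGroup V] [Module ℂ V]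
  [AddCommGroup W] [Module ℂ W]

theorem modePow_one (k : K × K) : modePow k 1 = 1 := by
  simp [modePow, conjPow]

theorem modePow_intCast (a : ℤ) {z : ℂ} (hz : z ≠ 0) :
    modePow ((a : K), (-1 : K)) z = z ^ (-a - 1) := by
  simp only [modePow, conjPow, map_intCast, map_neg, map_one, neg_neg, sub_self, zero_mul, add_zero]
  rw [show (-(a : ℂ) - 1) = ((-a - 1 : ℤ) : ℂ) by push_cast; ring, Complex.exp_int_mul,
    Complex.exp_log hz]

/-- Conjugation is real linear, so an analytic germ in `(z, z̄)` is real analytic in `z`. Holomorphy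
is not yet available, since `z̄` may occur. -/
theorem IsCorrelationFunction.analyticAt {g : (Fin 2 → ℂ) → ℂ} (hg : IsCorrelationFunction g)
    {s z : ℂ} (hs : s ≠ 0) (hz : z ∈ ({0, s}ᶜ : Set ℂ)) :
    AnalyticAt ℝ (fun x => g ![x, s]) z := by
  simp only [Set.mem_compl_iff, Set.mem_insert_iff, Set.mem_singleton_iff, not_or] at hz
  have hc : ![z, s] ∈ Conf 2 := by
    refine ⟨fun i => ?_, fun i j hij => ?_⟩
    · fin_cases i
      · exact hz.1
      · exact hs
    · fin_cases i <;> fin_cases j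
      · rfl
      · exact absurd hij hz.2
      · exact absurd hij.symm hz.2
      · rfl
  obtain ⟨G, hG, hGg, -⟩ := hg _ hc
  have h1 : AnalyticAt ℝ (fun x : ℂ => ![x, s]) z := by
    refine AnalyticAt.pi fun i => ?_
    fin_cases i
    · exact analyticAt_id
    · exact analyticAt_const
  have h2 : AnalyticAt ℝ (fun x : ℂ => fun i => (starRingEnd ℂ) (![x, s] i)) z := by
    refine AnalyticAt.pi fun i => ?_
    fin_cases i
    · exact (Complex.conjCLE : ℂ →L[ℝ] ℂ).analyticAt z
    · exact (analyticAt_const : AnalyticAt ℝ (fun _ : ℂ => (starRingEnd ℂ) s) z)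
  have h3 : AnalyticAt ℝ (fun x : ℂ => G (conjPt ![x, s])) z :=
    AnalyticAt.fun_comp (f := fun x : ℂ => conjPt ![x, s]) (hG.restrictScalars (𝕜 := ℝ)) (h1.prod h2)
  refine h3.congr ?_
  exact h1.continuousAt.eventually hGg

theorem productTerm_two (Y : V →ₗ[ℂ] (K → K → Module.End ℂ W)) (u₁ u₂ : V) (z₁ z₂ : ℂ) (w : W)
    (f : Module.Dual ℂ W) (k : Fin 2 → K × K) :
    productTerm Y ![u₁, u₂] ![z₁, z₂] w f k =
      f (Y u₁ (k 0).1 (k 0).2 (Y u₂ (k 1).1 (k 1).2 w)) *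
        (modePow (k 0) z₁ * modePow (k 1) z₂) := by
  simp [productTerm, List.ofFn_succ, Fin.prod_univ_two]

/-- The matrix element `⟨f, Y(w, s, s̄) y⟩`. -/
noncomputable def pairing (Y : V →ₗ[ℂ] (K → K → Module.End ℂ W)) (s : ℂ) (w : V) (y : W)
    (f : Module.Dual ℂ W) : ℂ :=
  ∑' k : K × K, f (Y w k.1 k.2 y) * modePow k s

theorem hasSum_productTerm_two {Y : V →ₗ[ℂ] (K → K → Module.End ℂ W)} {u₁ u₂ : V} {z₁ z₂ : ℂ}
    {w : W} {f : Module.Dual ℂ W} {S : ℂ}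
    (h : HasSum (productTerm Y ![u₁, u₂] ![z₁, z₂] w f) S) :
    HasSum (fun k : (K × K) × (K × K) => f (Y u₁ k.1.1 k.1.2 (Y u₂ k.2.1 k.2.2 w)) *
        (modePow k.1 z₁ * modePow k.2 z₂)) S := by
  rw [← (finTwoArrowEquiv (K × K)).symm.hasSum_iff] at h
  refine h.congr_fun fun k => ?_
  simp [productTerm_two]

theorem HasSum.fiberwise {ι κ : Type*} {T : ι × κ → ℂ} {S : ℂ} (h : HasSum T S) :
    HasSum (fun a => ∑' k, T (a, k)) S :=
  h.prod_fiberwise fun a => (h.summable.prod_factor a).hasSum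

/-- The modes of a chiral vertex operator, and only they, may be non-zero. -/
def ChiralModes (Y : V →ₗ[ℂ] (K → K → Module.End ℂ W)) (u : V) : Prop :=
  ∀ m n : K, (n ≠ -1 ∨ ∀ a : ℤ, m ≠ a) → Y u m n = 0

theorem ChiralModes.eq_zero_of_notMem_range {Y : V →ₗ[ℂ] (K → K → Module.End ℂ W)} {u : V}
    (hu : ChiralModes Y u) {k : K × K} (hk : k ∉ Set.range fun a : ℤ => ((a : K), (-1 : K))) :
    Y u k.1 k.2 = 0 := by
  refine hu _ _ ?_
  by_contra! h
  obtain ⟨h2, a, h1⟩ := h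
  exact hk ⟨a, Prod.ext h1.symm h2.symm⟩

variable [CharZero K]

theorem intCast_neg_one_injective :
    Function.Injective fun a : ℤ => ((a : K), (-1 : K)) := fun a b h => by
  simpa using h

/-- Absolute convergence allows the modes of `w` to be summed first. Only the modes `(a, -1)` of `u`
remain, which leaves a Laurent series in `z` without `z̄`. -/
theorem ChiralModes.hasSum_left {Y : V →ₗ[ℂ] (K → K → Module.End ℂ W)} {u w : V}
    (hu : ChiralModes Y u) {z s : ℂ} (hz : z ≠ 0) {y : W} {f : Module.Dual ℂ W} {S : ℂ}
    (h : HasSum (productTerm Y ![u, w] ![z, s] y f) S) :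
    HasSum (fun a : ℤ => pairing Y s w y (f ∘ₗ Y u a (-1)) * z ^ (-a - 1)) S := by
  have h := hasSum_productTerm_two h
  have inj : Function.Injective fun p : ℤ × (K × K) => (((p.1 : K), (-1 : K)), p.2) := by
    rintro ⟨a, k⟩ ⟨b, l⟩ h
    simpa using h
  rw [← inj.hasSum_iff] at h
  · refine (HasSum.fiberwise h).congr_fun fun a => ?_
    rw [pairing, ← tsum_mul_right]
    refine tsum_congr fun k => ?_
    simp only [Function.comp_apply, LinearMap.comp_apply, modePow_intCast a hz]
    ring
  · rintro ⟨k, l⟩ hk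
    rw [hu.eq_zero_of_notMem_range (k := k)]
    · simp
    · rintro ⟨a, rfl⟩
      exact hk ⟨(a, l), rfl⟩

theorem ChiralModes.hasSum_right {Y : V →ₗ[ℂ] (K → K → Module.End ℂ W)} {u w : V}
    (hu : ChiralModes Y u) {z s : ℂ} (hz : z ≠ 0) {y : W} {f : Module.Dual ℂ W} {S : ℂ}
    (h : HasSum (productTerm Y ![w, u] ![s, z] y f) S) :
    HasSum (fun a : ℤ => pairing Y s w (Y u a (-1) y) f * z ^ (-a - 1)) S := by
  have h := hasSum_productTerm_two h
  have inj : Function.Injective fun p : ℤ × (K × K) => (p.2, ((p.1 : K), (-1 : K))) := by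
    rintro ⟨a, k⟩ ⟨b, l⟩ h
    simpa [and_comm] using h
  rw [← inj.hasSum_iff] at h
  · refine (HasSum.fiberwise h).congr_fun fun a => ?_
    rw [pairing, ← tsum_mul_right]
    refine tsum_congr fun k => ?_
    simp only [Function.comp_apply, modePow_intCast a hz]
    ring
  · rintro ⟨l, k⟩ hk
    rw [hu.eq_zero_of_notMem_range (k := k)]
    · simp
    · rintro ⟨a, rfl⟩
      exact hk ⟨(a, l), rfl⟩

/-- As a function of the position of a chiral vector, a two-point function is holomorphic. -/
theorem ChiralModes.differentiableOn {Y : V →ₗ[ℂ] (K → K → Module.End ℂ W)} {u w : V}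
    (hu : ChiralModes Y u) {s : ℂ} (hs : s ≠ 0) {y : W} {f : Module.Dual ℂ W}
    {g : (Fin 2 → ℂ) → ℂ} (hg : IsCorrelationFunction g)
    (h : ∀ z : ℂ, ‖s‖ < ‖z‖ → HasSum (productTerm Y ![u, w] ![z, s] y f) (g ![z, s])) :
    DifferentiableOn ℂ (fun z => g ![z, s]) {0, s}ᶜ := by
  have hsp : 0 < ‖s‖ := norm_pos_iff.2 hs
  have h1 : ∀ z : ℂ, ‖s‖ < ‖z‖ → z ≠ 0 := by
    rintro z hz rfl
    exact absurd hz (by simp)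
  have h2 : ‖s‖ < ‖2 * s‖ := by
    rw [norm_mul]
    norm_num
    linarith
  -- The point `2 * s` lies where `|z| > |s|`, so the Laurent series gives holomorphy near it.
  refine differentiableOn_of_analyticOnNhd_real (isPreconnected_compl_pair 0 s)
    (fun z hz => hg.analyticAt hs hz) (z₀ := 2 * s) ?_ ?_
  · simp only [Set.mem_compl_iff, Set.mem_insert_iff, Set.mem_singleton_iff, not_or]
    refine ⟨h1 _ h2, fun h => ?_⟩
    rw [h] at h2
    exact lt_irrefl _ h2
  · filter_upwards [(isOpen_lt continuous_const continuous_norm).mem_nhds h2] with z hz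
    exact differentiableAt_of_hasSum_zpow hsp.le
      (fun z hz => hu.hasSum_left (h1 z hz) (h z hz)) hz

/-- Locality for one operator. This makes `pairing`, defined by an unconditional sum, additive in
the functional. -/
theorem IsLocal.summable {gr : K × K → Submodule ℂ W} {Y : V →ₗ[ℂ] (K → K → Module.End ℂ W)}
    (h : IsLocal gr Y) {s : ℂ} (hs : s ≠ 0) (w : V) (y : W) {f : Module.Dual ℂ W}
    (hf : f ∈ contragredient gr) :
    Summable fun k : K × K => f (Y w k.1 k.2 y) * modePow k s := by
  obtain ⟨m, -, hm⟩ := h 1 ![w]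
  have h1 := (hm 1 ![s] (fun i => by fin_cases i; exact hs)
    (Subsingleton.strictAnti _) y ⟨f, hf⟩).summable
  rw [← (Equiv.funUnique (Fin 1) (K × K)).symm.summable_iff] at h1
  refine h1.congr fun k => ?_
  simp [productTerm]

/-- The identity and the transposition in the locality axiom give the two expansions of the same
function. -/
theorem IsLocal.two_point {gr : K × K → Submodule ℂ W} {Y : V →ₗ[ℂ] (K → K → Module.End ℂ W)}
    (hloc : IsLocal gr Y) {u : V} (hu : ChiralModes Y u) (w : V) (y : W) {f : Module.Dual ℂ W}
    (hf : f ∈ contragredient gr) {s : ℂ} (hs : s ≠ 0) :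
    ∃ φ : ℂ → ℂ, DifferentiableOn ℂ φ {0, s}ᶜ ∧
      (∀ z : ℂ, ‖s‖ < ‖z‖ →
        HasSum (fun a : ℤ => pairing Y s w y (f ∘ₗ Y u a (-1)) * z ^ (-a - 1)) (φ z)) ∧
      (∀ z : ℂ, 0 < ‖z‖ → ‖z‖ < ‖s‖ →
        HasSum (fun a : ℤ => pairing Y s w (Y u a (-1) y) f * z ^ (-a - 1)) (φ z)) := by
  obtain ⟨m, hm1, hm2⟩ := hloc 2 ![u, w]
  have hsp : 0 < ‖s‖ := norm_pos_iff.2 hs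
  have hL : ∀ z : ℂ, ‖s‖ < ‖z‖ →
      HasSum (productTerm Y ![u, w] ![z, s] y f) (m ![z, s] y ⟨f, hf⟩) := by
    intro z hz
    have hz0 : z ≠ 0 := norm_pos_iff.1 (hsp.trans hz)
    have h := hm2 1 ![z, s] (fun i => by fin_cases i <;> assumption) (fun i j hij => by
      fin_cases i <;> fin_cases j <;> first | exact absurd hij (by decide) | exact hz) y ⟨f, hf⟩
    simpa using h
  have hR : ∀ z : ℂ, 0 < ‖z‖ → ‖z‖ < ‖s‖ →
      HasSum (productTerm Y ![w, u] ![s, z] y f) (m ![z, s] y ⟨f, hf⟩) := by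
    intro z hz0 hz
    have hz0 : z ≠ 0 := norm_pos_iff.1 hz0
    have h := hm2 (Equiv.swap 0 1) ![z, s] (fun i => by fin_cases i <;> assumption)
      (fun i j hij => by
        fin_cases i <;> fin_cases j <;> first | exact absurd hij (by decide) | simpa using hz)
      y ⟨f, hf⟩
    have e1 : ![u, w] ∘ (Equiv.swap 0 1 : Equiv.Perm (Fin 2)) = ![w, u] := by
      funext i
      fin_cases i <;> simp
    have e2 : ![z, s] ∘ (Equiv.swap 0 1 : Equiv.Perm (Fin 2)) = ![s, z] := by
      funext i
      fin_cases i <;> simp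
    rwa [e1, e2] at h
  exact ⟨fun z => m ![z, s] y ⟨f, hf⟩, hu.differentiableOn hs (hm1 y ⟨f, hf⟩) hL,
    fun z hz => hu.hasSum_left (norm_pos_iff.1 (hsp.trans hz)) (hL z hz),
    fun z hz0 hz => hu.hasSum_right (norm_pos_iff.1 hz0) (hR z hz0 hz)⟩

end TwoPoint

/-! ### Graded spaces and homogeneous functionals -/

section Graded

variable {ι W : Type*} [AddCommGroup W] [Module ℂ W] {gr : ι → Submodule ℂ W}

/-- `W` is the direct sum of its homogeneous subspaces. -/
structure IsGrading (gr : ι → Submodule ℂ W) : Prop where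
  indep : iSupIndep gr
  span : iSup gr = ⊤

theorem IsGrading.of_isInternal [DecidableEq ι] (h : DirectSum.IsInternal gr) : IsGrading gr :=
  ⟨h.submodule_iSupIndep, h.submodule_iSup_eq_top⟩

theorem IsGrading.induction (hgr : IsGrading gr) {P : W → Prop} (hom : ∀ e, ∀ w ∈ gr e, P w)
    (zero : P 0) (add : ∀ x y, P x → P y → P (x + y)) (w : W) : P w :=
  Submodule.iSup_induction gr (motive := P) (by rw [hgr.span]; trivial) hom zero add

theorem IsGrading.hom_ext (hgr : IsGrading gr) {M : Type*} [AddCommGroup M] [Module ℂ M]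
    {S T : W →ₗ[ℂ] M} (h : ∀ e, ∀ w ∈ gr e, S w = T w) : S = T :=
  LinearMap.ext <| hgr.induction h (by simp) fun x y hx hy => by rw [map_add, map_add, hx, hy]

theorem IsGrading.exists_proj (hgr : IsGrading gr) :
    ∃ π : ι → W →ₗ[ℂ] W, (∀ e w, π e w ∈ gr e) ∧ (∀ e, ∀ w ∈ gr e, π e w = w) ∧
      (∀ e e', e' ≠ e → ∀ w ∈ gr e', π e w = 0) ∧ ∀ w, (∀ e, π e w = 0) → w = 0 := by
  classical
  have hint : DirectSum.IsInternal gr :=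
    (DirectSum.isInternal_submodule_iff_iSupIndep_and_iSup_eq_top gr).2 ⟨hgr.indep, hgr.span⟩
  let E := LinearEquiv.ofBijective (DirectSum.coeLinearMap gr) hint
  have hE : ∀ e (w : gr e), E.symm (w : W) = DirectSum.lof ℂ ι (fun i => gr i) e w := by
    intro e w
    rw [LinearEquiv.symm_apply_eq]
    exact (DirectSum.coeLinearMap_lof gr e w).symm
  refine ⟨fun e => (gr e).subtype ∘ₗ DirectSum.component ℂ ι (fun i => gr i) e ∘ₗ
    E.symm.toLinearMap, ?_, ?_, ?_, ?_⟩
  · intro e w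
    exact Submodule.coe_mem _
  · intro e w hw
    simp only [LinearMap.comp_apply, LinearEquiv.coe_coe, hE e ⟨w, hw⟩]
    rw [DirectSum.component.lof_self]
    rfl
  · intro e e' hne w hw
    simp only [LinearMap.comp_apply, LinearEquiv.coe_coe, hE e' ⟨w, hw⟩]
    rw [DirectSum.component.of, dif_neg hne, map_zero]
  · intro w hw
    have : E.symm w = 0 := by
      refine DirectSum.ext_component ℂ fun e => ?_
      have := hw e
      simpa using this
    simpa using this

/-- The linear functional `f` vanishes on all homogeneous subspaces except `gr e`. -/
def IsHomFun (gr : ι → Submodule ℂ W) (e : ι) (f : Module.Dual ℂ W) : Prop :=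
  ∀ e', e' ≠ e → ∀ w ∈ gr e', f w = 0

theorem IsHomFun.mem_contragredient {e : ι} {f : Module.Dual ℂ W} (hf : IsHomFun gr e f) :
    f ∈ contragredient gr := by
  refine (Set.finite_singleton e).subset ?_
  rintro a ⟨v, hv, hne⟩
  by_contra h
  exact hne (hf a h v hv)

/-- Any functional becomes homogeneous after composition with the projection to `gr e`, without
changing its values on `gr e`. Operator identities can thus be tested in one degree at a time. -/
theorem IsGrading.eq_of_forall_isHomFun (hgr : IsGrading gr) {e : ι} {w w' : W} (hw : w ∈ gr e)
    (hw' : w' ∈ gr e) (h : ∀ f : Module.Dual ℂ W, IsHomFun gr e f → f w = f w') : w = w' := by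
  obtain ⟨π, -, h2, h3, -⟩ := hgr.exists_proj
  refine sub_eq_zero.1 ((Module.forall_dual_apply_eq_zero_iff ℂ _).1 fun g => ?_)
  rw [map_sub, sub_eq_zero]
  have := h (g ∘ₗ π e) fun e' hne v hv => by
    rw [LinearMap.comp_apply, h3 e e' hne v hv, map_zero]
  rwa [LinearMap.comp_apply, LinearMap.comp_apply, h2 e _ hw, h2 e _ hw'] at this

/-- The projections intertwine `S` and `T` with scalars. A non-zero component of `w` in another
degree would satisfy two different eigenvalue equations. -/
theorem mem_of_eigen {K : Type*} {gr : K × K → Submodule ℂ W} (hgr : IsGrading gr) {i : K → ℂ}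
    (hi : Function.Injective i) {S T : Module.End ℂ W}
    (h : ∀ a b, ∀ w ∈ gr (a, b), S w = i a • w ∧ T w = i b • w) {a b : K} {w : W}
    (hS : S w = i a • w) (hT : T w = i b • w) : w ∈ gr (a, b) := by
  obtain ⟨π, h1, h2, h3, h4⟩ := hgr.exists_proj
  have cS : ∀ e, π e ∘ₗ S = i e.1 • π e := by
    intro e
    refine hgr.hom_ext fun e' v hv => ?_
    rw [LinearMap.comp_apply, (h e'.1 e'.2 v hv).1, LinearMap.smul_apply, map_smul]
    by_cases he : e' = e
    · rw [he]
    · rw [h3 e e' he v hv, smul_zero, smul_zero]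
  have cT : ∀ e, π e ∘ₗ T = i e.2 • π e := by
    intro e
    refine hgr.hom_ext fun e' v hv => ?_
    rw [LinearMap.comp_apply, (h e'.1 e'.2 v hv).2, LinearMap.smul_apply, map_smul]
    by_cases he : e' = e
    · rw [he]
    · rw [h3 e e' he v hv, smul_zero, smul_zero]
  have hz : ∀ e, e ≠ (a, b) → π e w = 0 := by
    intro e he
    have e1 := LinearMap.congr_fun (cS e) w
    have e2 := LinearMap.congr_fun (cT e) w
    rw [LinearMap.comp_apply, hS, map_smul, LinearMap.smul_apply] at e1
    rw [LinearMap.comp_apply, hT, map_smul, LinearMap.smul_apply] at e2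
    by_contra hne
    exact he (Prod.ext (hi (smul_left_injective ℂ hne e1)).symm
      (hi (smul_left_injective ℂ hne e2)).symm)
  have : w - π (a, b) w = 0 := by
    refine h4 _ fun e => ?_
    rw [map_sub]
    by_cases he : e = (a, b)
    · rw [he, h2 _ _ (h1 _ _), sub_self]
    · rw [hz e he, h3 e (a, b) (Ne.symm he) _ (h1 _ _), sub_self]
  rw [sub_eq_zero.1 this]
  exact h1 _ _

end Graded

theorem hasFiniteSum_of_range {M : Type*} [AddCommMonoid M] {f : ℕ → M} {s : M} (N : ℕ)
    (h : ∀ r, N ≤ r → f r = 0) (hs : ∑ r ∈ Finset.range N, f r = s) : HasFiniteSum f s := by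
  have hsub : Function.support f ⊆ ↑(Finset.range N) := by
    intro r hr
    by_contra h'
    exact hr (h r (by simpa using h'))
  exact ⟨(Finset.finite_toSet _).subset hsub, (finsum_eq_sum_of_support_subset f hsub).trans hs⟩

theorem HasFiniteSum.add {M : Type*} [AddCommMonoid M] {f g : ℕ → M} {s t : M}
    (hf : HasFiniteSum f s) (hg : HasFiniteSum g t) : HasFiniteSum (f + g) (s + t) := by
  refine ⟨(hf.1.union hg.1).subset (Function.support_add f g), ?_⟩
  rw [← hf.2, ← hg.2]
  exact finsum_add_distrib hf.1 hg.1

/-! ### Properties common to the algebra and its modules -/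

section System

variable {K V W : Type*} [Field K] [CharZero K] [Algebra ℝ K] [Algebra K ℂ] [IsScalarTower ℝ K ℂ]
  [AddCommGroup V] [Module ℂ V] [AddCommGroup W] [Module ℂ W]

set_option linter.unusedSectionVars false

/-- The properties which the vertex operators on the algebra and on a module have in common. -/
structure IsModeSystem (A : NonChiralVOA V) (gr : K × K → Submodule ℂ W)
    (Y : V →ₗ[ℂ] (K → K → Module.End ℂ W)) : Prop where
  grading : IsGrading gr
  locality : IsLocal gr Y
  shift : ∀ {h hb : ℝ} {u : V}, u ∈ A.gr (h, hb) → ∀ {a b : K} {w : W}, w ∈ gr (a, b) →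
    ∀ m n : K, Y u m n w ∈ gr (a + algebraMap ℝ K h - m - 1, b + algebraMap ℝ K hb - n - 1)
  bounded : ∃ M : ℝ, ∀ a b : K, (algebraMap K ℂ a).re < M ∨ (algebraMap K ℂ b).re < M →
    gr (a, b) = ⊥
  single_valued : ∀ a b : K, gr (a, b) ≠ ⊥ → ∃ k : ℤ, a - b = k
  chiral : ∀ {u : V}, A.IsChiral u → ∀ m n : K, n ≠ -1 → Y u m n = 0
  antiChiral : ∀ {u : V}, A.IsAntiChiral u → ∀ m n : K, m ≠ -1 → Y u m n = 0

theorem re_algebraMap (r : ℝ) : (algebraMap K ℂ (algebraMap ℝ K r)).re = r := by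
  rw [← IsScalarTower.algebraMap_apply]
  simp

variable {A : NonChiralVOA V} {gr : K × K → Submodule ℂ W}
  {Y : V →ₗ[ℂ] (K → K → Module.End ℂ W)}

namespace IsModeSystem

/-- Spin counting: `u`, the argument and its image all have integral spin. If the second index is
`-1`, the first index is a combination of these spins and is therefore an integer. -/
theorem chiralModes (S : IsModeSystem A gr Y) {h hb : ℝ} {u : V} (hu : u ∈ A.gr (h, hb))
    (hc : A.IsChiral u) : ChiralModes Y u := by
  intro m n hmn
  by_cases hn : n = -1
  · subst hn
    have hm : ∀ a : ℤ, m ≠ a := hmn.resolve_left (fun h => h rfl)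
    refine S.grading.hom_ext fun e w hw => ?_
    rw [LinearMap.zero_apply]
    by_contra hne
    have h1 := S.shift hu (a := e.1) (b := e.2) hw m (-1)
    obtain ⟨k₁, hk₁⟩ := S.single_valued e.1 e.2 (fun h0 => by
      rw [show e = (e.1, e.2) from rfl, h0, Submodule.mem_bot] at hw
      rw [hw, map_zero] at hne
      exact hne rfl)
    obtain ⟨k₂, hk₂⟩ := S.single_valued _ _ (fun h0 => by
      rw [h0, Submodule.mem_bot] at h1
      exact hne h1)
    obtain ⟨k₃, hk₃⟩ := A.single_valued h hb (fun h0 => by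
      rw [h0, Submodule.mem_bot] at hu
      rw [hu, map_zero] at hne
      exact hne rfl)
    have hk₄ : algebraMap ℝ K h - algebraMap ℝ K hb = k₃ := by
      rw [← map_sub, hk₃, map_intCast]
    refine hm (k₁ + k₃ - 1 - k₂) ?_
    push_cast
    rw [← hk₁, ← hk₂, ← hk₄]
    ring
  · exact S.chiral hc m n hn

/-- A mode of large index lowers the first weight below the bound of the grading. -/
theorem eventually_zero (S : IsModeSystem A gr Y) {h hb : ℝ} {u : V} (hu : u ∈ A.gr (h, hb))
    (y : W) : ∃ N : ℤ, ∀ a : ℤ, N ≤ a → Y u a (-1) y = 0 := by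
  obtain ⟨M, hM⟩ := S.bounded
  refine S.grading.induction (P := fun y => ∃ N : ℤ, ∀ a : ℤ, N ≤ a → Y u a (-1) y = 0)
    ?_ ⟨0, by simp⟩ ?_ y
  · intro e w hw
    obtain ⟨N, hN⟩ := exists_int_gt ((algebraMap K ℂ e.1).re + h - 1 - M)
    refine ⟨N, fun a ha => ?_⟩
    have h1 := S.shift hu (a := e.1) (b := e.2) hw a (-1)
    rw [hM _ _ (Or.inl ?_), Submodule.mem_bot] at h1
    · exact h1
    · have ha' : (N : ℝ) ≤ a := by exact_mod_cast ha
      simp only [map_add, map_sub, map_one, map_intCast, Complex.add_re, Complex.sub_re,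
        re_algebraMap, Complex.intCast_re, Complex.one_re]
      linarith
  · rintro y₁ y₂ ⟨N₁, h₁⟩ ⟨N₂, h₂⟩
    refine ⟨max N₁ N₂, fun a ha => ?_⟩
    rw [map_add, h₁ a (le_trans (le_max_left _ _) ha), h₂ a (le_trans (le_max_right _ _) ha),
      add_zero]

theorem comp_mem_contragredient (S : IsModeSystem A gr Y) {h hb : ℝ} {u : V}
    (hu : u ∈ A.gr (h, hb)) {f : Module.Dual ℂ W} (hf : f ∈ contragredient gr) (m n : K) :
    f ∘ₗ Y u m n ∈ contragredient gr := by
  have inj : Function.Injective fun e : K × K =>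
      (e.1 + algebraMap ℝ K h - m - 1, e.2 + algebraMap ℝ K hb - n - 1) := by
    intro e e' h
    simpa [Prod.ext_iff] using h
  refine (Set.Finite.preimage inj.injOn hf).subset ?_
  rintro e ⟨w, hw, hne⟩
  exact ⟨_, S.shift hu (a := e.1) (b := e.2) hw m n, hne⟩

theorem comp_isHomFun (S : IsModeSystem A gr Y) {h hb : ℝ} {u : V}
    (hu : u ∈ A.gr (h, hb)) {f : Module.Dual ℂ W} {e : K × K} (hf : IsHomFun gr e f) (m n : K) :
    IsHomFun gr (e.1 - algebraMap ℝ K h + m + 1, e.2 - algebraMap ℝ K hb + n + 1)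
      (f ∘ₗ Y u m n) := by
  intro e' he' w hw
  refine hf _ (fun heq => he' ?_) _ (S.shift hu (a := e'.1) (b := e'.2) hw m n)
  rw [← heq]
  ext <;> ring

/-- At position `1` all powers equal `1`, and only one mode sends `y` to the degree seen by `f`. The
double series therefore has at most one non-zero term. -/
theorem pairing_one (S : IsModeSystem A gr Y) {h hb : ℝ} {u : V}
    (hu : u ∈ A.gr (h, hb)) {f : Module.Dual ℂ W} {e : K × K} (hf : IsHomFun gr e f) {a b : K}
    {y : W} (hy : y ∈ gr (a, b)) :
    pairing Y 1 u y f =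
      f (Y u (a + algebraMap ℝ K h - 1 - e.1) (b + algebraMap ℝ K hb - 1 - e.2) y) := by
  rw [pairing, tsum_eq_single
    (a + algebraMap ℝ K h - 1 - e.1, b + algebraMap ℝ K hb - 1 - e.2), modePow_one, mul_one]
  intro k hk
  rw [hf _ _ _ (S.shift hu hy k.1 k.2), zero_mul]
  intro heq
  apply hk
  rw [← heq]
  ext <;> simp

/-- With homogeneous `y` and `f`, fixing the mode of `v` fixes that of `u`. Both expansions of the
two-point function are then multiples of `z ^ (-a - 1)`, and holomorphy off `{0, 1}` forces the same
coefficient. -/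
theorem commute_of_chiral_of_antiChiral (S : IsModeSystem A gr Y) {h hb h' hb' : ℝ} {u v : V}
    (hu : u ∈ A.gr (h, hb)) (hv : v ∈ A.gr (h', hb')) (hcu : A.IsChiral u)
    (hcv : A.IsAntiChiral v) (a : ℤ) (b : K) : Commute (Y u a (-1)) (Y v (-1) b) := by
  refine S.grading.hom_ext fun e y hy => ?_
  set e' : K × K := (e.1 + algebraMap ℝ K h' + algebraMap ℝ K h - a - 1,
    e.2 + algebraMap ℝ K hb' + algebraMap ℝ K hb - b - 1) with he'
  have hy' : y ∈ gr (e.1, e.2) := hy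
  have m1 : Y u a (-1) (Y v (-1) b y) ∈ gr e' := by
    have := S.shift hu (S.shift hv hy' (-1) b) a (-1)
    convert this using 3 <;> ring
  have m2 : Y v (-1) b (Y u a (-1) y) ∈ gr e' := by
    have := S.shift hv (S.shift hu hy' a (-1)) (-1) b
    convert this using 3 <;> ring
  refine S.grading.eq_of_forall_isHomFun m1 m2 fun f hf => ?_
  obtain ⟨φ, hφ, hA, hB⟩ := S.locality.two_point (S.chiralModes hu hcu) v y
    hf.mem_contragredient (s := 1) one_ne_zero
  -- Degree counting gives `v` the first index `a - c - 1`. Since `v` is anti-chiral, this index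
  -- must be `-1`, so `c = a`.
  have eA : (fun c : ℤ => pairing Y 1 v y (f ∘ₗ Y u c (-1))) = Pi.single a
      (f (Y u a (-1) (Y v (-1) b y))) := by
    funext c
    rw [S.pairing_one hv (S.comp_isHomFun hu hf c (-1)) hy']
    have e2 : e.2 + algebraMap ℝ K hb' - 1 - (e'.2 - algebraMap ℝ K hb + -1 + 1) = b := by
      simp only [he']
      ring
    have e1 : e.1 + algebraMap ℝ K h' - 1 - (e'.1 - algebraMap ℝ K h + c + 1) = a - c - 1 := by
      simp only [he']
      ring
    dsimp only
    rw [e1, e2]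
    by_cases hca : c = a
    · subst hca
      simp
    · rw [Pi.single_eq_of_ne hca, S.antiChiral hcv]
      · simp
      · intro h0
        apply hca
        have : (a : K) - c = 0 := by linear_combination h0
        exact_mod_cast (sub_eq_zero.1 this).symm
  have eB : (fun c : ℤ => pairing Y 1 v (Y u c (-1) y) f) = Pi.single a
      (f (Y v (-1) b (Y u a (-1) y))) := by
    funext c
    rw [S.pairing_one hv hf (S.shift hu hy' c (-1))]
    have e2 : e.2 + algebraMap ℝ K hb - -1 - 1 + algebraMap ℝ K hb' - 1 - e'.2 = b := by
      simp only [he']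
      ring
    have e1 : e.1 + algebraMap ℝ K h - c - 1 + algebraMap ℝ K h' - 1 - e'.1 = a - c - 1 := by
      simp only [he']
      ring
    rw [e1, e2]
    by_cases hca : c = a
    · subst hca
      simp
    · rw [Pi.single_eq_of_ne hca, S.antiChiral hcv]
      · simp
      · intro h0
        apply hca
        have : (a : K) - c = 0 := by linear_combination h0
        exact_mod_cast (sub_eq_zero.1 this).symm
  have single : ∀ (c z : ℂ),
      HasSum (fun k : ℤ => (Pi.single a c : ℤ → ℂ) k * z ^ (-k - 1)) (c * z ^ (-a - 1)) := by
    intro c z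
    have := hasSum_single (f := fun k : ℤ => (Pi.single a c : ℤ → ℂ) k * z ^ (-k - 1)) a
      fun k hk => by simp [hk]
    simpa using this
  have hA' : ∀ z : ℂ, 1 < ‖z‖ → φ z = f (Y u a (-1) (Y v (-1) b y)) * z ^ (-a - 1) := by
    intro z hz
    have h1 := hA z (by simpa using hz)
    rw [funext_iff] at eA
    simp only [eA] at h1
    exact h1.unique (single _ z)
  have hB' : φ (1 / 2) = f (Y v (-1) b (Y u a (-1) y)) * (1 / 2) ^ (-a - 1) := by
    have h1 := hB (1 / 2) (by norm_num) (by norm_num)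
    rw [funext_iff] at eB
    simp only [eB] at h1
    exact h1.unique (single _ _)
  have hmono : DifferentiableOn ℂ
      (fun z => f (Y u a (-1) (Y v (-1) b y)) * z ^ (-a - 1)) {0, (1 : ℂ)}ᶜ := by
    intro z hz
    have hz0 : z ≠ 0 := fun h => hz (by simp [h])
    exact ((differentiableAt_id.zpow (Or.inl hz0)).const_mul _).differentiableWithinAt
  have key := eqOn_compl_pair hφ hmono (z₀ := 2) (by norm_num) (by
    filter_upwards [(isOpen_lt continuous_const continuous_norm).mem_nhds
      (show (1 : ℝ) < ‖(2 : ℂ)‖ by norm_num)] with z hz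
    exact hA' z hz)
  have h2 := key (show (1 / 2 : ℂ) ∈ ({0, (1 : ℂ)}ᶜ : Set ℂ) by norm_num)
  rw [hB'] at h2
  exact (mul_right_cancel₀ (zpow_ne_zero _ (by norm_num)) h2).symm

end IsModeSystem

end System

/-! ### The Borcherds identity from duality -/

section Borcherds

variable {K V W : Type*} [Field K] [CharZero K] [Algebra ℝ K] [Algebra K ℂ] [IsScalarTower ℝ K ℂ]
  [AddCommGroup V] [Module ℂ V] [AddCommGroup W] [Module ℂ W]

set_option linter.unusedSectionVars false

/-- The products `Y(u, z) Y(v, 1)`, `Y(v, 1) Y(u, z)` and `Y(Y(u, z - 1) v, 1)` are expansions of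
one holomorphic function. -/
def HasDuality (A : NonChiralVOA V) (gr : K × K → Submodule ℂ W)
    (Y : V →ₗ[ℂ] (K → K → Module.End ℂ W)) (u v : V) : Prop :=
  ∀ (y : W) (f : Module.Dual ℂ W), f ∈ contragredient gr →
    ∃ φ : ℂ → ℂ, DifferentiableOn ℂ φ {0, 1}ᶜ ∧
      (∀ z : ℂ, 1 < ‖z‖ →
        HasSum (fun a : ℤ => pairing Y 1 v y (f ∘ₗ Y u a (-1)) * z ^ (-a - 1)) (φ z)) ∧
      (∀ z : ℂ, 0 < ‖z‖ → ‖z‖ < 1 →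
        HasSum (fun a : ℤ => pairing Y 1 v (Y u a (-1) y) f * z ^ (-a - 1)) (φ z)) ∧
      (∀ z : ℂ, 0 < ‖z - 1‖ → ‖z - 1‖ < 1 →
        HasSum (fun a : ℤ => pairing Y 1 (A.Y u a (-1) v) y f * (z - 1) ^ (-a - 1)) (φ z))

variable {A : NonChiralVOA V} {gr : K × K → Submodule ℂ W}
  {Y : V →ₗ[ℂ] (K → K → Module.End ℂ W)}

namespace IsModeSystem

/-- The residue identity with every matrix element at position `1` reduced to a single mode. The
integer `k` enters only through the degree of `f`, which selects the mode of `v`. -/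
theorem jacobi_of_isHomFun (S : IsModeSystem A gr Y) {h hb h' hb' : ℝ} {u v : V}
    (hu : u ∈ A.gr (h, hb)) (hv : v ∈ A.gr (h', hb')) (hd : HasDuality A gr Y u v) (n m k : ℤ)
    (hw : ∀ a : ℤ, A.Y u a (-1) v ∈ A.gr (h' + h - a - 1, hb' + hb))
    {J : ℤ} (hJ : ∀ a : ℤ, J ≤ a → A.Y u a (-1) v = 0) {a b : K} {y : W} (hy : y ∈ gr (a, b))
    {f : Module.Dual ℂ W}
    (hf : IsHomFun gr (a + algebraMap ℝ K h + algebraMap ℝ K h' - (n + m + k : ℤ) - 2,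
      b + algebraMap ℝ K hb + algebraMap ℝ K hb') f) :
    ∃ I₁ I₂ I₃ : ℂ,
      HasSum (fun r : ℕ => Ring.choose (m : ℂ) r * (-1) ^ r *
        f (Y u (n + m - r : ℤ) (-1) (Y v (k + r : ℤ) (-1) y))) I₁ ∧
      HasSum (fun r : ℕ => Ring.choose (m : ℂ) r * (-1) ^ (m + r) *
        f (Y v (k + m - r : ℤ) (-1) (Y u (n + r : ℤ) (-1) y))) I₂ ∧
      HasSum (fun j : ℕ => Ring.choose (n : ℂ) j *
        f (Y (A.Y u (m + j : ℤ) (-1) v) (n + k - j : ℤ) (-1) y)) I₃ ∧ I₁ - I₂ = I₃ := by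
  obtain ⟨φ, hφ, hA, hB, hC⟩ := hd y f hf.mem_contragredient
  obtain ⟨I₁, I₂, I₃, h₁, h₂, h₃, hI⟩ := jacobi_of_expansions hφ hA hB hC (k := J)
    (fun c hc => by rw [hJ c hc]; simp [pairing]) n m
  refine ⟨I₁, I₂, I₃, h₁.congr_fun fun r => ?_, h₂.congr_fun fun r => ?_,
    h₃.congr_fun fun j => ?_, hI⟩
  · rw [S.pairing_one hv (S.comp_isHomFun hu hf _ _) hy, LinearMap.comp_apply]
    push_cast
    ring_nf
  · rw [S.pairing_one hv hf (S.shift hu hy _ _)]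
    push_cast
    ring_nf
  · rw [S.pairing_one (hw _) hf hy]
    simp only [map_add, map_sub, map_one, map_intCast]
    push_cast
    ring_nf

theorem borcherds (S : IsModeSystem A gr Y) {h hb h' hb' : ℝ} {u v : V}
    (hu : u ∈ A.gr (h, hb)) (hv : v ∈ A.gr (h', hb')) (hd : HasDuality A gr Y u v)
    (hw : ∀ a : ℤ, A.Y u a (-1) v ∈ A.gr (h' + h - a - 1, hb' + hb))
    {J : ℤ} (hJ : ∀ a : ℤ, J ≤ a → A.Y u a (-1) v = 0) (n m k : ℤ) :
    ∃ T : Module.End ℂ W,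
      HasFiniteSum (fun j : ℕ => Ring.choose (n : ℂ) j •
        Y (A.Y u (m + j : ℤ) (-1) v) (n + k - j : ℤ) (-1)) T ∧
      ∀ y : W, HasFiniteSum (fun r : ℕ => Ring.choose (m : ℂ) r •
        ((-1 : ℂ) ^ r • Y u (n + m - r : ℤ) (-1) (Y v (k + r : ℤ) (-1) y) -
          (-1 : ℂ) ^ (m + r) • Y v (k + m - r : ℤ) (-1) (Y u (n + r : ℤ) (-1) y))) (T y) := by
  -- From `N₀` on, `u_{m+j} v = 0` already in the algebra. The right-hand side is thus one finite
  -- sum of operators, independent of `y`.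
  set N₀ : ℕ := (J - m).toNat with hN₀
  have hj : ∀ j : ℕ, N₀ ≤ j → A.Y u (m + j : ℤ) (-1) v = 0 := fun j hj => hJ _ (by
    have := Int.self_le_toNat (J - m)
    omega)
  set T : Module.End ℂ W := ∑ j ∈ Finset.range N₀, Ring.choose (n : ℂ) j •
        Y (A.Y u (m + j : ℤ) (-1) v) (n + k - j : ℤ) (-1) with hT
  refine ⟨T, hasFiniteSum_of_range N₀ (fun j hjN => by rw [hj j hjN]; simp) rfl, fun y => ?_⟩
  refine S.grading.induction (P := fun y => HasFiniteSum (fun r : ℕ => Ring.choose (m : ℂ) r •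
        ((-1 : ℂ) ^ r • Y u (n + m - r : ℤ) (-1) (Y v (k + r : ℤ) (-1) y) -
          (-1 : ℂ) ^ (m + r) • Y v (k + m - r : ℤ) (-1) (Y u (n + r : ℤ) (-1) y))) (T y))
    ?_ ?_ ?_ y
  · intro e y hy
    obtain ⟨N₁, h₁⟩ := S.eventually_zero hv y
    obtain ⟨N₂, h₂⟩ := S.eventually_zero hu y
    set N : ℕ := max (N₁ - k).toNat (N₂ - n).toNat
    have hv0 : ∀ r : ℕ, N ≤ r → Y v (k + r : ℤ) (-1) y = 0 := fun r hr => h₁ _ (by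
      have := Int.self_le_toNat (N₁ - k)
      have := (le_max_left (N₁ - k).toNat (N₂ - n).toNat).trans hr
      omega)
    have hu0 : ∀ r : ℕ, N ≤ r → Y u (n + r : ℤ) (-1) y = 0 := fun r hr => h₂ _ (by
      have := Int.self_le_toNat (N₂ - n)
      have := (le_max_right (N₁ - k).toNat (N₂ - n).toNat).trans hr
      omega)
    refine hasFiniteSum_of_range N (fun r hr => by rw [hv0 r hr, hu0 r hr]; simp) ?_
    have hy' : y ∈ gr (e.1, e.2) := hy
    -- Every term on both sides maps `y` into this degree, so it suffices to test against
    -- functionals homogeneous of that degree.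
    refine S.grading.eq_of_forall_isHomFun
      (e := (e.1 + algebraMap ℝ K h + algebraMap ℝ K h' - (n + m + k : ℤ) - 2,
        e.2 + algebraMap ℝ K hb + algebraMap ℝ K hb')) ?_ ?_ fun f hf => ?_
    · refine Submodule.sum_mem _ fun r _ => Submodule.smul_mem _ _ (Submodule.sub_mem _
        (Submodule.smul_mem _ _ ?_) (Submodule.smul_mem _ _ ?_))
      · have := S.shift hu (S.shift hv hy' (k + r : ℤ) (-1)) (n + m - r : ℤ) (-1)
        convert this using 3 <;> push_cast <;> ring
      · have := S.shift hv (S.shift hu hy' (n + r : ℤ) (-1)) (k + m - r : ℤ) (-1)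
        convert this using 3 <;> push_cast <;> ring
    · rw [hT, LinearMap.sum_apply]
      refine Submodule.sum_mem _ fun j _ => Submodule.smul_mem _ _ ?_
      have := S.shift (hw (m + j : ℤ)) hy' (n + k - j : ℤ) (-1)
      convert this using 3 <;> simp only [map_add, map_sub, map_one, map_intCast] <;>
        push_cast <;> ring
    · obtain ⟨I₁, I₂, I₃, e₁, e₂, e₃, hI⟩ := S.jacobi_of_isHomFun hu hv hd n m k hw hJ hy' hf
      have e₁' := e₁.unique (hasSum_sum_of_ne_finset_zero (s := Finset.range N) fun r hr => by
        rw [hv0 r (by simpa using hr)]; simp)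
      have e₂' := e₂.unique (hasSum_sum_of_ne_finset_zero (s := Finset.range N) fun r hr => by
        rw [hu0 r (by simpa using hr)]; simp)
      have e₃' := e₃.unique (hasSum_sum_of_ne_finset_zero (s := Finset.range N₀) fun r hr => by
        rw [hj r (by simpa using hr)]; simp)
      rw [e₁', e₂', e₃', ← Finset.sum_sub_distrib] at hI
      rw [hT, LinearMap.sum_apply, map_sum, map_sum]
      simp only [LinearMap.smul_apply, map_smul, smul_eq_mul]
      rw [← hI]
      refine Finset.sum_congr rfl fun r _ => ?_
      rw [map_sub, map_smul, map_smul, smul_eq_mul, smul_eq_mul]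
      ring
  · simp only [map_zero, smul_zero, sub_zero]
    exact hasFiniteSum_of_range 0 (fun _ _ => rfl) (by simp)
  · intro y₁ y₂ h₁ h₂
    rw [map_add]
    convert h₁.add h₂ using 1
    funext r
    simp only [map_add, smul_add, Pi.add_apply, smul_sub]
    abel

end IsModeSystem

end Borcherds

/-! ### Divided powers and truncated exponentials -/

section Exponential

variable {R : Type*} [Ring R] [Algebra ℂ R]

/-- The divided power `D ^ k / k!`. -/
noncomputable def dpow (D : R) (k : ℕ) : R := ((k.factorial : ℂ)⁻¹) • D ^ k

theorem dpow_zero (D : R) : dpow D 0 = 1 := by simp [dpow]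

theorem dpow_mul_self (D : R) (k : ℕ) : dpow D k * D = ((k : ℂ) + 1) • dpow D (k + 1) := by
  have h : (k : ℂ) + 1 ≠ 0 := by exact_mod_cast k.succ_ne_zero
  rw [dpow, dpow, smul_mul_assoc, ← pow_succ, smul_smul, Nat.factorial_succ]
  congr 1
  push_cast
  rw [mul_inv, mul_inv_cancel_left₀ h]

theorem dpow_mul_dpow (D : R) (i l : ℕ) :
    dpow D l * dpow D i = ((i + l).choose i : ℂ) • dpow D (i + l) := by
  rw [dpow, dpow, dpow, smul_mul_smul_comm, ← pow_add, smul_smul, add_comm l i]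
  congr 1
  rw [Nat.cast_add_choose]
  have h1 := Nat.cast_ne_zero (R := ℂ).2 i.factorial_ne_zero
  have h2 := Nat.cast_ne_zero (R := ℂ).2 l.factorial_ne_zero
  have h3 := Nat.cast_ne_zero (R := ℂ).2 (i + l).factorial_ne_zero
  field_simp

theorem dpow_add {S T : R} (h : Commute S T) (k : ℕ) :
    dpow (S + T) k = ∑ p ∈ Finset.HasAntidiagonal.antidiagonal k, dpow S p.1 * dpow T p.2 := by
  rw [dpow, h.add_pow', Finset.smul_sum]
  refine Finset.sum_congr rfl fun p hp => ?_
  obtain rfl := Finset.HasAntidiagonal.mem_antidiagonal.1 hp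
  rw [dpow, dpow, smul_mul_smul_comm, ← Nat.cast_smul_eq_nsmul ℂ, smul_smul]
  congr 1
  rw [Nat.cast_add_choose]
  have h1 := Nat.cast_ne_zero (R := ℂ).2 p.1.factorial_ne_zero
  have h2 := Nat.cast_ne_zero (R := ℂ).2 p.2.factorial_ne_zero
  have h3 := Nat.cast_ne_zero (R := ℂ).2 (p.1 + p.2).factorial_ne_zero
  field_simp

theorem choose_succ_mul (a : ℂ) (i : ℕ) :
    ((i : ℂ) + 1) * Ring.choose a (i + 1) = Ring.choose a i * (a - i) := by
  have h := Ring.choose_smul_choose a (Nat.le_succ i)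
  simp only [Nat.succ_eq_add_one, Nat.choose_succ_self_right, Nat.add_sub_cancel_left,
    Ring.choose_one_right, nsmul_eq_mul] at h
  exact_mod_cast h

/-- Moving `exp D` past modes `U a` with `[D, U a] = -a U (a - 1)`. -/
theorem mul_dpow {U : ℤ → R} {D : R} (h : ∀ a, U a * D = D * U a + (a : ℂ) • U (a - 1)) (k : ℕ) :
    ∀ a : ℤ, U a * dpow D k = ∑ p ∈ Finset.HasAntidiagonal.antidiagonal k,
      Ring.choose (a : ℂ) p.1 • (dpow D p.2 * U (a - p.1)) := by
  induction k with
  | zero =>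
    intro a
    simp [dpow_zero]
  | succ k ih =>
    intro a
    have hk : (k : ℂ) + 1 ≠ 0 := by exact_mod_cast k.succ_ne_zero
    -- After multiplication by `k + 1`, this factor splits on the antidiagonal as `p.1 + p.2`. The
    -- two parts match the two terms of `U a * D = D * U a + a • U (a - 1)`.
    refine smul_right_injective R hk ?_
    dsimp only
    set g : ℕ × ℕ → R := fun p => Ring.choose (a : ℂ) p.1 • (dpow D p.2 * U (a - p.1)) with hg
    have e1 : ((k : ℂ) + 1) • (U a * dpow D (k + 1)) =
        ∑ p ∈ Finset.HasAntidiagonal.antidiagonal k,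
          (((p.2 : ℂ) + 1) • g (p.1, p.2 + 1) + ((p.1 : ℂ) + 1) • g (p.1 + 1, p.2)) := by
      rw [← mul_smul_comm, ← dpow_mul_self, ← mul_assoc, ih, Finset.sum_mul]
      refine Finset.sum_congr rfl fun p _ => ?_
      rw [smul_mul_assoc, mul_assoc, h, mul_add, ← mul_assoc, dpow_mul_self, hg]
      simp only [smul_add, smul_mul_assoc, smul_smul, mul_smul_comm, choose_succ_mul]
      rw [show a - (p.1 : ℤ) - 1 = a - ((p.1 + 1 : ℕ) : ℤ) by push_cast; ring]
      push_cast
      rw [mul_comm (Ring.choose (a : ℂ) p.1) ((p.2 : ℂ) + 1)]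
    have e2 : ((k : ℂ) + 1) • ∑ p ∈ Finset.HasAntidiagonal.antidiagonal (k + 1), g p =
        (∑ p ∈ Finset.HasAntidiagonal.antidiagonal (k + 1), (p.2 : ℂ) • g p) +
          ∑ p ∈ Finset.HasAntidiagonal.antidiagonal (k + 1), (p.1 : ℂ) • g p := by
      rw [Finset.smul_sum, ← Finset.sum_add_distrib]
      refine Finset.sum_congr rfl fun p hp => ?_
      rw [← add_smul]
      congr 1
      have := Finset.HasAntidiagonal.mem_antidiagonal.1 hp
      have h2 : ((p.1 + p.2 : ℕ) : ℂ) = ((k + 1 : ℕ) : ℂ) := by rw [this]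
      push_cast at h2
      rw [add_comm (p.2 : ℂ), h2]
    rw [e1, e2, Finset.Nat.sum_antidiagonal_succ', Finset.Nat.sum_antidiagonal_succ,
      Finset.sum_add_distrib]
    simp

end Exponential

section ExpDual

variable {V : Type*} [AddCommGroup V] [Module ℂ V]

/-- The truncated series `∑ c ^ k f ∘ D ^ k / k!`. -/
noncomputable def expDual (D : Module.End ℂ V) (c : ℂ) (N : ℕ) (f : Module.Dual ℂ V) :
    Module.Dual ℂ V :=
  ∑ k ∈ Finset.range N, c ^ k • (f ∘ₗ dpow D k)

theorem comp_dpow_of_comp_pow {D : Module.End ℂ V} {f : Module.Dual ℂ V} {k : ℕ}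
    (h : f ∘ₗ D ^ k = 0) : f ∘ₗ dpow D k = 0 := by
  rw [dpow, LinearMap.comp_smul, h, smul_zero]

/-- The truncated form of `U(a) exp(cD) = ∑ binom(a,i) c^i exp(cD) U(a-i)`. All non-zero terms lie
in an `I × N` rectangle, which the triangle of size `N' ≥ I + N` contains. -/
theorem expDual_comp {D : Module.End ℂ V} {U : ℤ → Module.End ℂ V}
    (h : ∀ a, U a * D = D * U a + (a : ℂ) • U (a - 1)) (c : ℂ) {f : Module.Dual ℂ V} {N I N' : ℕ}
    (a : ℤ) (hN : ∀ k, N ≤ k → f ∘ₗ dpow D k = 0)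
    (hI : ∀ i : ℕ, I ≤ i → ∀ k, f ∘ₗ dpow D k ∘ₗ U (a - i) = 0) (hN' : I + N ≤ N') :
    expDual D c N' (f ∘ₗ U a) =
      ∑ i ∈ Finset.range I, (Ring.choose (a : ℂ) i * c ^ i) • (expDual D c N f ∘ₗ U (a - i)) := by
  have := sum_range_antidiagonal
    (fun i l => (Ring.choose (a : ℂ) i * c ^ (i + l)) • (f ∘ₗ dpow D l ∘ₗ U (a - i)))
    (I := I) (L := N) (fun i l hi => by rw [hI i hi, smul_zero])
    (fun i l hl => by rw [← LinearMap.comp_assoc, hN l hl, LinearMap.zero_comp, smul_zero]) hN'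
  have e1 : expDual D c N' (f ∘ₗ U a) = ∑ k ∈ Finset.range N',
      ∑ p ∈ Finset.HasAntidiagonal.antidiagonal k,
        (Ring.choose (a : ℂ) p.1 * c ^ (p.1 + p.2)) • (f ∘ₗ dpow D p.2 ∘ₗ U (a - p.1)) := by
    refine Finset.sum_congr rfl fun k _ => ?_
    have h1 : U a ∘ₗ dpow D k = _ := mul_dpow h k a
    rw [LinearMap.comp_assoc, h1, LinearMap.ext_iff]
    intro x
    simp only [LinearMap.smul_apply, LinearMap.comp_apply, LinearMap.sum_apply, map_sum,
      Finset.smul_sum, map_smul]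
    refine Finset.sum_congr rfl fun p hp => ?_
    rw [Finset.HasAntidiagonal.mem_antidiagonal.1 hp, smul_smul, mul_comm]
    rfl
  rw [e1, this]
  refine Finset.sum_congr rfl fun i _ => ?_
  rw [LinearMap.ext_iff]
  intro x
  simp only [expDual, LinearMap.smul_apply, LinearMap.comp_apply, LinearMap.sum_apply,
    Finset.smul_sum, smul_smul]
  refine Finset.sum_congr rfl fun l _ => ?_
  rw [pow_add, mul_assoc]

/-- On each antidiagonal the binomial theorem gives `(-1 + 1)^k`, so only `k = 0` survives. -/
theorem expDual_neg_expDual {D : Module.End ℂ V} {f : Module.Dual ℂ V} {N : ℕ}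
    (hN : ∀ k, N ≤ k → f ∘ₗ dpow D k = 0) : expDual D (-1) N (expDual D 1 N f) = f := by
  have := sum_range_antidiagonal
    (fun i l => ((-1 : ℂ) ^ i * ((i + l).choose i : ℂ)) • (f ∘ₗ dpow D (i + l)))
    (I := N) (L := N) (fun i l hi => by rw [hN _ (by omega), smul_zero])
    (fun i l hl => by rw [hN _ (by omega), smul_zero]) le_rfl
  have e1 : expDual D (-1) N (expDual D 1 N f) = ∑ i ∈ Finset.range N, ∑ l ∈ Finset.range N,
      ((-1 : ℂ) ^ i * ((i + l).choose i : ℂ)) • (f ∘ₗ dpow D (i + l)) := by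
    refine Finset.sum_congr rfl fun i _ => ?_
    rw [LinearMap.ext_iff]
    intro x
    simp only [expDual, LinearMap.smul_apply, LinearMap.comp_apply, LinearMap.sum_apply,
      Finset.smul_sum, one_pow, one_smul]
    refine Finset.sum_congr rfl fun l _ => ?_
    have h1 : dpow D l (dpow D i x) = _ := LinearMap.congr_fun (dpow_mul_dpow D i l) x
    rw [h1, LinearMap.smul_apply, map_smul, smul_smul]
  rw [e1, ← this]
  have e2 : ∀ k, (∑ p ∈ Finset.HasAntidiagonal.antidiagonal k,
      ((-1 : ℂ) ^ p.1 * ((p.1 + p.2).choose p.1 : ℂ)) • (f ∘ₗ dpow D (p.1 + p.2))) =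
      if k = 0 then f else 0 := by
    intro k
    have h1 : ∀ p ∈ Finset.HasAntidiagonal.antidiagonal k,
        ((-1 : ℂ) ^ p.1 * ((p.1 + p.2).choose p.1 : ℂ)) • (f ∘ₗ dpow D (p.1 + p.2)) =
        ((k.choose p.1) • ((-1 : ℂ) ^ p.1 * 1 ^ p.2)) • (f ∘ₗ dpow D k) := by
      intro p hp
      rw [Finset.HasAntidiagonal.mem_antidiagonal.1 hp, nsmul_eq_mul, one_pow, mul_one, mul_comm]
    rw [Finset.sum_congr rfl h1, ← Finset.sum_smul, ← (Commute.one_right (-1 : ℂ)).add_pow']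
    split_ifs with hk
    · subst hk
      simp [dpow_zero, Module.End.one_eq_id]
    · simp [hk]
  simp only [e2]
  -- For `N = 0` the hypothesis at `k = 0` says `f = 0`, so the empty sum is correct.
  rcases Nat.eq_zero_or_pos N with h0 | h0
  · subst h0
    have := hN 0 le_rfl
    rw [dpow_zero, Module.End.one_eq_id, LinearMap.comp_id] at this
    simp [this]
  · rw [Finset.sum_ite_eq' , if_pos (by simpa using h0)]

end ExpDual

/-! ### Chiral vectors and the weight filtration of the algebra -/

namespace NonChiralVOA

variable {V : Type*} [AddCommGroup V] [Module ℂ V] (A : NonChiralVOA V)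

theorem isGrading : IsGrading A.gr := .of_isInternal A.gr_isInternal

/-- The commutators with `L(0)` and `L̄(0)` make the image a joint eigenvector, which determines its
degree. -/
theorem shift {h hb a b : ℝ} {u w : V} (hu : u ∈ A.gr (h, hb)) (hw : w ∈ A.gr (a, b)) (m n : ℝ) :
    A.Y u m n w ∈ A.gr (a + h - m - 1, b + hb - n - 1) := by
  refine mem_of_eigen A.isGrading (i := fun r : ℝ => (r : ℂ)) Complex.ofReal_injective A.grading
    ?_ ?_
  · have h1 := LinearMap.congr_fun (A.L_zero u m n) w
    rw [Ring.lie_def, (A.grading h hb u hu).1, map_smul] at h1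
    simp only [LinearMap.sub_apply, Module.End.mul_apply, (A.grading a b w hw).1, map_smul,
      LinearMap.add_apply, LinearMap.smul_apply, Pi.smul_apply] at h1
    rw [sub_eq_iff_eq_add] at h1
    rw [h1, ← add_smul, ← add_smul]
    congr 1
    push_cast
    ring
  · have h1 := LinearMap.congr_fun (A.Lbar_zero u m n) w
    rw [Ring.lie_def, (A.grading h hb u hu).2, map_smul] at h1
    simp only [LinearMap.sub_apply, Module.End.mul_apply, (A.grading a b w hw).2, map_smul,
      LinearMap.add_apply, LinearMap.smul_apply, Pi.smul_apply] at h1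
    rw [sub_eq_iff_eq_add] at h1
    rw [h1, ← add_smul, ← add_smul]
    congr 1
    push_cast
    ring

theorem isModeSystem : IsModeSystem A A.gr A.Y where
  grading := A.isGrading
  locality := A.locality
  shift hu _ _ _ hw m n := A.shift hu hw m n
  bounded := by
    obtain ⟨M, hM⟩ := A.bounded_below
    exact ⟨M, fun a b h => hM a b (by simpa using h)⟩
  single_valued := A.single_valued
  chiral hu m n hn := hu m n hn
  antiChiral hu m n hm := hu m n hm

variable {A}

/-- Creation recovers `L̄(-1)u` from `∂_x̄ Y(u) 𝟏`, which vanishes for chiral `u`. -/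
theorem IsChiral.Lbar_eq_zero {u : V} (hu : A.IsChiral u) : A.Lbar (-1) u = 0 := by
  rw [← A.creation_const (A.Lbar (-1) u), (A.translation_bar u _ _).2, hu _ _ (by norm_num),
    smul_zero, LinearMap.zero_apply]

theorem isChiral_of_Lbar_eq_zero {u : V} (hu : A.Lbar (-1) u = 0) : A.IsChiral u := by
  intro m n hn
  have h := (A.translation_bar u m (n + 1)).2
  rw [hu, map_zero, add_sub_cancel_right] at h
  refine (smul_eq_zero.1 h.symm).resolve_left ?_
  rw [neg_eq_zero, Complex.ofReal_eq_zero]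
  intro h0
  exact hn (by linarith)

/-- Chirality is equivalent to being killed by `L̄(-1)`. This operator kills `v` and commutes with
the modes of `u`. -/
theorem IsChiral.mode {u v : V} (hu : A.IsChiral u) (hv : A.IsChiral v) (m n : ℝ) :
    A.IsChiral (A.Y u m n v) := by
  apply isChiral_of_Lbar_eq_zero
  have h := (A.translation_bar u m n).1
  rw [hu.Lbar_eq_zero, map_zero] at h
  have h1 := LinearMap.congr_fun h v
  rw [Ring.lie_def] at h1
  simpa [hv.Lbar_eq_zero] using h1

theorem omega_isChiral : A.IsChiral A.omega := fun m n hn =>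
  A.omega_mode_zero m n (Or.inl hn)

theorem omegabar_isAntiChiral : A.IsAntiChiral A.omegabar := fun m n hn =>
  A.omegabar_mode_zero m n (Or.inl hn)

/-- A non-zero homogeneous chiral vector has `h̄ = 0`. -/
theorem IsChiral.hb_eq_zero {h hb : ℝ} {u : V} (hu : u ∈ A.gr (h, hb)) (hc : A.IsChiral u)
    (hne : u ≠ 0) : hb = 0 := by
  -- `L̄(0)` is a mode of the anti-chiral `ω̄` and so commutes with the mode `(-1, -1)` of `u`. The
  -- `L̄(0)` axiom then leaves `h̄` times that mode, and creation gives `h̄ u = 0`.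
  have hcomm := A.isModeSystem.commute_of_chiral_of_antiChiral hu A.omegabar_mem hc
    omegabar_isAntiChiral (-1) 1
  have h0 : A.Y A.omegabar (-1) 1 = A.Lbar 0 := by
    simpa using A.omegabar_mode 0
  rw [h0] at hcomm
  have h1 := A.Lbar_zero u (-1) (-1)
  rw [Ring.lie_def, (A.grading h hb u hu).2, map_smul] at h1
  rw [show ((-1 : ℤ) : ℝ) = -1 by norm_num] at hcomm
  rw [hcomm.eq, sub_self] at h1
  have h2 := LinearMap.congr_fun h1 A.vac
  simp only [LinearMap.zero_apply, LinearMap.add_apply, LinearMap.smul_apply, Pi.smul_apply,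
    A.creation_const] at h2
  rw [show (-((-1 : ℝ) : ℂ) - 1) = 0 by push_cast; ring, zero_smul, zero_add] at h2
  exact_mod_cast (smul_eq_zero.1 h2.symm).resolve_right hne

variable (A)

/-- The sum of the homogeneous subspaces with `t ≤ h + h̄`. -/
def weightGE (t : ℝ) : Submodule ℂ V := ⨆ (e : ℝ × ℝ) (_ : t ≤ e.1 + e.2), A.gr e

theorem mem_weightGE {a b t : ℝ} {w : V} (hw : w ∈ A.gr (a, b)) (ht : t ≤ a + b) :
    w ∈ A.weightGE t :=
  Submodule.mem_iSup_of_mem (a, b) (Submodule.mem_iSup_of_mem ht hw)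

theorem weightGE_mono {s t : ℝ} (h : s ≤ t) : A.weightGE t ≤ A.weightGE s :=
  iSup₂_le fun e he _ hw => A.mem_weightGE (a := e.1) (b := e.2) hw (h.trans he)

theorem exists_weightGE_eq_top : ∃ t, ∀ w, w ∈ A.weightGE t := by
  obtain ⟨M, hM⟩ := A.bounded_below
  refine ⟨M + M, A.isGrading.induction (fun e w hw => ?_) (Submodule.zero_mem _)
    fun x y hx hy => Submodule.add_mem _ hx hy⟩
  by_cases h : e.1 < M ∨ e.2 < M
  · have hw' : w ∈ A.gr (e.1, e.2) := hw
    rw [hM _ _ h, Submodule.mem_bot] at hw'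
    rw [hw']
    exact Submodule.zero_mem _
  · push Not at h
    exact A.mem_weightGE (a := e.1) (b := e.2) hw (add_le_add h.1 h.2)

theorem mode_mem_weightGE {h hb t : ℝ} {u w : V} (hu : u ∈ A.gr (h, hb)) (m n : ℝ)
    (hw : w ∈ A.weightGE t) : A.Y u m n w ∈ A.weightGE (t + (h + hb - m - n - 2)) := by
  have : A.weightGE t ≤ (A.weightGE (t + (h + hb - m - n - 2))).comap (A.Y u m n) :=
    iSup₂_le fun e he v hv => A.mem_weightGE (A.shift hu (a := e.1) (b := e.2) hv m n)
      (by linarith)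
  exact this hw

/-- The derivation `L(-1) + L̄(-1)`. -/
def deriv : Module.End ℂ V := A.L (-1) + A.Lbar (-1)

theorem L_neg_one : A.L (-1) = A.Y A.omega 0 (-1) := by
  simpa using (A.omega_mode (-1)).symm

theorem Lbar_neg_one : A.Lbar (-1) = A.Y A.omegabar (-1) 0 := by
  simpa using (A.omegabar_mode (-1)).symm

theorem deriv_mem_weightGE {t : ℝ} {w : V} (hw : w ∈ A.weightGE t) :
    A.deriv w ∈ A.weightGE (t + 1) := by
  have h1 := A.mode_mem_weightGE A.omega_mem 0 (-1) hw
  have h2 := A.mode_mem_weightGE A.omegabar_mem (-1) 0 hw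
  rw [deriv, LinearMap.add_apply, L_neg_one, Lbar_neg_one]
  refine Submodule.add_mem _ ?_ ?_
  · convert h1 using 2
    norm_num
  · convert h2 using 2
    norm_num

theorem deriv_pow_mem_weightGE {t : ℝ} {w : V} (hw : w ∈ A.weightGE t) (k : ℕ) :
    (A.deriv ^ k) w ∈ A.weightGE (t + k) := by
  induction k with
  | zero => simpa using hw
  | succ k ih =>
    rw [pow_succ', Module.End.mul_apply]
    convert A.deriv_mem_weightGE ih using 2
    push_cast
    ring

variable {A}

theorem exists_eq_zero_on_weightGE {f : Module.Dual ℂ V} (hf : f ∈ contragredient A.gr) :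
    ∃ t, ∀ w ∈ A.weightGE t, f w = 0 := by
  have hf' : {a | ∃ v ∈ A.gr a, f v ≠ 0}.Finite := hf
  obtain ⟨t, ht⟩ := (hf'.image fun e : ℝ × ℝ => e.1 + e.2).bddAbove
  refine ⟨t + 1, fun w hw => ?_⟩
  have : A.weightGE (t + 1) ≤ LinearMap.ker f := by
    refine iSup₂_le fun e he v hv => ?_
    by_contra hne
    have := ht (Set.mem_image_of_mem (fun e : ℝ × ℝ => e.1 + e.2)
      (show e ∈ {a | ∃ v ∈ A.gr a, f v ≠ 0} from ⟨v, hv, hne⟩))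
    linarith
  exact this hw

/-- `f` vanishes in total weight at least `t`, all of `V` lies in total weight at least `s`, and
`D^k` raises the weight by `k`. Hence `N > t - s` works uniformly in the vector. -/
theorem exists_comp_dpow_eq_zero {f : Module.Dual ℂ V} (hf : f ∈ contragredient A.gr) :
    ∃ N : ℕ, ∀ k, N ≤ k → f ∘ₗ dpow A.deriv k = 0 := by
  obtain ⟨t, ht⟩ := exists_eq_zero_on_weightGE hf
  obtain ⟨s, hs⟩ := A.exists_weightGE_eq_top
  obtain ⟨N, hN⟩ := exists_nat_gt (t - s)
  refine ⟨N, fun k hk => comp_dpow_of_comp_pow (LinearMap.ext fun w => ?_)⟩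
  refine ht _ (A.weightGE_mono ?_ (A.deriv_pow_mem_weightGE (hs w) k))
  have : (N : ℝ) ≤ k := by exact_mod_cast hk
  linarith

theorem exists_comp_dpow_comp_mode_eq_zero {f : Module.Dual ℂ V} (hf : f ∈ contragredient A.gr)
    {h hb : ℝ} {u : V} (hu : u ∈ A.gr (h, hb)) :
    ∃ N : ℤ, ∀ a : ℤ, a < N → ∀ k, f ∘ₗ dpow A.deriv k ∘ₗ A.Y u a (-1) = 0 := by
  obtain ⟨t, ht⟩ := exists_eq_zero_on_weightGE hf
  obtain ⟨s, hs⟩ := A.exists_weightGE_eq_top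
  obtain ⟨N, hN⟩ := exists_int_lt (s + h + hb - 1 - t)
  refine ⟨N, fun a ha k => LinearMap.ext fun w => ?_⟩
  have h1 := A.mode_mem_weightGE hu a (-1) (hs w)
  have h2 := A.deriv_pow_mem_weightGE h1 k
  have h3 : (a : ℝ) < N := by exact_mod_cast ha
  have h4 : (0 : ℝ) ≤ k := Nat.cast_nonneg k
  simp only [LinearMap.comp_apply, dpow, LinearMap.smul_apply, map_smul, LinearMap.zero_apply]
  rw [ht _ (A.weightGE_mono (by linarith) h2), smul_zero]

theorem comp_dpow_mem {f : Module.Dual ℂ V} (hf : f ∈ contragredient A.gr) (k : ℕ) :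
    f ∘ₗ dpow A.deriv k ∈ contragredient A.gr := by
  rw [dpow, LinearMap.comp_smul]
  refine Submodule.smul_mem _ _ ?_
  induction k with
  | zero => simpa [Module.End.one_eq_id] using hf
  | succ k ih =>
    rw [pow_succ, Module.End.mul_eq_comp, ← LinearMap.comp_assoc]
    generalize f ∘ₗ A.deriv ^ k = g at ih ⊢
    rw [deriv, LinearMap.comp_add]
    refine Submodule.add_mem _ ?_ ?_
    · rw [L_neg_one]
      exact A.isModeSystem.comp_mem_contragredient A.omega_mem ih _ _
    · rw [Lbar_neg_one]
      exact A.isModeSystem.comp_mem_contragredient A.omegabar_mem ih _ _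

theorem expDual_mem {f : Module.Dual ℂ V} (hf : f ∈ contragredient A.gr) (c : ℂ) (N : ℕ) :
    expDual A.deriv c N f ∈ contragredient A.gr :=
  Submodule.sum_mem _ fun _ _ => Submodule.smul_mem _ _ (comp_dpow_mem hf _)

/-- `L(-1)` differentiates `Y(u, x)` and `L̄(-1)` commutes with it. This is the relation needed to
move `exp D` past the modes of `u`. -/
theorem IsChiral.mode_mul_deriv {u : V} (hu : A.IsChiral u) (a : ℤ) :
    A.Y u a (-1) * A.deriv = A.deriv * A.Y u a (-1) + (a : ℂ) • A.Y u (a - 1 : ℤ) (-1) := by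
  have h1 := (A.translation u a (-1)).1.trans (A.translation u a (-1)).2
  have h2 := (A.translation_bar u a (-1)).1
  rw [hu.Lbar_eq_zero, map_zero] at h2
  rw [Ring.lie_def] at h1 h2
  have h2' : A.Lbar (-1) * A.Y u a (-1) - A.Y u a (-1) * A.Lbar (-1) = 0 := h2
  have e : (((a - 1 : ℤ) : ℝ)) = (a : ℝ) - 1 := by push_cast; rfl
  have e' : (((a : ℝ)) : ℂ) = (a : ℂ) := by push_cast; rfl
  rw [e' , neg_smul] at h1
  rw [sub_eq_iff_eq_add] at h1
  rw [sub_eq_zero] at h2'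
  rw [deriv, mul_add, add_mul, h1, h2', e]
  abel

end NonChiralVOA

/-! ### Matrix elements at position -1 and vertex operators on the vacuum -/

theorem pairing_sum_smul {K V W : Type*} [Field K] [CharZero K] [Algebra K ℂ] [AddCommGroup V]
    [Module ℂ V] [AddCommGroup W] [Module ℂ W] {gr : K × K → Submodule ℂ W}
    {Y : V →ₗ[ℂ] (K → K → Module.End ℂ W)} (hY : IsLocal gr Y) {s : ℂ} (hs : s ≠ 0) (w : V) (y : W)
    {ι : Type*} (t : Finset ι) (c : ι → ℂ) {f : ι → Module.Dual ℂ W}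
    (hf : ∀ i ∈ t, f i ∈ contragredient gr) :
    pairing Y s w y (∑ i ∈ t, c i • f i) = ∑ i ∈ t, c i * pairing Y s w y (f i) := by
  have h : HasSum (fun k : K × K => ∑ i ∈ t, c i * (f i (Y w k.1 k.2 y) * modePow k s))
      (∑ i ∈ t, c i * pairing Y s w y (f i)) :=
    hasSum_sum fun i hi => ((hY.summable hs w y (hf i hi)).hasSum).mul_left (c i)
  rw [← h.tsum_eq, pairing]
  refine tsum_congr fun k => ?_
  rw [LinearMap.sum_apply, Finset.sum_mul]
  refine Finset.sum_congr rfl fun i _ => ?_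
  rw [LinearMap.smul_apply, smul_eq_mul, mul_assoc]

/-- The logarithms of `z` and `z̄` at `-1` are `iπ` and `-iπ`. For integral exponents both give the
same sign. -/
theorem modePow_neg_one (i l : ℕ) : modePow ((-1 - i, -1 - l) : ℝ × ℝ) (-1) = (-1) ^ (i + l) := by
  have h1 : ∀ n : ℕ, Complex.exp (n * (Real.pi * Complex.I)) = (-1) ^ n := fun n => by
    rw [Complex.exp_nat_mul, Complex.exp_pi_mul_I]
  have h2 : ∀ n : ℕ, Complex.exp (n * (-(Real.pi * Complex.I))) = (-1) ^ n := fun n => by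
    rw [Complex.exp_nat_mul, Complex.exp_neg, Complex.exp_pi_mul_I, inv_neg_one]
  simp only [modePow, conjPow, Complex.log_neg_one, map_mul, Complex.conj_ofReal, Complex.conj_I,
    mul_neg, Complex.exp_add, pow_add]
  rw [← h1, ← h2]
  simp

namespace NonChiralVOA

variable {V : Type*} [AddCommGroup V] [Module ℂ V] {A : NonChiralVOA V}

/-- The creation axiom does not by itself exclude positive non-integral powers. Passing to `L(-1)u`
raises the index by one at the cost of a factor that is non-zero for non-integral `m`. Iteration
reaches indices above `-1`, where creation applies. -/
theorem mode_vac_eq_zero {m : ℝ} (hm : ∀ a : ℤ, m ≠ a) (u : V) (n : ℝ) :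
    A.Y u m n A.vac = 0 := by
  have key : ∀ (t : ℕ) (u : V) (m : ℝ), (∀ a : ℤ, m ≠ a) → -1 - (t : ℝ) < m →
      A.Y u m n A.vac = 0 := by
    intro t
    induction t with
    | zero =>
      intro u m _ hlt
      refine A.creation_nonneg u m n fun h => ?_
      simp at hlt
      linarith [h.1]
    | succ t ih =>
      intro u m hm hlt
      have h1 := ih (A.L (-1) u) (m + 1) (fun a ha => hm (a - 1) (by push_cast; linarith))
        (by push_cast at hlt; linarith)
      rw [(A.translation u (m + 1) n).2, add_sub_cancel_right, LinearMap.smul_apply,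
        smul_eq_zero] at h1
      refine h1.resolve_left fun h0 => hm (-1) ?_
      rw [neg_eq_zero, Complex.ofReal_eq_zero] at h0
      push_cast
      linarith
  obtain ⟨t, ht⟩ := exists_nat_gt (-1 - m)
  exact key t u m hm (by linarith)

theorem mode_vac_eq_zero_bar {n : ℝ} (hn : ∀ a : ℤ, n ≠ a) (u : V) (m : ℝ) :
    A.Y u m n A.vac = 0 := by
  have key : ∀ (t : ℕ) (u : V) (n : ℝ), (∀ a : ℤ, n ≠ a) → -1 - (t : ℝ) < n →
      A.Y u m n A.vac = 0 := by
    intro t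
    induction t with
    | zero =>
      intro u n _ hlt
      refine A.creation_nonneg u m n fun h => ?_
      simp at hlt
      linarith [h.2]
    | succ t ih =>
      intro u n hn hlt
      have h1 := ih (A.Lbar (-1) u) (n + 1) (fun a ha => hn (a - 1) (by push_cast; linarith))
        (by push_cast at hlt; linarith)
      rw [(A.translation_bar u m (n + 1)).2, add_sub_cancel_right, LinearMap.smul_apply,
        smul_eq_zero] at h1
      refine h1.resolve_left fun h0 => hn (-1) ?_
      rw [neg_eq_zero, Complex.ofReal_eq_zero] at h0
      push_cast
      linarith
  obtain ⟨t, ht⟩ := exists_nat_gt (-1 - n)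
  exact key t u n hn (by linarith)

/-- Iterated translation. With its analogue for `L̄(-1)` it gives `Y(u, x, x̄) 𝟏 = exp(x L(-1) + x̄
L̄(-1)) u` coefficient by coefficient. -/
theorem Y_dpow_L (i : ℕ) : ∀ (u : V) (n : ℝ),
    A.Y u (-1 - i) n = A.Y (dpow (A.L (-1)) i u) (-1) n := by
  induction i with
  | zero => simp [dpow_zero]
  | succ i ih =>
    intro u n
    have hi : (i : ℂ) + 1 ≠ 0 := by exact_mod_cast i.succ_ne_zero
    have h1 := (A.translation u (-1 - i) n).2
    have h2 := LinearMap.congr_fun (dpow_mul_self (A.L (-1)) i) u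
    rw [Module.End.mul_apply, LinearMap.smul_apply] at h2
    rw [ih, h2, map_smul] at h1
    have h3 : (-((-1 - i : ℝ) : ℂ)) = (i : ℂ) + 1 := by push_cast; ring
    rw [h3] at h1
    have h4 := smul_right_injective _ hi h1
    rw [h4]
    push_cast
    ring_nf

theorem Y_dpow_Lbar (i : ℕ) : ∀ (u : V) (m : ℝ),
    A.Y u m (-1 - i) = A.Y (dpow (A.Lbar (-1)) i u) m (-1) := by
  induction i with
  | zero => simp [dpow_zero]
  | succ i ih =>
    intro u m
    have hi : (i : ℂ) + 1 ≠ 0 := by exact_mod_cast i.succ_ne_zero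
    have h1 := (A.translation_bar u m (-1 - i)).2
    have h2 := LinearMap.congr_fun (dpow_mul_self (A.Lbar (-1)) i) u
    rw [Module.End.mul_apply, LinearMap.smul_apply] at h2
    rw [ih, h2, map_smul] at h1
    have h3 : (-((-1 - i : ℝ) : ℂ)) = (i : ℂ) + 1 := by push_cast; ring
    rw [h3] at h1
    have h4 := smul_right_injective _ hi h1
    rw [h4]
    push_cast
    ring_nf

/-- This is `Y(w, -1) 𝟏 = exp(-D) w`. At `-1` the powers depend only on `i + l`, so the divided
powers of the commuting `L(-1)` and `L̄(-1)` recombine on antidiagonals into those of `D`. -/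
theorem pairing_vac {g : Module.Dual ℂ V} (hg : g ∈ contragredient A.gr) {N : ℕ}
    (hN : ∀ k, N ≤ k → g ∘ₗ dpow A.deriv k = 0) (w : V) :
    pairing A.Y (-1) w A.vac g = expDual A.deriv (-1) N g w := by
  have h := (A.locality.summable (s := -1) (by norm_num) w A.vac hg).hasSum
  have inj : Function.Injective fun p : ℕ × ℕ => ((-1 - p.1, -1 - p.2) : ℝ × ℝ) := by
    rintro ⟨i, l⟩ ⟨i', l'⟩ h
    simpa using h
  rw [← inj.hasSum_iff] at h
  · rw [← Finset.HasAntidiagonal.sigmaAntidiagonalEquivProd.hasSum_iff] at h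
    have h2 := h.sigma fun k => hasSum_fintype _
    have e1 : HasSum (fun k : ℕ => (-1 : ℂ) ^ k * g (dpow A.deriv k w))
        (pairing A.Y (-1) w A.vac g) := by
      refine h2.congr_fun fun k => ?_
      have hcomm : Commute (A.L (-1)) (A.Lbar (-1)) := by
        have := A.virasoro_comm (-1) (-1)
        rwa [Ring.lie_def, sub_eq_zero] at this
      rw [deriv, dpow_add hcomm, LinearMap.sum_apply, map_sum, Finset.mul_sum,
        ← Finset.sum_coe_sort]
      refine Finset.sum_congr rfl fun p _ => ?_
      have hp := Finset.HasAntidiagonal.mem_antidiagonal.1 p.2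
      simp only [Function.comp_apply, Finset.HasAntidiagonal.sigmaAntidiagonalEquivProd_apply,
        modePow_neg_one, hp, Y_dpow_Lbar, Y_dpow_L, A.creation_const, Module.End.mul_apply]
      rw [mul_comm]
    have e2 := hasSum_sum_of_ne_finset_zero (L := SummationFilter.unconditional ℕ)
      (f := fun k : ℕ => (-1 : ℂ) ^ k * g (dpow A.deriv k w)) (s := Finset.range N) fun k hk => by
        have := LinearMap.congr_fun (hN k (by simpa using hk)) w
        rw [LinearMap.comp_apply] at this
        rw [this]
        simp
    rw [e1.unique e2]
    simp [expDual]
  · rintro ⟨m, n⟩ hk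
    have : A.Y w m n A.vac = 0 := by
      by_cases hm : ∀ a : ℤ, m ≠ a
      · exact mode_vac_eq_zero hm w n
      by_cases hn : ∀ a : ℤ, n ≠ a
      · exact mode_vac_eq_zero_bar hn w m
      push Not at hm hn
      obtain ⟨a, rfl⟩ := hm
      obtain ⟨b, rfl⟩ := hn
      refine A.creation_nonneg w _ _ fun ⟨ha, hb⟩ => hk ?_
      have ha' : a ≤ -1 := by exact_mod_cast ha
      have hb' : b ≤ -1 := by exact_mod_cast hb
      obtain ⟨i, hi⟩ := Int.eq_ofNat_of_zero_le (show 0 ≤ -1 - a by omega)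
      obtain ⟨l, hl⟩ := Int.eq_ofNat_of_zero_le (show 0 ≤ -1 - b by omega)
      refine ⟨(i, l), ?_⟩
      obtain rfl : a = -1 - i := by omega
      obtain rfl : b = -1 - l := by omega
      push_cast
      rfl
    simp [this]

/-- The sums of the formula for moving `exp D` past the modes of a chiral vector. -/
theorem exists_expDual_comp_mode {f : Module.Dual ℂ V} (hf : f ∈ contragredient A.gr) {h hb : ℝ}
    {u : V} (hu : u ∈ A.gr (h, hb)) (hc : A.IsChiral u) {N : ℕ}
    (hN : ∀ k, N ≤ k → f ∘ₗ dpow A.deriv k = 0) (a : ℤ) (c : ℂ) :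
    ∃ I M : ℕ, (∀ k, M ≤ k → (f ∘ₗ A.Y u a (-1)) ∘ₗ dpow A.deriv k = 0) ∧
      (∀ i : ℕ, I ≤ i → ∀ k, f ∘ₗ dpow A.deriv k ∘ₗ A.Y u (a - i : ℤ) (-1) = 0) ∧
      expDual A.deriv c M (f ∘ₗ A.Y u a (-1)) = ∑ i ∈ Finset.range I,
        (Ring.choose (a : ℂ) i * c ^ i) • (expDual A.deriv c N f ∘ₗ A.Y u (a - i : ℤ) (-1)) := by
  obtain ⟨N₁, h₁⟩ := exists_comp_dpow_comp_mode_eq_zero hf hu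
  obtain ⟨M, hM⟩ := exists_comp_dpow_eq_zero
    (A.isModeSystem.comp_mem_contragredient hu hf a (-1))
  have hI : ∀ i : ℕ, (a - N₁ + 1).toNat ≤ i → ∀ k,
      f ∘ₗ dpow A.deriv k ∘ₗ A.Y u (a - i : ℤ) (-1) = 0 := fun i hi => h₁ _ (by
    have := Int.self_le_toNat (a - N₁ + 1)
    omega)
  refine ⟨_, max M ((a - N₁ + 1).toNat + N), fun k hk => hM k ((le_max_left _ _).trans hk), hI, ?_⟩
  exact expDual_comp (U := fun a : ℤ => A.Y u a (-1)) (fun b => hc.mode_mul_deriv b) c a hN hI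
    (le_max_right _ _)

end NonChiralVOA

theorem ChiralModes.pairing_one {K V W : Type*} [Field K] [CharZero K] [Algebra K ℂ]
    [AddCommGroup V] [Module ℂ V] [AddCommGroup W] [Module ℂ W]
    {Y : V →ₗ[ℂ] (K → K → Module.End ℂ W)} {u : V} (hu : ChiralModes Y u) (y : W)
    (f : Module.Dual ℂ W) : pairing Y 1 u y f = ∑' a : ℤ, f (Y u a (-1) y) := by
  rw [pairing, ← (intCast_neg_one_injective (K := K)).tsum_eq]
  · simp [modePow_one]
  · intro k hk
    by_contra h
    exact hk (by simp [hu.eq_zero_of_notMem_range h])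

theorem expDual_comp_eq_zero {V : Type*} [AddCommGroup V] [Module ℂ V] {D T : Module.End ℂ V}
    {f : Module.Dual ℂ V} (h : ∀ k, f ∘ₗ dpow D k ∘ₗ T = 0) (c : ℂ) (N : ℕ) :
    expDual D c N f ∘ₗ T = 0 := by
  rw [LinearMap.ext_iff]
  intro x
  rw [LinearMap.comp_apply, expDual, LinearMap.sum_apply]
  refine Finset.sum_eq_zero fun k _ => ?_
  have := LinearMap.congr_fun (h k) x
  simp only [LinearMap.comp_apply, LinearMap.zero_apply] at this
  rw [LinearMap.smul_apply, LinearMap.comp_apply, this, smul_zero]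

/-! ### Skew-symmetry and duality on the algebra -/

namespace NonChiralVOA

variable {V : Type*} [AddCommGroup V] [Module ℂ V] {A : NonChiralVOA V}

/-- Skew-symmetry: `Y(v, 1) w = exp(L(-1) + L̄(-1)) Y(w, -1) v`. -/
theorem skew_symmetry {h hb : ℝ} {v : V} (hv : v ∈ A.gr (h, hb)) (hc : A.IsChiral v) (w : V)
    {f : Module.Dual ℂ V} (hf : f ∈ contragredient A.gr) {N : ℕ}
    (hN : ∀ k, N ≤ k → f ∘ₗ dpow A.deriv k = 0) :
    pairing A.Y 1 v w f = pairing A.Y (-1) w v (expDual A.deriv 1 N f) := by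
  have hch := A.isModeSystem.chiralModes hv hc
  -- `φ(z) = ⟨f exp(D), Y(v,z) Y(w,-1) 𝟏⟩`, to be compared with `ψ(z) = ⟨f, Y(v,z+1) w⟩`, a finite
  -- sum.
  obtain ⟨φ, hφ, hA, hB⟩ := A.locality.two_point hch w A.vac (expDual_mem hf 1 N)
    (s := -1) (by norm_num)
  obtain ⟨j₀, hj₀⟩ := exists_comp_dpow_comp_mode_eq_zero hf hv
  obtain ⟨j₁, hj₁⟩ := A.isModeSystem.eventually_zero hv w
  set c : ℤ → ℂ := fun j => f (A.Y v j (-1) w) with hc_def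
  have hc₀ : ∀ j < j₀, c j = 0 := fun j hj => by
    have := LinearMap.congr_fun (hj₀ j hj 0) w
    simpa [dpow_zero] using this
  have hc₁ : ∀ j, j₁ ≤ j → c j = 0 := fun j hj => by
    simp only [hc_def, hj₁ j hj, map_zero]
  have hc_supp : ∀ j ∉ Finset.Ico j₀ j₁, c j = 0 := fun j hj => by
    rw [Finset.mem_Ico, not_and_or, not_le, not_lt] at hj
    exact hj.elim (hc₀ j) (hc₁ j)
  set ψ : ℂ → ℂ := fun z => ∑ j ∈ Finset.Ico j₀ j₁, c j * (z - (-1)) ^ (-j - 1) with hψ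
  have hψd : ∀ z : ℂ, z ≠ -1 → DifferentiableAt ℂ ψ z := fun z hz => by
    refine DifferentiableAt.fun_sum fun j _ => DifferentiableAt.const_mul ?_ _
    exact (differentiableAt_id.sub_const _).zpow (Or.inl (sub_ne_zero.2 hz))
  -- `Y(w,-1) 𝟏 = exp(-D) w`. Moving `exp(-D)` left past `v_b` cancels `exp(D)` and leaves the
  -- binomial sum that re-expands `ψ` at infinity.
  have hexp : ∀ b : ℤ, HasSum (fun i : ℕ => Ring.choose (b : ℂ) i * (-1) ^ i * c (b - i))
      (pairing A.Y (-1) w A.vac (expDual A.deriv 1 N f ∘ₗ A.Y v b (-1))) := by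
    intro b
    obtain ⟨N', hN'⟩ := exists_comp_dpow_eq_zero (expDual_mem hf 1 N)
    have hN₂ : ∀ k, max N N' ≤ k → expDual A.deriv 1 N f ∘ₗ dpow A.deriv k = 0 :=
      fun k hk => hN' k ((le_max_right _ _).trans hk)
    obtain ⟨I, M, hM, hI, hE⟩ := exists_expDual_comp_mode (expDual_mem hf 1 N) hv hc hN₂ b (-1)
    have hinv : expDual A.deriv (-1) (max N N') (expDual A.deriv 1 N f) = f := by
      have : expDual A.deriv 1 N f = expDual A.deriv 1 (max N N') f := by
        refine Finset.sum_subset (Finset.range_mono (le_max_left _ _)) fun k _ hk => ?_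
        rw [hN k (by simpa using hk), smul_zero]
      rw [this]
      exact expDual_neg_expDual fun k hk => hN k ((le_max_left _ _).trans hk)
    rw [hinv] at hE
    rw [pairing_vac (A.isModeSystem.comp_mem_contragredient hv (expDual_mem hf 1 N) _ _) hM, hE,
      LinearMap.sum_apply]
    refine hasSum_sum_of_ne_finset_zero (L := SummationFilter.unconditional ℕ) fun i hi => ?_
    have h1 := expDual_comp_eq_zero (hI i (by simpa using hi)) (-1) (max N N')
    rw [hinv] at h1
    have h2 := LinearMap.congr_fun h1 w
    rw [LinearMap.comp_apply] at h2
    simp only [hc_def]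
    rw [h2]
    simp
  have hφψ : ∀ z : ℂ, 2 < ‖z‖ → φ z = ψ z := by
    intro z hz
    refine (hA z (by rw [norm_neg, norm_one]; linarith)).unique
      (hasSum_shift (c := -1) (by simp) hc₀ (ψ := ψ) (fun z _ => ?_) hexp hz)
    exact hasSum_sum_of_ne_finset_zero (L := SummationFilter.unconditional ℤ) fun j hj => by
      rw [hc_supp j hj, zero_mul]
  have heq : Set.EqOn φ ψ {0, -1}ᶜ := by
    refine eqOn_compl_pair hφ (fun z hz => (hψd z fun h => hz (by simp [h])).differentiableWithinAt)
      (z₀ := 3) (by norm_num) ?_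
    filter_upwards [(isOpen_lt continuous_const continuous_norm).mem_nhds
      (show (2 : ℝ) < ‖(3 : ℂ)‖ by norm_num)] with z hz
    exact hφψ z hz
  have hsph : ∀ z ∈ Metric.sphere (0 : ℂ) (1 / 2), z ≠ 0 ∧ z ≠ -1 := by
    intro z hz
    constructor <;> rintro rfl <;> norm_num at hz
  -- The moment at `-1` is the constant term of the inner expansion. There `v_{-1} 𝟏 = v`, so it is
  -- the right-hand side of skew-symmetry, while `ψ 0` is the left-hand side.
  have i1 := circleIntegral_zpow_mul_of_hasSum (φ := φ) (z₀ := 0) (R := 1 / 2) (by norm_num)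
    (c := fun a : ℤ => pairing A.Y (-1) w (A.Y v a (-1) A.vac) (expDual A.deriv 1 N f))
    (fun z hz => by
      rw [mem_sphere_iff_norm, sub_zero] at hz
      simpa using hB z (by rw [hz]; norm_num) (by rw [hz]; norm_num)) (-1)
  have i2 : (∮ z in C(0, 1 / 2), (z - 0)⁻¹ • ψ z) = (2 * Real.pi * Complex.I) • ψ 0 := by
    refine DifferentiableOn.circleIntegral_sub_inv_smul
      (fun z hz => (hψd z ?_).differentiableWithinAt) (Metric.mem_ball_self (by norm_num))
    rintro rfl
    norm_num at hz
  have i3 : (∮ z in C(0, 1 / 2), (z - 0) ^ (-1 : ℤ) * φ z) =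
      ∮ z in C(0, 1 / 2), (z - 0)⁻¹ • ψ z := by
    refine circleIntegral.integral_congr (by norm_num) fun z hz => ?_
    have := heq (show z ∈ ({0, -1}ᶜ : Set ℂ) by simpa using hsph z hz)
    rw [this, zpow_neg_one, smul_eq_mul]
  rw [i3, i2, smul_eq_mul] at i1
  have i4 := mul_left_cancel₀ Complex.two_pi_I_ne_zero i1
  have h1 : A.Y v ((-1 : ℤ) : ℝ) (-1) A.vac = v := by
    rw [← A.creation_const v]
    norm_num [A.creation_const]
  rw [h1] at i4
  rw [← i4, hch.pairing_one, hψ]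
  simp only [zero_sub, neg_neg, one_zpow, mul_one]
  exact tsum_eq_sum fun j hj => hc_supp j hj

/-- Only the expansion at `1` goes beyond locality. It is the inner expansion of the second
two-point function `φ'(z - 1) = ⟨f exp(D), Y(u,z-1) Y(y,-1) v⟩`, which equals `φ(z)` by
skew-symmetry. -/
theorem hasDuality {h hb h' hb' : ℝ} {u v : V} (hu : u ∈ A.gr (h, hb)) (hcu : A.IsChiral u)
    (hv : v ∈ A.gr (h', hb')) (hcv : A.IsChiral v) : HasDuality A A.gr A.Y u v := by
  intro y f hf
  have hch := A.isModeSystem.chiralModes hu hcu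
  obtain ⟨N, hN⟩ := exists_comp_dpow_eq_zero hf
  have hf' := expDual_mem hf 1 N
  obtain ⟨φ, hφ, hA, hB⟩ := A.locality.two_point hch v y hf (s := 1) one_ne_zero
  obtain ⟨φ', hφ', hA', hB'⟩ := A.locality.two_point hch y v hf' (s := -1) (by norm_num)
  simp only [norm_one, norm_neg] at hA hB hA' hB'
  have hd : DifferentiableOn ℂ (fun z => φ' (z - 1)) {0, 1}ᶜ := by
    intro z hz
    have hz' : z - 1 ∈ ({0, -1}ᶜ : Set ℂ) := by
      simp only [Set.mem_compl_iff, Set.mem_insert_iff, Set.mem_singleton_iff, not_or] at hz ⊢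
      refine ⟨sub_ne_zero.2 hz.2, fun h => hz.1 ?_⟩
      linear_combination h
    have h1 := (hφ' _ hz').differentiableAt ((isOpen_compl_pair 0 (-1)).mem_nhds hz')
    exact (h1.comp z (differentiableAt_id.sub_const 1)).differentiableWithinAt
  obtain ⟨a₀, ha₀⟩ := exists_comp_dpow_comp_mode_eq_zero hf' hu
  have hzero : ∀ a < a₀, pairing A.Y (-1) y v (expDual A.deriv 1 N f ∘ₗ A.Y u a (-1)) = 0 := by
    intro a ha
    have h1 := ha₀ a ha 0
    rw [dpow_zero, Module.End.one_eq_id, LinearMap.id_comp] at h1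
    simp [h1, pairing]
  -- Skew-symmetry for `v` and `y`, followed by moving `exp(D)` past `u_b`, expresses the outer
  -- coefficients of `φ` as those of `φ'` re-expanded about the shifted centre.
  have hexp : ∀ b : ℤ, HasSum (fun i : ℕ => Ring.choose (b : ℂ) i * 1 ^ i *
      pairing A.Y (-1) y v (expDual A.deriv 1 N f ∘ₗ A.Y u (b - i : ℤ) (-1)))
      (pairing A.Y 1 v y (f ∘ₗ A.Y u b (-1))) := by
    intro b
    obtain ⟨I, M, hM, hI, hE⟩ := exists_expDual_comp_mode hf hu hcu hN b 1
    rw [skew_symmetry hv hcv y (A.isModeSystem.comp_mem_contragredient hu hf _ _) hM, hE,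
      pairing_sum_smul A.locality (by norm_num) _ _ _ _ fun i _ =>
        A.isModeSystem.comp_mem_contragredient hu hf' _ _]
    refine hasSum_sum_of_ne_finset_zero (L := SummationFilter.unconditional ℕ) fun i hi => ?_
    rw [expDual_comp_eq_zero (hI i (by simpa using hi))]
    simp [pairing]
  have heq : Set.EqOn φ (fun z => φ' (z - 1)) {0, 1}ᶜ := by
    refine eqOn_compl_pair hφ hd (z₀ := 3) (by norm_num) ?_
    filter_upwards [(isOpen_lt continuous_const continuous_norm).mem_nhds
      (show (2 : ℝ) < ‖(3 : ℂ)‖ by norm_num)] with z hz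
    exact (hA z (by linarith)).unique (hasSum_shift (c := 1) (by simp) hzero
      (ψ := fun z => φ' (z - 1)) (fun z hz => hA' (z - 1) hz) hexp hz)
  refine ⟨φ, hφ, hA, hB, fun z hz0 hz1 => ?_⟩
  have hmem : z ∈ ({0, 1}ᶜ : Set ℂ) := by
    simp only [Set.mem_compl_iff, Set.mem_insert_iff, Set.mem_singleton_iff, not_or]
    constructor
    · rintro rfl
      norm_num at hz1
    · rintro rfl
      norm_num at hz0
  rw [heq hmem]
  refine (hB' (z - 1) hz0 hz1).congr_fun fun a => ?_
  -- Skew-symmetry applies to `u_a v` because that vector is again homogeneous and chiral.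
  rw [skew_symmetry (A.shift hu hv a (-1)) (hcu.mode hcv _ _) y hf hN]

end NonChiralVOA

/-! ### Integral spin and modules -/

theorem IsModeSystem.eq_zero_of_sub_ne_int {K V W : Type*} [Field K] [CharZero K] [Algebra ℝ K]
    [Algebra K ℂ] [IsScalarTower ℝ K ℂ] [AddCommGroup V] [Module ℂ V] [AddCommGroup W] [Module ℂ W]
    {A : NonChiralVOA V} {gr : K × K → Submodule ℂ W} {Y : V →ₗ[ℂ] (K → K → Module.End ℂ W)}
    (S : IsModeSystem A gr Y) {m n : K} (hmn : ¬∃ k : ℤ, m - n = k) (u : V) : Y u m n = 0 := by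
  refine A.isGrading.induction (P := fun u => Y u m n = 0) ?_ (by simp) ?_ u
  · intro d u hu
    refine S.grading.hom_ext fun e w hw => ?_
    rw [LinearMap.zero_apply]
    by_contra hne
    have hu' : u ∈ A.gr (d.1, d.2) := hu
    have h1 := S.shift hu' (a := e.1) (b := e.2) hw m n
    obtain ⟨k₁, hk₁⟩ := S.single_valued e.1 e.2 (fun h0 => by
      rw [show e = (e.1, e.2) from rfl, h0, Submodule.mem_bot] at hw
      rw [hw, map_zero] at hne
      exact hne rfl)
    obtain ⟨k₂, hk₂⟩ := S.single_valued _ _ (fun h0 => by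
      rw [h0, Submodule.mem_bot] at h1
      exact hne h1)
    obtain ⟨k₃, hk₃⟩ := A.single_valued d.1 d.2 (fun h0 => by
      rw [h0, Submodule.mem_bot] at hu'
      rw [hu', map_zero] at hne
      exact hne rfl)
    have hk₄ : algebraMap ℝ K d.1 - algebraMap ℝ K d.2 = k₃ := by
      rw [← map_sub, hk₃, map_intCast]
    refine hmn ⟨k₁ + k₃ - k₂, ?_⟩
    push_cast
    rw [← hk₁, ← hk₂, ← hk₄]
    ring
  · intro x y hx hy
    rw [map_add, Pi.add_apply, Pi.add_apply, hx, hy, add_zero]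

namespace NonChiralVOA

variable {V : Type*} [AddCommGroup V] [Module ℂ V] {A : NonChiralVOA V}

theorem IsAntiChiral.L_eq_zero {u : V} (hu : A.IsAntiChiral u) : A.L (-1) u = 0 := by
  rw [← A.creation_const (A.L (-1) u), (A.translation u _ _).2, hu _ _ (by norm_num),
    smul_zero, LinearMap.zero_apply]

namespace VModule

variable {W : Type*} [AddCommGroup W] [Module ℂ W] (B : A.VModule W)

theorem isGrading : IsGrading B.gr := .of_isInternal B.gr_isInternal

theorem shift {h hb : ℝ} {a b : ℂ} {u : V} {w : W} (hu : u ∈ A.gr (h, hb)) (hw : w ∈ B.gr (a, b))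
    (m n : ℂ) : B.Y u m n w ∈ B.gr (a + h - m - 1, b + hb - n - 1) := by
  refine mem_of_eigen B.isGrading (i := id) Function.injective_id B.grading ?_ ?_
  · have h1 := LinearMap.congr_fun (B.L_zero u m n) w
    rw [Ring.lie_def, (A.grading h hb u hu).1, map_smul] at h1
    simp only [LinearMap.sub_apply, Module.End.mul_apply, (B.grading a b w hw).1, map_smul,
      LinearMap.add_apply, LinearMap.smul_apply, Pi.smul_apply] at h1
    rw [sub_eq_iff_eq_add] at h1
    rw [h1, ← add_smul, ← add_smul]
    congr 1
    simp only [id]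
    ring
  · have h1 := LinearMap.congr_fun (B.Lbar_zero u m n) w
    rw [Ring.lie_def, (A.grading h hb u hu).2, map_smul] at h1
    simp only [LinearMap.sub_apply, Module.End.mul_apply, (B.grading a b w hw).2, map_smul,
      LinearMap.add_apply, LinearMap.smul_apply, Pi.smul_apply] at h1
    rw [sub_eq_iff_eq_add] at h1
    rw [h1, ← add_smul, ← add_smul]
    congr 1
    simp only [id]
    ring

theorem isModeSystem : IsModeSystem A B.gr B.Y where
  grading := B.isGrading
  locality := B.locality
  shift hu _ _ _ hw m n := B.shift hu hw m n
  bounded := B.bounded_below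
  single_valued := B.single_valued
  -- `L̄(-1)u = 0` holds in `V`, and translation on the module then gives `∂_x̄ Y_W(u) = 0`.
  chiral {u} hu m n hn := by
    have h := (B.translation_bar u m (n + 1)).2
    rw [hu.Lbar_eq_zero, map_zero, add_sub_cancel_right] at h
    refine (smul_eq_zero.1 h.symm).resolve_left fun h0 => hn ?_
    linear_combination -h0
  antiChiral {u} hu m n hm := by
    have h := (B.translation u (m + 1) n).2
    rw [hu.L_eq_zero, map_zero, add_sub_cancel_right] at h
    refine (smul_eq_zero.1 h.symm).resolve_left fun h0 => hm ?_
    linear_combination -h0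

/-- The duality axiom at `z₂ = 1`. All three expansions are given, so `v` can be arbitrary.
Chirality of `u` turns them into Laurent series. -/
theorem hasDuality {h hb : ℝ} {u : V} (hu : u ∈ A.gr (h, hb)) (hc : A.IsChiral u) (v : V) :
    HasDuality A B.gr B.Y u v := by
  intro y f hf
  have hch := B.isModeSystem.chiralModes hu hc
  obtain ⟨m, hm⟩ := B.duality
  obtain ⟨hg, hL, hR, hI⟩ := hm u v y ⟨f, hf⟩
  refine ⟨fun z => m u v ![z, 1] y ⟨f, hf⟩, hch.differentiableOn one_ne_zero hg fun z hz =>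
    hL z 1 hz (by simp), fun z hz => ?_, fun z hz0 hz => ?_, fun z hz0 hz => ?_⟩
  · exact hch.hasSum_left (norm_pos_iff.1 (one_pos.trans hz)) (hL z 1 (by simpa using hz) (by simp))
  · exact hch.hasSum_right (norm_pos_iff.1 hz0) (hR z 1 (by simpa using hz) hz0)
  · have hz1 : z - 1 ≠ 0 := norm_pos_iff.1 hz0
    have h := hI z 1 (by simpa using hz) hz0
    have inj : Function.Injective
        fun p : ℤ × (ℂ × ℂ) => (((p.1 : ℝ), (-1 : ℝ)), p.2) := by
      rintro ⟨a, k⟩ ⟨b, l⟩ h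
      simpa using h
    rw [← inj.hasSum_iff] at h
    · refine (HasSum.fiberwise h).congr_fun fun a => ?_
      rw [pairing, ← tsum_mul_right]
      refine tsum_congr fun k => ?_
      simp only [Function.comp_apply, modePow_intCast a hz1]
      ring
    · rintro ⟨k, l⟩ hk
      rw [(A.isModeSystem.chiralModes hu hc).eq_zero_of_notMem_range (k := k)]
      · simp
      · rintro ⟨a, rfl⟩
        exact hk ⟨(a, l), rfl⟩

end VModule

end NonChiralVOA

/-! ### Exchange of x and x̄: mirror algebra and mirror module -/

/-- The conjugate configuration. -/
def conjConf {n : ℕ} (z : Fin n → ℂ) : Fin n → ℂ := fun i => (starRingEnd ℂ) (z i)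

theorem ContinuesAlong.swap {E : Type*} [NormedAddCommGroup E] [NormedSpace ℂ E]
    {γ : C(unitInterval, E × E)} {G : E × E → ℂ}
    (h : ContinuesAlong (ContinuousMap.comp ⟨Prod.swap, continuous_swap⟩ γ) G) :
    ContinuesAlong γ (fun p => G p.swap) := by
  obtain ⟨F, hF0, hF⟩ := h
  have ht : ∀ t, Tendsto Prod.swap (𝓝 (γ t)) (𝓝 (γ t).swap) := fun t =>
    continuous_swap.tendsto _
  refine ⟨fun t p => F t p.swap, (ht 0).eventually hF0, fun t => ⟨?_, ?_⟩⟩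
  · exact AnalyticAt.fun_comp (f := fun p : E × E => p.swap) (hF t).1
      ((ContinuousLinearEquiv.prodComm ℂ E E : E × E →L[ℂ] E × E).analyticAt _)
  · filter_upwards [(hF t).2] with s hs
    exact (ht s).eventually hs

theorem IsCorrelationFunction.conj {n : ℕ} {g : (Fin n → ℂ) → ℂ} (hg : IsCorrelationFunction g) :
    IsCorrelationFunction fun z => g (conjConf z) := by
  intro z hz
  have hz' : conjConf z ∈ Conf n := ⟨fun i => by simpa [conjConf] using hz.1 i, fun i j hij =>
    hz.2 ((starRingEnd ℂ).injective hij)⟩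
  have hsw : ∀ y : Fin n → ℂ, (conjPt y).swap = conjPt (conjConf y) := fun y =>
    Prod.ext rfl (funext fun i => by simp [conjPt, conjConf])
  obtain ⟨G, hG, hGg, hc⟩ := hg _ hz'
  rw [← hsw] at hG hc
  refine ⟨fun p => G p.swap, ?_, ?_, ?_⟩
  · exact AnalyticAt.fun_comp (f := fun p : (Fin n → ℂ) × (Fin n → ℂ) => p.swap) hG
      ((ContinuousLinearEquiv.prodComm ℂ (Fin n → ℂ) (Fin n → ℂ) :
        (Fin n → ℂ) × (Fin n → ℂ) →L[ℂ] (Fin n → ℂ) × (Fin n → ℂ)).analyticAt _)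
  · have hcont : Continuous (conjConf (n := n)) :=
      continuous_pi fun i => Complex.continuous_conj.comp (continuous_apply i)
    filter_upwards [hcont.continuousAt.eventually hGg] with y hy
    rw [hsw, hy]
  · intro γ h0 hγ
    refine ContinuesAlong.swap (hc _ ?_ fun t => ?_)
    · simp [h0]
    · exact ⟨(hγ t).2, (hγ t).1⟩

section Swap

variable {K V W : Type*} [Field K] [CharZero K] [Algebra K ℂ] [AddCommGroup V] [Module ℂ V]
  [AddCommGroup W] [Module ℂ W]

set_option linter.unusedSectionVars false

/-- Logarithm and conjugation commute off the negative real axis. On it they differ by `2πi`, which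
is harmless because the exponents of `z` and `z̄` differ by an integer. -/
theorem modePow_swap {k : K × K} {j : ℤ} (hj : k.1 - k.2 = j) (z : ℂ) :
    modePow k.swap ((starRingEnd ℂ) z) = modePow k z := by
  have hj' : algebraMap K ℂ k.1 - algebraMap K ℂ k.2 = j := by rw [← map_sub, hj, map_intCast]
  simp only [modePow, conjPow, Prod.fst_swap, Prod.snd_swap]
  by_cases hz : z.arg = Real.pi
  · have h1 : (starRingEnd ℂ) z = z := by
      rw [Complex.conj_eq_iff_im]
      exact (Complex.arg_eq_pi_iff.1 hz).2
    have h2 : Complex.log z - (starRingEnd ℂ) (Complex.log z) = 2 * Real.pi * Complex.I := by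
      rw [Complex.sub_conj, Complex.log_im, hz]
      push_cast
      ring
    rw [h1, Complex.exp_eq_exp_iff_exists_int]
    refine ⟨j, ?_⟩
    rw [← hj', ← h2]
    ring
  · rw [Complex.log_conj _ hz, Complex.conj_conj, add_comm]

/-- The vertex operator map with the roles of `x` and `x̄` exchanged. -/
def swapModes (Y : V →ₗ[ℂ] (K → K → Module.End ℂ W)) : V →ₗ[ℂ] (K → K → Module.End ℂ W) where
  toFun u m n := Y u n m
  map_add' u v := by
    funext m n
    rw [map_add]
    rfl
  map_smul' c u := by
    funext m n
    rw [map_smul]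
    rfl

/-- All exponents `m - n` of `z` relative to `z̄` are integers. -/
def IntegralSpin (Y : V →ₗ[ℂ] (K → K → Module.End ℂ W)) : Prop :=
  ∀ (u : V) (m n : K), (¬∃ j : ℤ, m - n = (j : K)) → Y u m n = 0

/-- Exchanging the indices of each mode matches the two series term by term: terms with a
non-integral spin vanish on both sides, and `modePow_swap` covers the rest. -/
theorem hasSum_productTerm_swap {Y : V →ₗ[ℂ] (K → K → Module.End ℂ W)} (hY : IntegralSpin Y)
    {n : ℕ} {u : Fin n → V} {z : Fin n → ℂ} {w : W} {f : Module.Dual ℂ W} {S : ℂ}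
    (h : HasSum (productTerm Y u (conjConf z) w f) S) :
    HasSum (productTerm (swapModes Y) u z w f) S := by
  rw [← (Equiv.piCongrRight fun _ : Fin n => Equiv.prodComm K K).hasSum_iff] at h
  refine h.congr_fun fun k => ?_
  simp only [Function.comp_apply, productTerm, Equiv.piCongrRight_apply, Pi.map_apply,
    Equiv.prodComm_apply, Prod.fst_swap, Prod.snd_swap]
  by_cases hk : ∀ i, ∃ j : ℤ, (k i).1 - (k i).2 = (j : K)
  · congr 1
    refine Finset.prod_congr rfl fun i _ => ?_
    obtain ⟨j, hj⟩ := hk i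
    exact (modePow_swap hj (z i)).symm
  · push Not at hk
    obtain ⟨i, hi⟩ := hk
    have h0 : Y (u i) (k i).2 (k i).1 = 0 := hY _ _ _ fun ⟨j, hj⟩ => hi (-j) (by
      push_cast
      rw [← hj]
      ring)
    have h1 : (List.ofFn fun i => Y (u i) (k i).2 (k i).1).prod = 0 :=
      List.prod_eq_zero (by rw [List.mem_ofFn]; exact ⟨i, h0⟩)
    have h2 : (List.ofFn fun i => swapModes Y (u i) (k i).1 (k i).2).prod = 0 := h1
    rw [h1, h2]
    simp

variable {gr : K × K → Submodule ℂ W}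

theorem contragredient_swap_le : contragredient (fun e : K × K => gr e.swap) ≤ contragredient gr := by
  intro f hf
  have hf' : {a : K × K | ∃ v ∈ gr a.swap, f v ≠ 0}.Finite := hf
  refine (hf'.image Prod.swap).subset ?_
  rintro a ⟨v, hv, hne⟩
  exact ⟨a.swap, ⟨v, by simpa using hv, hne⟩, a.swap_swap⟩

/-- Restriction of matrix elements to fewer functionals. -/
def restrictDual {p q : Submodule ℂ (Module.Dual ℂ W)} (h : q ≤ p) :
    (W →ₗ[ℂ] (p →ₗ[ℂ] ℂ)) →ₗ[ℂ] (W →ₗ[ℂ] (q →ₗ[ℂ] ℂ)) where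
  toFun φ := (LinearMap.lcomp ℂ ℂ (Submodule.inclusion h)) ∘ₗ φ
  map_add' _ _ := LinearMap.comp_add _ _ _
  map_smul' _ _ := LinearMap.comp_smul _ _ _

/-- Restriction of the matrix elements of an operator-valued function to fewer functionals,
precomposed with complex conjugation of the variables. -/
def swapDual {p q : Submodule ℂ (Module.Dual ℂ W)} (h : q ≤ p) {n : ℕ} :
    ((Fin n → ℂ) → W →ₗ[ℂ] (p →ₗ[ℂ] ℂ)) →ₗ[ℂ] ((Fin n → ℂ) → W →ₗ[ℂ] (q →ₗ[ℂ] ℂ)) where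
  toFun m z := restrictDual h (m (conjConf z))
  map_add' _ _ := funext fun _ => map_add (restrictDual h) _ _
  map_smul' _ _ := funext fun _ => map_smul (restrictDual h) _ _

theorem IsLocal.swap {Y : V →ₗ[ℂ] (K → K → Module.End ℂ W)} (hY : IntegralSpin Y)
    (h : IsLocal gr Y) : IsLocal (fun e : K × K => gr e.swap) (swapModes Y) := by
  intro n u
  obtain ⟨m, hm₁, hm₂⟩ := h n u
  refine ⟨fun z => restrictDual contragredient_swap_le (m (conjConf z)), fun w f =>
    (hm₁ w (Submodule.inclusion contragredient_swap_le f)).conj, fun σ z hz hσ w f => ?_⟩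
  exact hasSum_productTerm_swap hY (hm₂ σ (conjConf z) (fun i => by simpa [conjConf] using hz i)
    (by simpa [conjConf] using hσ) w (Submodule.inclusion contragredient_swap_le f))

theorem isInternal_swap [DecidableEq (K × K)] (h : DirectSum.IsInternal gr) :
    DirectSum.IsInternal fun e : K × K => gr e.swap :=
  (DirectSum.isInternal_submodule_iff_iSupIndep_and_iSup_eq_top _).2
    ⟨h.submodule_iSupIndep.comp Prod.swap_injective,
      ((Equiv.prodComm K K).iSup_comp (g := gr)).trans h.submodule_iSup_eq_top⟩

end Swap

namespace NonChiralVOA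

variable {V : Type*} [AddCommGroup V] [Module ℂ V] (A : NonChiralVOA V)

theorem integralSpin : IntegralSpin A.Y := fun u _ _ h =>
  A.isModeSystem.eq_zero_of_sub_ne_int h u

/-- The vertex operator algebra with the roles of `x` and `x̄` exchanged. -/
noncomputable def mirror : NonChiralVOA V where
  c := A.cbar
  cbar := A.c
  gr e := A.gr e.swap
  gr_isInternal := isInternal_swap A.gr_isInternal
  Y := swapModes A.Y
  vac := A.vac
  omega := A.omegabar
  omegabar := A.omega
  vac_mem := A.vac_mem
  omega_mem := A.omegabar_mem
  omegabar_mem := A.omega_mem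
  identity m n := by
    exact (A.identity n m).trans (if_congr and_comm rfl rfl)
  finite_dim a := A.finite_dim a.swap
  bounded_below := by
    obtain ⟨M, hM⟩ := A.bounded_below
    exact ⟨M, fun h hb hlt => hM hb h hlt.symm⟩
  single_valued h hb hne := by
    obtain ⟨k, hk⟩ := A.single_valued hb h hne
    refine ⟨-k, ?_⟩
    push_cast
    rw [← hk]
    ring
  creation_nonneg v m n hmn := A.creation_nonneg v n m fun h => hmn h.symm
  creation_const := A.creation_const
  L := A.Lbar
  Lbar := A.L
  omega_mode := A.omegabar_mode
  omega_mode_zero r s h := A.omegabar_mode_zero s r h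
  omegabar_mode := A.omega_mode
  omegabar_mode_zero r s h := A.omega_mode_zero s r h
  virasoro := A.virasoro_bar
  virasoro_bar := A.virasoro
  virasoro_comm m n := by
    have h := A.virasoro_comm n m
    rw [Ring.lie_def, sub_eq_zero] at h ⊢
    exact h.symm
  grading h hb v hv := (A.grading hb h v hv).symm
  L_zero u m n := A.Lbar_zero u n m
  Lbar_zero u m n := A.L_zero u n m
  translation u m n := A.translation_bar u n m
  translation_bar u m n := A.translation u n m
  locality := A.locality.swap A.integralSpin

variable {A}

theorem isChiral_mirror {u : V} : A.mirror.IsChiral u ↔ A.IsAntiChiral u :=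
  ⟨fun h m n hm => h n m hm, fun h m n hn => h n m hn⟩

namespace VModule

variable {W : Type*} [AddCommGroup W] [Module ℂ W] (B : A.VModule W)

theorem integralSpin : IntegralSpin B.Y := fun u _ _ h =>
  B.isModeSystem.eq_zero_of_sub_ne_int h u

/-- The duality function of `B` at conjugate positions. Conjugation preserves all three domains. -/
theorem mirror_duality : ∃ m : V →ₗ[ℂ] V →ₗ[ℂ]
      ((Fin 2 → ℂ) → W →ₗ[ℂ] (contragredient (fun e : ℂ × ℂ => B.gr e.swap) →ₗ[ℂ] ℂ)),
    ∀ (u₁ u₂ : V) (w : W) (f : contragredient (fun e : ℂ × ℂ => B.gr e.swap)),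
      IsCorrelationFunction (fun z => m u₁ u₂ z w f) ∧
      (∀ z₁ z₂ : ℂ, ‖z₂‖ < ‖z₁‖ → 0 < ‖z₂‖ →
        HasSum (productTerm (swapModes B.Y) ![u₁, u₂] ![z₁, z₂] w (f : Module.Dual ℂ W))
          (m u₁ u₂ ![z₁, z₂] w f)) ∧
      (∀ z₁ z₂ : ℂ, ‖z₁‖ < ‖z₂‖ → 0 < ‖z₁‖ →
        HasSum (productTerm (swapModes B.Y) ![u₂, u₁] ![z₂, z₁] w (f : Module.Dual ℂ W))
          (m u₁ u₂ ![z₁, z₂] w f)) ∧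
      (∀ z₁ z₂ : ℂ, ‖z₁ - z₂‖ < ‖z₂‖ → 0 < ‖z₁ - z₂‖ →
        HasSum (fun k : (ℝ × ℝ) × (ℂ × ℂ) =>
            (f : Module.Dual ℂ W)
              (swapModes B.Y (swapModes A.Y u₁ k.1.1 k.1.2 u₂) k.2.1 k.2.2 w) *
              (modePow k.1 (z₁ - z₂) * modePow k.2 z₂))
          (m u₁ u₂ ![z₁, z₂] w f)) := by
  obtain ⟨m, hm⟩ := B.duality
  refine ⟨m.compr₂ (swapDual contragredient_swap_le), fun u₁ u₂ w f => ?_⟩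
  have hconj : ∀ z₁ z₂ : ℂ, conjConf ![z₁, z₂] = ![(starRingEnd ℂ) z₁, (starRingEnd ℂ) z₂] := by
    intro z₁ z₂
    funext i
    fin_cases i <;> rfl
  have hval : ∀ z, m.compr₂ (swapDual contragredient_swap_le) u₁ u₂ z w f =
      m u₁ u₂ (conjConf z) w (Submodule.inclusion contragredient_swap_le f) := fun _ => rfl
  have hnorm : ∀ z₁ z₂ : ℂ, ‖(starRingEnd ℂ) z₁ - (starRingEnd ℂ) z₂‖ = ‖z₁ - z₂‖ := by
    intro z₁ z₂
    rw [← map_sub, Complex.norm_conj]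
  obtain ⟨h₁, h₂, h₃, h₄⟩ := hm u₁ u₂ w (Submodule.inclusion contragredient_swap_le f)
  simp only [hval]
  refine ⟨h₁.conj, fun z₁ z₂ hlt h0 => ?_, fun z₁ z₂ hlt h0 => ?_, fun z₁ z₂ hlt h0 => ?_⟩
  · refine hasSum_productTerm_swap B.integralSpin ?_
    rw [hconj]
    exact h₂ _ _ (by simpa using hlt) (by simpa using h0)
  · refine hasSum_productTerm_swap B.integralSpin ?_
    rw [hconj, hconj]
    exact h₃ _ _ (by simpa using hlt) (by simpa using h0)
  · have h := h₄ ((starRingEnd ℂ) z₁) ((starRingEnd ℂ) z₂) (by rw [hnorm]; simpa using hlt)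
      (by rwa [hnorm])
    rw [hconj]
    rw [← ((Equiv.prodComm ℝ ℝ).prodCongr (Equiv.prodComm ℂ ℂ)).hasSum_iff] at h
    refine h.congr_fun fun k => ?_
    simp only [Function.comp_apply, Equiv.prodCongr_apply, Prod.map_fst, Prod.map_snd,
      Equiv.prodComm_apply, Prod.fst_swap, Prod.snd_swap]
    by_cases hk₁ : ∃ j : ℤ, k.1.1 - k.1.2 = (j : ℝ)
    · by_cases hk₂ : ∃ j : ℤ, k.2.1 - k.2.2 = (j : ℂ)
      · obtain ⟨j₁, hj₁⟩ := hk₁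
        obtain ⟨j₂, hj₂⟩ := hk₂
        rw [← map_sub, modePow_swap hj₁, modePow_swap hj₂]
        rfl
      · have h0 : ∀ v : V, B.Y v k.2.2 k.2.1 = 0 := fun v =>
          B.integralSpin _ _ _ fun ⟨j, hj⟩ => hk₂ ⟨-j, by push_cast; rw [← hj]; ring⟩
        have h1 : ∀ v : V, swapModes B.Y v k.2.1 k.2.2 = 0 := h0
        rw [h0, h1]
        simp
    · have h0 : A.Y u₁ k.1.2 k.1.1 = 0 :=
          A.integralSpin _ _ _ fun ⟨j, hj⟩ => hk₁ ⟨-j, by push_cast; rw [← hj]; ring⟩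
      have h1 : swapModes A.Y u₁ k.1.1 k.1.2 = 0 := h0
      rw [h0, h1]
      simp

/-- The module with the roles of `x` and `x̄` exchanged. -/
noncomputable def mirror : A.mirror.VModule W where
  gr e := B.gr e.swap
  gr_isInternal := isInternal_swap B.gr_isInternal
  Y := swapModes B.Y
  identity m n := by
    exact (B.identity n m).trans (if_congr and_comm rfl rfl)
  finite_dim a := B.finite_dim a.swap
  bounded_below := by
    obtain ⟨M, hM⟩ := B.bounded_below
    exact ⟨M, fun h hb hlt => hM hb h hlt.symm⟩
  single_valued h hb hne := by
    obtain ⟨k, hk⟩ := B.single_valued hb h hne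
    refine ⟨-k, ?_⟩
    push_cast
    rw [← hk]
    ring
  L := B.Lbar
  Lbar := B.L
  omega_mode := B.omegabar_mode
  omega_mode_zero r s h := B.omegabar_mode_zero s r h
  omegabar_mode := B.omega_mode
  omegabar_mode_zero r s h := B.omega_mode_zero s r h
  virasoro := B.virasoro_bar
  virasoro_bar := B.virasoro
  grading h hb v hv := (B.grading hb h v hv).symm
  L_zero u m n := B.Lbar_zero u n m
  Lbar_zero u m n := B.L_zero u n m
  translation u m n := B.translation_bar u n m
  translation_bar u m n := B.translation u n m
  locality := B.locality.swap B.integralSpin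
  duality := B.mirror_duality

end VModule

end NonChiralVOA

/-! ### The identities in terms of the normalized modes -/

theorem hasFiniteSum_zero {M : Type*} [AddCommMonoid M] {f : ℕ → M} (hf : ∀ j, f j = 0) :
    HasFiniteSum f 0 :=
  hasFiniteSum_of_range 0 (fun r _ => hf r) (by simp)

theorem HasFiniteSum.unique {M : Type*} [AddCommMonoid M] {f : ℕ → M} {s t : M}
    (hs : HasFiniteSum f s) (ht : HasFiniteSum f t) : s = t :=
  hs.2.symm.trans ht.2

theorem binom_eq {s : ℝ} {a : ℤ} (h : s = a) (j : ℕ) : binom s j = Ring.choose (a : ℂ) j := by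
  rw [binom, h, Complex.ofReal_choose, Complex.ofReal_intCast]

/-- The reflection `r ↦ m - r` carries the first sum to the second once the factors commute. -/
theorem sum_choose_eq_zero_of_commute {E : Type*} [Ring E] [Module ℂ E] {X Z : ℝ → E}
    (h : ∀ (a : ℤ) (b : ℝ), Commute (X a) (Z b)) (m : ℕ) (n k : ℤ) :
    ∑ r ∈ Finset.range (m + 1), (m.choose r : ℂ) •
        ((-1 : ℂ) ^ r • (X (n + m - r) * Z (k + r)) -
          (-1 : ℂ) ^ (m + r) • (Z (k + m - r) * X (n + r))) = 0 := by
  simp only [smul_sub, Finset.sum_sub_distrib]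
  rw [sub_eq_zero, ← Finset.sum_range_reflect (n := m + 1)]
  refine Finset.sum_congr rfl fun r hr => ?_
  have hr : r ≤ m := Nat.lt_succ_iff.1 (Finset.mem_range.1 hr)
  rw [show m + 1 - 1 - r = m - r by omega, Nat.choose_symm hr, Nat.cast_sub hr]
  have h1 : (-1 : ℂ) ^ (m - r) = (-1) ^ (m + r) := by
    rw [show m + r = (m - r) + 2 * r by omega, pow_add, pow_mul]
    simp
  have h2 := (h (n + r) (k + m - r)).eq
  push_cast at h2
  rw [h1, ← h2, show (n : ℝ) + m - (m - r) = n + r by ring,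
    show (k : ℝ) + (m - r) = k + m - r by ring]

theorem NonChiralVOA.exists_int {V : Type*} [AddCommGroup V] [Module ℂ V] {A : NonChiralVOA V}
    {h hb : ℝ} {u : V} (hu : u ∈ A.gr (h, hb)) (hne : u ≠ 0) : ∃ k : ℤ, h - hb = k :=
  A.single_valued h hb fun h0 => hne (by rwa [h0, Submodule.mem_bot] at hu)

theorem NonChiralVOA.x_mem {V : Type*} [AddCommGroup V] [Module ℂ V] {A : NonChiralVOA V}
    {h hb h' hb' : ℝ} {u v : V} (hu : u ∈ A.gr (h, hb)) (hv : v ∈ A.gr (h', hb')) (p : ℝ) :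
    A.x h hb u p v ∈ A.gr (h' - p + hb, hb + hb') := by
  have := A.shift hu hv (p + (h - hb) - 1) (-1)
  rw [x]
  convert this using 3 <;> ring

section System

variable {K V W : Type*} [Field K] [CharZero K] [Algebra ℝ K] [Algebra K ℂ]
  [IsScalarTower ℝ K ℂ] [AddCommGroup V] [Module ℂ V] [AddCommGroup W] [Module ℂ W]

set_option linter.unusedSectionVars false

/-- The mode of `Y(u)` at `x ^ (-s-(h-h̄))`. -/
def chiralMode (Y : V →ₗ[ℂ] (K → K → Module.End ℂ W)) (h hb : ℝ) (u : V) (s : ℝ) :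
    Module.End ℂ W := Y u (algebraMap ℝ K (s + (h - hb) - 1)) (-1)

/-- The mode of `Y(v)` at `x̄ ^ (-s-(h̄-h))`. -/
def antiChiralMode (Y : V →ₗ[ℂ] (K → K → Module.End ℂ W)) (h hb : ℝ) (v : V) (s : ℝ) :
    Module.End ℂ W := Y v (-1) (algebraMap ℝ K (s + (hb - h) - 1))

/-- The span of all modes of homogeneous chiral vectors. -/
def chiralSpan (A : NonChiralVOA V) (Y : V →ₗ[ℂ] (K → K → Module.End ℂ W)) :
    Submodule ℂ (Module.End ℂ W) :=
  Submodule.span ℂ {T | ∃ (h hb : ℝ) (u : V) (n : ℤ),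
    u ∈ A.gr (h, hb) ∧ A.IsChiral u ∧ T = chiralMode Y h hb u n}

/-- The span of all modes of homogeneous anti-chiral vectors. -/
def antiChiralSpan (A : NonChiralVOA V) (Y : V →ₗ[ℂ] (K → K → Module.End ℂ W)) :
    Submodule ℂ (Module.End ℂ W) :=
  Submodule.span ℂ {T | ∃ (h hb : ℝ) (u : V) (n : ℤ),
    u ∈ A.gr (h, hb) ∧ A.IsAntiChiral u ∧ T = antiChiralMode Y h hb u n}

variable {A : NonChiralVOA V} {gr : K × K → Submodule ℂ W}
  {Y : V →ₗ[ℂ] (K → K → Module.End ℂ W)} {h hb h' hb' : ℝ} {u v : V}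

theorem chiralMode_eq {s : ℝ} {a : ℤ} (hs : s + (h - hb) - 1 = a) (u : V) :
    chiralMode Y h hb u s = Y u a (-1) := by
  rw [chiralMode, hs, map_intCast]

@[simp]
theorem chiralMode_zero (s : ℝ) : chiralMode Y h hb 0 s = 0 := by
  simp [chiralMode]

namespace IsModeSystem

theorem eq_zero_of_chiral (S : IsModeSystem A gr Y) (hu : u ∈ A.gr (h, hb)) (hc : A.IsChiral u)
    {r s : K} (hrs : s ≠ -1 ∨ ∀ n : ℤ, r ≠ algebraMap ℝ K (n + (h - hb) - 1)) : Y u r s = 0 := by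
  by_cases hne : u = 0
  · simp [hne]
  obtain ⟨k, hk⟩ := NonChiralVOA.exists_int hu hne
  refine S.chiralModes hu hc r s (hrs.imp_right fun hr a ha => hr (a - k + 1) ?_)
  rw [ha, hk, ← map_intCast (algebraMap ℝ K)]
  congr 1
  push_cast
  ring

theorem chiral_borcherds (S : IsModeSystem A gr Y) (hu : u ∈ A.gr (h, hb))
    (hv : v ∈ A.gr (h', hb')) (hcu : A.IsChiral u) (hcv : A.IsChiral v)
    (hd : HasDuality A gr Y u v) (m n k : ℤ) :
    ∃ T : Module.End ℂ W,
      HasFiniteSum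
        (fun j : ℕ => binom (n + (h - hb) - 1) j •
          chiralMode Y (h' - (j + 1 - (h - hb) + m) + hb) (hb + hb')
            (A.x h hb u (j + 1 - (h - hb) + m) v) (k + n + m + hb - hb')) T ∧
      ∀ w : W, HasFiniteSum
        (fun r : ℕ => binom m r •
          ((-1 : ℂ) ^ r • chiralMode Y h hb u (n + m - r) (chiralMode Y h' hb' v (k + r) w) -
            (-1 : ℂ) ^ (m + r) • chiralMode Y h' hb' v (k + m - r)
              (chiralMode Y h hb u (n + r) w)))
        (T w) := by
  -- The zero vector lies in every degree, so its nominal weights need not satisfy `h - h̄ ∈ ℤ` or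
  -- `h̄ = 0`. It is treated apart.
  by_cases hu0 : u = 0
  · subst hu0
    exact ⟨0, hasFiniteSum_zero fun j => by simp [NonChiralVOA.x],
      fun w => hasFiniteSum_zero fun r => by simp⟩
  by_cases hv0 : v = 0
  · subst hv0
    exact ⟨0, hasFiniteSum_zero fun j => by simp, fun w => hasFiniteSum_zero fun r => by simp⟩
  obtain ⟨D, hD⟩ := NonChiralVOA.exists_int hu hu0
  obtain ⟨D', hD'⟩ := NonChiralVOA.exists_int hv hv0
  have hb0 := hcu.hb_eq_zero hu hu0
  have hb0' := hcv.hb_eq_zero hv hv0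
  subst hb0 hb0'
  obtain ⟨J, hJ⟩ := A.isModeSystem.eventually_zero hu v
  -- With `h̄ = h̄' = 0`, `x_n(u)` is the mode `n + D - 1` of `u`, and `x_k(v)` is the mode `k + D'
  -- - 1` of `v`.
  obtain ⟨T, hT, hTw⟩ := S.borcherds hu hv hd (fun a => by
    have := A.shift hu hv a (-1)
    convert this using 3
    ring) hJ (n + D - 1) m (k + D' - 1)
  have hx : ∀ j : ℕ, A.x h 0 u (j + 1 - (h - 0) + m) v = A.Y u (m + j : ℤ) (-1) v := by
    intro j
    rw [NonChiralVOA.x, show (j + 1 - (h - 0) + m + (h - 0) - 1 : ℝ) = (m + j : ℤ) by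
      push_cast
      ring]
  refine ⟨T, ?_, fun w => ?_⟩
  · convert hT using 2 with j
    rw [hx, binom_eq (a := n + D - 1) (by rw [hD]; push_cast; ring),
      chiralMode_eq (a := n + D - 1 + (k + D' - 1) - j)]
    push_cast
    rw [← hD, ← hD']
    ring
  · convert hTw w using 2 with r
    rw [binom_eq (a := m) rfl, chiralMode_eq (a := n + D - 1 + m - r),
      chiralMode_eq (a := k + D' - 1 + r), chiralMode_eq (a := k + D' - 1 + m - r),
      chiralMode_eq (a := n + D - 1 + r)]
    all_goals
      push_cast
      rw [← sub_eq_zero]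
      first
        | (rw [hD]; ring1)
        | (rw [hD']; ring1)

/-- The case `m = 0` of the Borcherds identity, where `binom(0, r)` leaves only `r = 0`. -/
theorem chiral_commutator (S : IsModeSystem A gr Y) (hu : u ∈ A.gr (h, hb))
    (hv : v ∈ A.gr (h', hb')) (hcu : A.IsChiral u) (hcv : A.IsChiral v)
    (hd : HasDuality A gr Y u v) (n k : ℤ) :
    HasFiniteSum
      (fun j : ℕ => binom (n + (h - hb) - 1) j •
        chiralMode Y (h' - (j + 1 - (h - hb)) + hb) (hb + hb')
          (A.x h hb u (j + 1 - (h - hb)) v) (k + n))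
      ⁅chiralMode Y h hb u n, chiralMode Y h' hb' v k⁆ := by
  by_cases hu0 : u = 0
  · subst hu0
    rw [chiralMode_zero, Ring.lie_def, zero_mul, mul_zero, sub_zero]
    exact hasFiniteSum_zero fun j => by simp [NonChiralVOA.x]
  by_cases hv0 : v = 0
  · subst hv0
    rw [chiralMode_zero, Ring.lie_def, zero_mul, mul_zero, sub_zero]
    exact hasFiniteSum_zero fun j => by simp
  obtain ⟨T, hT, hTw⟩ := S.chiral_borcherds hu hv hcu hcv hd 0 n k
  -- The Borcherds identity carries the extra shift `h̄ - h̄'`, which vanishes here.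
  have hb0 := hcu.hb_eq_zero hu hu0
  have hb0' := hcv.hb_eq_zero hv hv0
  subst hb0 hb0'
  have hTe : T = ⁅chiralMode Y h 0 u n, chiralMode Y h' 0 v k⁆ := by
    ext w
    refine (hTw w).unique (hasFiniteSum_of_range 1 (fun r hr => ?_) ?_)
    · obtain ⟨r, rfl⟩ := Nat.exists_eq_add_of_le' hr
      simp [binom, Ring.choose_zero_succ]
    · simp [binom, Ring.lie_def]
  rw [← hTe]
  simpa using hT

/-- The commutator formula for the chiral vector `ω` of weight `(2, 0)`, whose normalized modes are
the Virasoro operators. -/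
theorem chiral_virasoro (S : IsModeSystem A gr Y) (hu : u ∈ A.gr (h, hb)) (hc : A.IsChiral u)
    (hd : HasDuality A gr Y A.omega u) {n : ℤ} {T : Module.End ℂ W}
    (hT : Y A.omega (n + 1) (-1) = T) (k : ℤ) :
    HasFiniteSum
      (fun j : ℕ => binom (n + 1) j • chiralMode Y (h - (j - 1)) hb (A.L (j - 1) u) (k + n))
      ⁅T, chiralMode Y h hb u k⁆ := by
  have key := S.chiral_commutator A.omega_mem hu A.omega_isChiral hc hd n k
  have h1 : chiralMode Y 2 0 A.omega n = T := by
    rw [← hT, chiralMode_eq (a := n + 1) (by push_cast; ring)]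
    push_cast
    rfl
  rw [h1] at key
  refine (congrArg (HasFiniteSum · _) (funext fun j => ?_)).mp key
  have h2 : A.x 2 0 A.omega (j + 1 - (2 - 0)) = A.L (j - 1) := by
    rw [← A.omega_mode, NonChiralVOA.x,
      show (j + 1 - (2 - 0) + (2 - 0) - 1 : ℝ) = (j - 1 : ℤ) + 1 by push_cast; ring]
  rw [h2, zero_add, show (j + 1 - (2 - 0) : ℝ) = j - 1 by ring,
    show (n + (2 - 0) - 1 : ℝ) = n + 1 by ring, add_zero]

theorem commute_chiralMode (S : IsModeSystem A gr Y) (hu : u ∈ A.gr (h, hb))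
    (hv : v ∈ A.gr (h', hb')) (hcu : A.IsChiral u) (hcv : A.IsAntiChiral v) (n : ℤ) (b : K) :
    Commute (chiralMode Y h hb u n) (Y v (-1) b) := by
  by_cases hu0 : u = 0
  · subst hu0
    rw [chiralMode_zero]
    exact Commute.zero_left _
  obtain ⟨D, hD⟩ := NonChiralVOA.exists_int hu hu0
  rw [chiralMode_eq (a := n + D - 1) (by rw [hD]; push_cast; ring)]
  exact S.commute_of_chiral_of_antiChiral hu hv hcu hcv _ _

theorem chiral_lie_antiChiral (S : IsModeSystem A gr Y) (hu : u ∈ A.gr (h, hb))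
    (hv : v ∈ A.gr (h', hb')) (hcu : A.IsChiral u) (hcv : A.IsAntiChiral v) (n k : ℤ) :
    ⁅chiralMode Y h hb u n, antiChiralMode Y h' hb' v k⁆ = 0 :=
  (S.commute_chiralMode hu hv hcu hcv n _).lie_eq

theorem chiral_antiChiral_borcherds (S : IsModeSystem A gr Y) (hu : u ∈ A.gr (h, hb))
    (hv : v ∈ A.gr (h', hb')) (hcu : A.IsChiral u) (hcv : A.IsAntiChiral v) (m : ℕ) (n k : ℤ) :
    ∑ r ∈ Finset.range (m + 1), (m.choose r : ℂ) •
      ((-1 : ℂ) ^ r • (chiralMode Y h hb u (n + m - r) * antiChiralMode Y h' hb' v (k + r)) -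
        (-1 : ℂ) ^ (m + r) •
          (antiChiralMode Y h' hb' v (k + m - r) * chiralMode Y h hb u (n + r))) = 0 :=
  sum_choose_eq_zero_of_commute (X := chiralMode Y h hb u)
    (Z := antiChiralMode Y h' hb' v) (fun a _ => S.commute_chiralMode hu hv hcu hcv a _) m n k

theorem chiral_virasoro_bar (S : IsModeSystem A gr Y) (hu : u ∈ A.gr (h, hb))
    (hc : A.IsChiral u) {b : K} {T : Module.End ℂ W} (hT : Y A.omegabar (-1) b = T) (k : ℤ) :
    ⁅T, chiralMode Y h hb u k⁆ = 0 :=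
  hT ▸ (S.commute_chiralMode hu A.omegabar_mem hc A.omegabar_isAntiChiral k _).symm.lie_eq

theorem lie_mem_chiralSpan (S : IsModeSystem A gr Y)
    (hd : ∀ {h hb h' hb' : ℝ} {u v : V}, u ∈ A.gr (h, hb) → A.IsChiral u → v ∈ A.gr (h', hb') →
      A.IsChiral v → HasDuality A gr Y u v)
    {P Q : Module.End ℂ W} (hP : P ∈ chiralSpan A Y) (hQ : Q ∈ chiralSpan A Y) :
    ⁅P, Q⁆ ∈ chiralSpan A Y := by
  refine Submodule.span_induction₂ (p := fun P Q _ _ => ⁅P, Q⁆ ∈ chiralSpan A Y) ?_ ?_ ?_ ?_ ?_ ?_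
    ?_ hP hQ
  · rintro _ _ ⟨h, hb, u, n, hu, hcu, rfl⟩ ⟨h', hb', v, k, hv, hcv, rfl⟩
    rw [← (S.chiral_commutator hu hv hcu hcv (hd hu hcu hv hcv) n k).2]
    refine finsum_induction (fun T => T ∈ chiralSpan A Y) (zero_mem _)
      (fun _ _ => add_mem) fun j => ?_
    refine Submodule.smul_mem _ _ (Submodule.subset_span ⟨_, _, _, k + n,
      NonChiralVOA.x_mem hu hv (j + 1 - (h - hb)), hcu.mode hcv _ _, ?_⟩)
    push_cast
    rfl
  · intro Q _
    rw [Ring.lie_def, zero_mul, mul_zero, sub_zero]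
    exact zero_mem _
  · intro Q _
    rw [Ring.lie_def, zero_mul, mul_zero, sub_zero]
    exact zero_mem _
  · intro P P' Q _ _ _ h1 h2
    convert add_mem h1 h2 using 1
    simp only [Ring.lie_def]
    noncomm_ring
  · intro P P' Q _ _ _ h1 h2
    convert add_mem h1 h2 using 1
    simp only [Ring.lie_def]
    noncomm_ring
  · intro c P Q _ _ h1
    rw [Ring.lie_def, smul_mul_assoc, mul_smul_comm, ← smul_sub]
    exact Submodule.smul_mem _ _ h1
  · intro c P Q _ _ h1
    rw [Ring.lie_def, smul_mul_assoc, mul_smul_comm, ← smul_sub]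
    exact Submodule.smul_mem _ _ h1

theorem lie_eq_zero_of_mem_span (S : IsModeSystem A gr Y) {P Q : Module.End ℂ W}
    (hP : P ∈ chiralSpan A Y) (hQ : Q ∈ antiChiralSpan A Y) : ⁅P, Q⁆ = 0 := by
  refine Commute.lie_eq (Submodule.span_induction₂ (p := fun P Q _ _ => Commute P Q) ?_
    (fun _ _ => .zero_left _) (fun _ _ => .zero_right _) (fun _ _ _ _ _ _ => .add_left)
    (fun _ _ _ _ _ _ => .add_right) (fun c _ _ _ _ h => h.smul_left c)
    (fun c _ _ _ _ h => h.smul_right c) hP hQ)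
  rintro _ _ ⟨h, hb, u, n, hu, hcu, rfl⟩ ⟨h', hb', v, k, hv, hcv, rfl⟩
  exact S.commute_chiralMode hu hv hcu hcv n _

end IsModeSystem

end System

/-! ### Assembly of the theorem -/

theorem chiralSpan_mirror {K V W : Type*} [Field K] [Algebra ℝ K] [AddCommGroup V] [Module ℂ V]
    [AddCommGroup W] [Module ℂ W] (A : NonChiralVOA V)
    (Y : V →ₗ[ℂ] (K → K → Module.End ℂ W)) :
    chiralSpan A.mirror (swapModes Y) = antiChiralSpan A Y := by
  refine congrArg (Submodule.span ℂ) (Set.ext fun T => ⟨?_, ?_⟩)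
  · rintro ⟨h, hb, u, n, hu, hc, hT⟩
    exact ⟨hb, h, u, n, hu, NonChiralVOA.isChiral_mirror.1 hc, hT⟩
  · rintro ⟨h, hb, u, n, hu, hc, hT⟩
    exact ⟨hb, h, u, n, hu, NonChiralVOA.isChiral_mirror.2 hc, hT⟩

end NCVOA

theorem mainTheorem10 {V : Type*} [AddCommGroup V] [Module ℂ V]
    (A : NCVOA.NonChiralVOA V) :
    -- vertex operators on the algebra itself
    (
    -- expansions of the chiral and anti-chiral vertex operators
    (∀ (h hb : ℝ) (u : V), u ∈ A.gr (h, hb) → A.IsChiral u →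
      ∀ r s : ℝ, (s ≠ -1 ∨ ∀ n : ℤ, r ≠ n + (h - hb) - 1) → A.Y u r s = 0) ∧
    (∀ (h hb : ℝ) (v : V), v ∈ A.gr (h, hb) → A.IsAntiChiral v →
      ∀ r s : ℝ, (r ≠ -1 ∨ ∀ n : ℤ, s ≠ n + (hb - h) - 1) → A.Y v r s = 0) ∧
    -- chiral vectors: closure, commutator, and Borcherds identity (`p = j + 1 - (h - hb)`)
    (∀ (h hb h' hb' : ℝ) (u v : V), u ∈ A.gr (h, hb) → v ∈ A.gr (h', hb') →
      A.IsChiral u → A.IsChiral v →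
      (∀ p : ℤ, A.IsChiral (A.x h hb u p v) ∧
        A.x h hb u p v ∈ A.gr (h' - p + hb, hb + hb')) ∧
      (∀ n k : ℤ, NCVOA.HasFiniteSum
        (fun j : ℕ => NCVOA.binom (n + (h - hb) - 1) j •
          A.x (h' - (j + 1 - (h - hb)) + hb) (hb + hb') (A.x h hb u (j + 1 - (h - hb)) v) (k + n))
        ⁅A.x h hb u n, A.x h' hb' v k⁆) ∧
      (∀ m n k : ℤ, ∃ S : Module.End ℂ V,
        NCVOA.HasFiniteSum
          (fun j : ℕ => NCVOA.binom (n + (h - hb) - 1) j •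
            A.x (h' - (j + 1 - (h - hb) + m) + hb) (hb + hb')
              (A.x h hb u (j + 1 - (h - hb) + m) v) (k + n + m + hb - hb')) S ∧
        ∀ w : V, NCVOA.HasFiniteSum
          (fun r : ℕ => NCVOA.binom m r •
            ((-1 : ℂ) ^ r • A.x h hb u (n + m - r) (A.x h' hb' v (k + r) w) -
              (-1 : ℂ) ^ (m + r) • A.x h' hb' v (k + m - r) (A.x h hb u (n + r) w)))
          (S w))) ∧
    -- anti-chiral vectors (`p = j + 1 - (hb - h)`)
    (∀ (h hb h' hb' : ℝ) (u v : V), u ∈ A.gr (h, hb) → v ∈ A.gr (h', hb') →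
      A.IsAntiChiral u → A.IsAntiChiral v →
      (∀ p : ℤ, A.IsAntiChiral (A.xbar h hb u p v) ∧
        A.xbar h hb u p v ∈ A.gr (h + h', hb' - p + h)) ∧
      (∀ n k : ℤ, NCVOA.HasFiniteSum
        (fun j : ℕ => NCVOA.binom (n + (hb - h) - 1) j •
          A.xbar (h + h') (hb' - (j + 1 - (hb - h)) + h) (A.xbar h hb u (j + 1 - (hb - h)) v) (k + n))
        ⁅A.xbar h hb u n, A.xbar h' hb' v k⁆) ∧
      (∀ m n k : ℤ, ∃ S : Module.End ℂ V,
        NCVOA.HasFiniteSum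
          (fun j : ℕ => NCVOA.binom (n + (hb - h) - 1) j •
            A.xbar (h + h') (hb' - (j + 1 - (hb - h) + m) + h)
              (A.xbar h hb u (j + 1 - (hb - h) + m) v) (k + n + m + h - h')) S ∧
        ∀ w : V, NCVOA.HasFiniteSum
          (fun r : ℕ => NCVOA.binom m r •
            ((-1 : ℂ) ^ r • A.xbar h hb u (n + m - r) (A.xbar h' hb' v (k + r) w) -
              (-1 : ℂ) ^ (m + r) • A.xbar h' hb' v (k + m - r) (A.xbar h hb u (n + r) w)))
          (S w))) ∧
    -- chiral against anti-chiral vectors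
    (∀ (h hb h' hb' : ℝ) (u v : V), u ∈ A.gr (h, hb) → v ∈ A.gr (h', hb') →
      A.IsChiral u → A.IsAntiChiral v →
      (∀ n k : ℤ, ⁅A.x h hb u n, A.xbar h' hb' v k⁆ = 0) ∧
      (∀ (m : ℕ) (n k : ℤ), ∑ r ∈ Finset.range (m + 1), (m.choose r : ℂ) •
        ((-1 : ℂ) ^ r • (A.x h hb u (n + m - r) * A.xbar h' hb' v (k + r)) -
          (-1 : ℂ) ^ (m + r) • (A.xbar h' hb' v (k + m - r) * A.x h hb u (n + r))) = 0)) ∧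
    -- Virasoro operators (`p = j - 1`)
    (∀ (h hb : ℝ) (u : V), u ∈ A.gr (h, hb) → A.IsChiral u → ∀ n k : ℤ,
      NCVOA.HasFiniteSum
        (fun j : ℕ => NCVOA.binom (n + 1) j • A.x (h - (j - 1)) hb (A.L (j - 1) u) (k + n))
        ⁅A.L n, A.x h hb u k⁆ ∧
      ⁅A.Lbar n, A.x h hb u k⁆ = 0) ∧
    (∀ (h hb : ℝ) (v : V), v ∈ A.gr (h, hb) → A.IsAntiChiral v → ∀ n k : ℤ,
      NCVOA.HasFiniteSum
        (fun j : ℕ => NCVOA.binom (n + 1) j •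
          A.xbar h (hb - (j - 1)) (A.Lbar (j - 1) v) (k + n))
        ⁅A.Lbar n, A.xbar h hb v k⁆ ∧
      ⁅A.L n, A.xbar h hb v k⁆ = 0) ∧
    -- the chiral and the anti-chiral algebra
    (∀ S ∈ A.chiralAlgebra, ∀ T ∈ A.chiralAlgebra, ⁅S, T⁆ ∈ A.chiralAlgebra) ∧
    (∀ S ∈ A.antiChiralAlgebra, ∀ T ∈ A.antiChiralAlgebra,
      ⁅S, T⁆ ∈ A.antiChiralAlgebra) ∧
    (∀ S ∈ A.chiralAlgebra, ∀ T ∈ A.antiChiralAlgebra, ⁅S, T⁆ = 0)) ∧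
    -- module vertex operators
    (∀ (W : Type*) [AddCommGroup W] [Module ℂ W] (B : A.VModule W),
    -- expansions of the chiral and anti-chiral vertex operators
    (∀ (h hb : ℝ) (u : V), u ∈ A.gr (h, hb) → A.IsChiral u →
      ∀ r s : ℂ, (s ≠ -1 ∨ ∀ n : ℤ, r ≠ ((n + (h - hb) - 1 : ℝ) : ℂ)) → B.Y u r s = 0) ∧
    (∀ (h hb : ℝ) (v : V), v ∈ A.gr (h, hb) → A.IsAntiChiral v →
      ∀ r s : ℂ, (r ≠ -1 ∨ ∀ n : ℤ, s ≠ ((n + (hb - h) - 1 : ℝ) : ℂ)) → B.Y v r s = 0) ∧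
    -- chiral vectors: closure, commutator, and Borcherds identity (`p = j + 1 - (h - hb)`)
    (∀ (h hb h' hb' : ℝ) (u v : V), u ∈ A.gr (h, hb) → v ∈ A.gr (h', hb') →
      A.IsChiral u → A.IsChiral v →
      (∀ n k : ℤ, NCVOA.HasFiniteSum
        (fun j : ℕ => NCVOA.binom (n + (h - hb) - 1) j •
          B.x (h' - (j + 1 - (h - hb)) + hb) (hb + hb') (A.x h hb u (j + 1 - (h - hb)) v) (k + n))
        ⁅B.x h hb u n, B.x h' hb' v k⁆) ∧
      (∀ m n k : ℤ, ∃ S : Module.End ℂ W,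
        NCVOA.HasFiniteSum
          (fun j : ℕ => NCVOA.binom (n + (h - hb) - 1) j •
            B.x (h' - (j + 1 - (h - hb) + m) + hb) (hb + hb')
              (A.x h hb u (j + 1 - (h - hb) + m) v) (k + n + m + hb - hb')) S ∧
        ∀ w : W, NCVOA.HasFiniteSum
          (fun r : ℕ => NCVOA.binom m r •
            ((-1 : ℂ) ^ r • B.x h hb u (n + m - r) (B.x h' hb' v (k + r) w) -
              (-1 : ℂ) ^ (m + r) • B.x h' hb' v (k + m - r) (B.x h hb u (n + r) w)))
          (S w))) ∧
    -- anti-chiral vectors (`p = j + 1 - (hb - h)`)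
    (∀ (h hb h' hb' : ℝ) (u v : V), u ∈ A.gr (h, hb) → v ∈ A.gr (h', hb') →
      A.IsAntiChiral u → A.IsAntiChiral v →
      (∀ n k : ℤ, NCVOA.HasFiniteSum
        (fun j : ℕ => NCVOA.binom (n + (hb - h) - 1) j •
          B.xbar (h + h') (hb' - (j + 1 - (hb - h)) + h) (A.xbar h hb u (j + 1 - (hb - h)) v) (k + n))
        ⁅B.xbar h hb u n, B.xbar h' hb' v k⁆) ∧
      (∀ m n k : ℤ, ∃ S : Module.End ℂ W,
        NCVOA.HasFiniteSum
          (fun j : ℕ => NCVOA.binom (n + (hb - h) - 1) j •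
            B.xbar (h + h') (hb' - (j + 1 - (hb - h) + m) + h)
              (A.xbar h hb u (j + 1 - (hb - h) + m) v) (k + n + m + h - h')) S ∧
        ∀ w : W, NCVOA.HasFiniteSum
          (fun r : ℕ => NCVOA.binom m r •
            ((-1 : ℂ) ^ r • B.xbar h hb u (n + m - r) (B.xbar h' hb' v (k + r) w) -
              (-1 : ℂ) ^ (m + r) • B.xbar h' hb' v (k + m - r) (B.xbar h hb u (n + r) w)))
          (S w))) ∧
    -- chiral against anti-chiral vectors
    (∀ (h hb h' hb' : ℝ) (u v : V), u ∈ A.gr (h, hb) → v ∈ A.gr (h', hb') →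
      A.IsChiral u → A.IsAntiChiral v →
      (∀ n k : ℤ, ⁅B.x h hb u n, B.xbar h' hb' v k⁆ = 0) ∧
      (∀ (m : ℕ) (n k : ℤ), ∑ r ∈ Finset.range (m + 1), (m.choose r : ℂ) •
        ((-1 : ℂ) ^ r • (B.x h hb u (n + m - r) * B.xbar h' hb' v (k + r)) -
          (-1 : ℂ) ^ (m + r) • (B.xbar h' hb' v (k + m - r) * B.x h hb u (n + r))) = 0)) ∧
    -- Virasoro operators (`p = j - 1`)
    (∀ (h hb : ℝ) (u : V), u ∈ A.gr (h, hb) → A.IsChiral u → ∀ n k : ℤ,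
      NCVOA.HasFiniteSum
        (fun j : ℕ => NCVOA.binom (n + 1) j • B.x (h - (j - 1)) hb (A.L (j - 1) u) (k + n))
        ⁅B.L n, B.x h hb u k⁆ ∧
      ⁅B.Lbar n, B.x h hb u k⁆ = 0) ∧
    (∀ (h hb : ℝ) (v : V), v ∈ A.gr (h, hb) → A.IsAntiChiral v → ∀ n k : ℤ,
      NCVOA.HasFiniteSum
        (fun j : ℕ => NCVOA.binom (n + 1) j •
          B.xbar h (hb - (j - 1)) (A.Lbar (j - 1) v) (k + n))
        ⁅B.Lbar n, B.xbar h hb v k⁆ ∧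
      ⁅B.L n, B.xbar h hb v k⁆ = 0) ∧
    -- the chiral and the anti-chiral algebra
    (∀ S ∈ B.chiralAlgebra, ∀ T ∈ B.chiralAlgebra, ⁅S, T⁆ ∈ B.chiralAlgebra) ∧
    (∀ S ∈ B.antiChiralAlgebra, ∀ T ∈ B.antiChiralAlgebra,
      ⁅S, T⁆ ∈ B.antiChiralAlgebra) ∧
    (∀ S ∈ B.chiralAlgebra, ∀ T ∈ B.antiChiralAlgebra, ⁅S, T⁆ = 0)) := by
  -- The anti-chiral clauses are the chiral ones for `A.mirror` and `B.mirror`, with `h` and `h̄`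
  -- exchanged. The normalized modes agree by definition.
  refine ⟨⟨
      fun h hb u hu hc r s => A.isModeSystem.eq_zero_of_chiral hu hc,
      fun h hb v hv hc r s => A.mirror.isModeSystem.eq_zero_of_chiral (h := hb) (hb := h) hv
        (NCVOA.NonChiralVOA.isChiral_mirror.2 hc),
      fun h hb h' hb' u v hu hv hcu hcv =>
      ⟨fun p => ⟨hcu.mode hcv _ _, NCVOA.NonChiralVOA.x_mem hu hv p⟩,
        A.isModeSystem.chiral_commutator hu hv hcu hcv
          (A.hasDuality hu hcu hv hcv),
        A.isModeSystem.chiral_borcherds hu hv hcu hcv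
          (A.hasDuality hu hcu hv hcv)⟩,
      fun h hb h' hb' u v hu hv hcu hcv =>
      ⟨fun p => ⟨NCVOA.NonChiralVOA.isChiral_mirror.1 ((NCVOA.NonChiralVOA.isChiral_mirror.2 hcu).mode
          (NCVOA.NonChiralVOA.isChiral_mirror.2 hcv) _ _),
        NCVOA.NonChiralVOA.x_mem (A := A.mirror) hu hv p⟩,
        A.mirror.isModeSystem.chiral_commutator (h := hb) (hb := h) (h' := hb') (hb' := h') hu hv
          (NCVOA.NonChiralVOA.isChiral_mirror.2 hcu)
          (NCVOA.NonChiralVOA.isChiral_mirror.2 hcv)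
          (A.mirror.hasDuality hu (NCVOA.NonChiralVOA.isChiral_mirror.2 hcu) hv
            (NCVOA.NonChiralVOA.isChiral_mirror.2 hcv)),
        A.mirror.isModeSystem.chiral_borcherds (h := hb) (hb := h) (h' := hb') (hb' := h') hu hv
          (NCVOA.NonChiralVOA.isChiral_mirror.2 hcu)
          (NCVOA.NonChiralVOA.isChiral_mirror.2 hcv)
          (A.mirror.hasDuality hu (NCVOA.NonChiralVOA.isChiral_mirror.2 hcu) hv
            (NCVOA.NonChiralVOA.isChiral_mirror.2 hcv))⟩,
      fun h hb h' hb' u v hu hv hcu hcv =>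
      ⟨A.isModeSystem.chiral_lie_antiChiral hu hv hcu hcv,
        A.isModeSystem.chiral_antiChiral_borcherds hu hv hcu hcv⟩,
      fun h hb u hu hc n k =>
      ⟨A.isModeSystem.chiral_virasoro hu hc
          (A.hasDuality A.omega_mem A.omega_isChiral hu hc) (A.omega_mode n) k,
        A.isModeSystem.chiral_virasoro_bar hu hc (A.omegabar_mode n) k⟩,
      fun h hb v hv hc n k =>
      ⟨A.mirror.isModeSystem.chiral_virasoro (h := hb) (hb := h) hv
          (NCVOA.NonChiralVOA.isChiral_mirror.2 hc)
          (A.mirror.hasDuality A.mirror.omega_mem A.mirror.omega_isChiral hv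
            (NCVOA.NonChiralVOA.isChiral_mirror.2 hc)) (A.mirror.omega_mode n) k,
        A.mirror.isModeSystem.chiral_virasoro_bar (h := hb) (hb := h) hv
          (NCVOA.NonChiralVOA.isChiral_mirror.2 hc) (A.mirror.omegabar_mode n) k⟩,
      fun P hP Q hQ => A.isModeSystem.lie_mem_chiralSpan
        (fun hu hcu hv hcv => A.hasDuality hu hcu hv hcv) hP hQ,
      fun P hP Q hQ => ?_,
      fun P hP Q hQ => A.isModeSystem.lie_eq_zero_of_mem_span hP hQ⟩,
      fun W _ _ B => ⟨
      fun h hb u hu hc r s => B.isModeSystem.eq_zero_of_chiral hu hc,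
      fun h hb v hv hc r s => B.mirror.isModeSystem.eq_zero_of_chiral (h := hb) (hb := h) hv
        (NCVOA.NonChiralVOA.isChiral_mirror.2 hc),
      fun h hb h' hb' u v hu hv hcu hcv =>
      ⟨B.isModeSystem.chiral_commutator hu hv hcu hcv (B.hasDuality hu hcu _),
        B.isModeSystem.chiral_borcherds hu hv hcu hcv (B.hasDuality hu hcu _)⟩,
      fun h hb h' hb' u v hu hv hcu hcv =>
      ⟨B.mirror.isModeSystem.chiral_commutator (h := hb) (hb := h) (h' := hb') (hb' := h') hu hv
          (NCVOA.NonChiralVOA.isChiral_mirror.2 hcu)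
          (NCVOA.NonChiralVOA.isChiral_mirror.2 hcv)
          (B.mirror.hasDuality hu (NCVOA.NonChiralVOA.isChiral_mirror.2 hcu) _),
        B.mirror.isModeSystem.chiral_borcherds (h := hb) (hb := h) (h' := hb') (hb' := h') hu hv
          (NCVOA.NonChiralVOA.isChiral_mirror.2 hcu)
          (NCVOA.NonChiralVOA.isChiral_mirror.2 hcv)
          (B.mirror.hasDuality hu (NCVOA.NonChiralVOA.isChiral_mirror.2 hcu) _)⟩,
      fun h hb h' hb' u v hu hv hcu hcv =>
      ⟨B.isModeSystem.chiral_lie_antiChiral hu hv hcu hcv,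
        B.isModeSystem.chiral_antiChiral_borcherds hu hv hcu hcv⟩,
      fun h hb u hu hc n k =>
      ⟨B.isModeSystem.chiral_virasoro hu hc
          (B.hasDuality A.omega_mem A.omega_isChiral _) (B.omega_mode n) k,
        B.isModeSystem.chiral_virasoro_bar hu hc (B.omegabar_mode n) k⟩,
      fun h hb v hv hc n k =>
      ⟨B.mirror.isModeSystem.chiral_virasoro (h := hb) (hb := h) hv
          (NCVOA.NonChiralVOA.isChiral_mirror.2 hc)
          (B.mirror.hasDuality A.mirror.omega_mem A.mirror.omega_isChiral _) (B.mirror.omega_mode n) k,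
        B.mirror.isModeSystem.chiral_virasoro_bar (h := hb) (hb := h) hv
          (NCVOA.NonChiralVOA.isChiral_mirror.2 hc) (B.mirror.omegabar_mode n) k⟩,
      fun P hP Q hQ => B.isModeSystem.lie_mem_chiralSpan
        (fun hu hcu _ _ => B.hasDuality hu hcu _) hP hQ,
      fun P hP Q hQ => ?_,
      fun P hP Q hQ => B.isModeSystem.lie_eq_zero_of_mem_span hP hQ⟩⟩
  -- In the spans the weights are existentially bound in the opposite order, so the two spans are
  -- identified by a separate equality.
  · have key := NCVOA.chiralSpan_mirror A A.Y
    change P ∈ NCVOA.antiChiralSpan A A.Y at hP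
    change Q ∈ NCVOA.antiChiralSpan A A.Y at hQ
    change ⁅P, Q⁆ ∈ NCVOA.antiChiralSpan A A.Y
    rw [← key] at hP hQ ⊢
    exact A.mirror.isModeSystem.lie_mem_chiralSpan
      (fun hu hcu hv hcv => A.mirror.hasDuality hu hcu hv hcv) hP hQ
  · have key := NCVOA.chiralSpan_mirror A B.Y
    change P ∈ NCVOA.antiChiralSpan A B.Y at hP
    change Q ∈ NCVOA.antiChiralSpan A B.Y at hQ
    change ⁅P, Q⁆ ∈ NCVOA.antiChiralSpan A B.Y
    rw [← key] at hP hQ ⊢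
    exact B.mirror.isModeSystem.lie_mem_chiralSpan
      (fun hu hcu _ _ => B.mirror.hasDuality hu hcu _) hP hQ
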